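/- **Setting.** Let $(\Omega,\mathcal F,(\mathcal F_s)_{s\ge 0},\mathbb P)$ be a filtered probability space and $(X_s)_{s\ge0}$ a real process with $X_0=0$ a.s. such that $(e^{X_s})_{s\ge0}$ is an $(\mathcal F_s)$-martingale under $\mathbb P$. For $t,\tau\ge 0$ put $X^{(t)}_\tau:=X_{t+\tau}-X_t$, and let $\widetilde{\mathbb P}_t$ be the stopped-share-price measure, $d\widetilde{\mathbb P}_t/d\mathbb P=e^{X_t}$. For $\sigma>0$ let $C_{BS}(\tau,k,\sigma)=\mathcal N(d_+)-e^k\mathcal N(d_-)$, $d_\pm=-\frac{k}{\sigma\sqrt\tau}\pm\frac12\sigma\sqrt\tau$, where $\mathcal N$ is the standard Gaussian distribution function. The Type-II forward smile $\widetilde\sigma_{t,\tau}(k)$ is the unique $\sigma>0$ with $\mathbb E\big[(e^{X_{t+\tau}}-e^{k+X_t})^+\big]=C_{BS}(\tau,k,\sigma)$. **Assumption A.** For a family of random variables $(Y_\varepsilon)_{\varepsilon>0}$, where $Y_\varepsilon$ is considered under a probability measure $\mu_\varepsilon$, let $M_\varepsilon(z)=\mathbb E^{\mu_\varepsilon}[e^{zY_\varepsilon/\varepsilon}]$,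 $\Lambda_\varepsilon(u)=\varepsilon\log M_\varepsilon(u)$ and $\mathcal D_\varepsilon=\{u\in\mathbb R: M_\varepsilon(u)<\infty\}$. For complex $z$ write $\Re\Lambda_\varepsilon(z)=\varepsilon\log|M_\varepsilon(z)|$ (equal to $-\infty$ where $M_\varepsilon(z)=0$). We say that Assumption A holds with coefficients $\Lambda_0,\Lambda_1,\Lambda_2$ if the set limit $\mathcal D_0=\lim_{\varepsilon\downarrow0}\mathcal D_\varepsilon$ exists (i.e. $\bigcup_{\varepsilon>0}\bigcap_{0<s\le\varepsilon}\mathcal D_s=\bigcap_{\varepsilon>0}\bigcup_{0<s\le\varepsilon}\mathcal D_s=:\mathcal D_0$) and, writing $\mathcal D_0^o$ for its interior: 1. for each $u\in\mathcal D_0^o$, $\Lambda_\varepsilon(u)=\Lambda_0(u)+\Lambda_1(u)\varepsilon+\Lambda_2(u)\varepsilon^2+\mathcal O(\varepsilon^3)$ as $\varepsilon\downarrow0$; 2. for some $\varepsilon_0>0$ the map $(\varepsilon,u)\mapsto\Lambda_\varepsilon(u)$ is finite and $C^\infty$ on $(0,\varepsilon_0)\times\mathcal D_0^o$; 3. $0\in\mathcal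 D_0^o$; 4. $\Lambda_0$ is strictly convex and differentiable on $\mathcal D_0^o$, and $|\Lambda_0'(u_n)|\to\infty$ for every sequence in $\mathcal D_0^o$ converging to a boundary point of $\mathcal D_0^o$; 5. $\Lambda_0$ extends holomorphically to $\{z\in\mathbb C:\Re z\in\mathcal D_0^o\setminus\{0\}\}$, and for every fixed $p\in\mathcal D_0^o\setminus\{0\}$: (a) $\Re\Lambda_\varepsilon(p+iq)=\Re\Lambda_0(p+iq)+\mathcal O(\varepsilon)$, uniformly for $q$ in bounded subsets of $\mathbb R$; (b) $q\mapsto\Re\Lambda_0(p+iq)$ has a unique maximum at $q=0$ and is bounded away from $\Lambda_0(p)$ as $|q|\to\infty$; (c) there are $\varepsilon_1,q^*>0$ and $M$ such that $\Re\Lambda_\varepsilon(p+iq)-\Re\Lambda_0(p+iq)\le M\varepsilon$ for all $|q|\ge q^*$ and $0<\varepsilon\le\varepsilon_1$. **Notation.** Let $\Lambda_{i,l}=\partial_u^l\Lambda_i$. For $k\in\Lambda_{0,1}(\mathcal D_0^o)$ let $u^*=u^*(k)$ be the unique point of $\mathcal D_0^o$ with $\Lambda_{0,1}(u^*)=k$,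 and let $\Lambda^*(k)=\sup_{u\in\mathcal D_0^o}\{uk-\Lambda_0(u)\}$. With all $\Lambda_i,\Lambda_{i,l}$ evaluated at $u^*(k)$ (unless another argument is shown) put $$\Upsilon(b,k)=\Lambda_2-\frac{5\Lambda_{0,3}^2}{24\Lambda_{0,2}^3}+\frac{4\Lambda_{1,1}\Lambda_{0,3}+\Lambda_{0,4}}{8\Lambda_{0,2}^2}-\frac{\Lambda_{1,1}^2+\Lambda_{1,2}}{2\Lambda_{0,2}}-\frac{\Lambda_{0,3}}{2u^*\Lambda_{0,2}^2}-\frac{\Lambda_{0,3}}{2(u^*-b)\Lambda_{0,2}^2}-\frac{\Lambda_{1,1}(b-2u^*)+3}{u^*(u^*-b)\Lambda_{0,2}}-\frac{b^2}{(u^*)^2(u^*-b)^2\Lambda_{0,2}}.$$ **(I) Diagonal small maturity.** Let $t\ge0$, $\tau>0$. Suppose that $Y_\varepsilon=X^{(\varepsilon t)}_{\varepsilon\tau}$ under $\mu_\varepsilon=\widetilde{\mathbb P}_{\varepsilon t}$ satisfies Assumption A and that $\Lambda_{0,1}(0)=0$. Then for every $k\in\Lambda_{0,1}(\mathcal D_0^o)\setminus\{0\}$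 the Type-II forward volatility $\widetilde\sigma_{\varepsilon t,\varepsilon\tau}(k)$ exists and is unique for all small $\varepsilon>0$, and as $\varepsilon\downarrow0$ $$\widetilde\sigma^2_{\varepsilon t,\varepsilon\tau}(k)=v_0+v_1\varepsilon+v_2\varepsilon^2+\mathcal O(\varepsilon^3),$$ where $$v_0=\frac{k^2}{2\tau\Lambda^*(k)},\qquad v_1=\frac{v_0^2\tau}{k}\left[1+\frac2k\log\left(\frac{k^2e^{\Lambda_1}}{(u^*)^2\sqrt{\Lambda_{0,2}}(\tau v_0)^{3/2}}\right)\right],$$ $$v_2=\frac{2\tau^2v_0^3}{k^2}\left(\frac3{k^2}+\frac18\right)+\frac{2\tau v_0^2}{k^2}\left(\Upsilon(0,k)+\frac1{u^*}\right)+\frac{v_1^2}{v_0}-\frac{3\tau}{k^2}v_0v_1.$$ **(II) Large maturity.** Let $t\ge0$. Suppose that $Y_\varepsilon=\varepsilon X^{(t)}_{1/\varepsilon}$ under $\mu_\varepsilon=\widetilde{\mathbb P}_t$ satisfies Assumption A, that $1\in\mathcal D_0^o$ and that $\Lambda_0(1)=0$. Then for every $k\in\Lambda_{0,1}(\mathcal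 D_0^o)\setminus\{\Lambda_{0,1}(0),\Lambda_{0,1}(1)\}$ the Type-II forward volatility $\widetilde\sigma_{t,\tau}(k\tau)$ exists and is unique for all large $\tau$, and as $\tau\uparrow\infty$ $$\widetilde\sigma^2_{t,\tau}(k\tau)=v_0^\infty+\frac{v_1^\infty}{\tau}+\frac{v_2^\infty}{\tau^2}+\mathcal O\left(\frac1{\tau^3}\right),$$ where $$v_0^\infty=2\left(2\Lambda^*(k)-k\mp2\sqrt{\Lambda^*(k)(\Lambda^*(k)-k)}\right),$$ with the sign $-$ if $k\notin[\Lambda_{0,1}(0),\Lambda_{0,1}(1)]$ and $+$ if $k\in(\Lambda_{0,1}(0),\Lambda_{0,1}(1))$, $$v_1^\infty=\frac{8(v_0^\infty)^2}{4k^2-(v_0^\infty)^2}\left(\Lambda_1+\log\frac{4k^2-(v_0^\infty)^2}{4(u^*-1)u^*(v_0^\infty)^{3/2}\sqrt{\Lambda_{0,2}}}\right),$$ and, writing $v_i$ for $v_i^\infty$, $$v_2^\infty=\frac{4}{v_0(v_0^2-4k^2)^3}\Big[8k^4v_1v_0^2(v_1+6)-16k^6v_1^2-2\Upsilon(1,k)v_0^3(v_0^2-4k^2)^2-k^2v_0^4(96+v_1^2+8v_1)-v_0^6(v_1+8)\Big].$$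 -/

import Mathlib

open MeasureTheory ProbabilityTheory Filter Topology Set
open scoped NNReal

noncomputable section

namespace FwdSmile

variable {Ω : Type*} [MeasurableSpace Ω]

/-! ### Renormalised log-moment generating functions of a family of random variables

`Y ε` is a random variable that is looked at under the measure `μ ε`, for `ε > 0`. -/

/-- The effective domain `D_ε = {u : E_ε[exp(u Y_ε / ε)] < ∞}`. -/
def lmgfDomain (μ : ℝ → Measure Ω) (Y : ℝ → Ω → ℝ) (ε : ℝ) : Set ℝ :=
  {u | u / ε ∈ integrableExpSet (Y ε) (μ ε)}

/-- `Λ_ε(u) = ε log E_ε[exp(u Y_ε / ε)]`. -/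
def lmgf (μ : ℝ → Measure Ω) (Y : ℝ → Ω → ℝ) (ε u : ℝ) : ℝ :=
  ε * cgf (Y ε) (μ ε) (u / ε)

/-- `E_ε[exp(z Y_ε / ε)]` for complex `z`. -/
def cMgf (μ : ℝ → Measure Ω) (Y : ℝ → Ω → ℝ) (ε : ℝ) (z : ℂ) : ℂ :=
  complexMGF (Y ε) (μ ε) (z / ε)

/-- `Re Λ_ε(z) = ε log |E_ε[exp(z Y_ε / ε)]|`, to be used where the expectation does not vanish
(where it vanishes, `Re Λ_ε(z) = -∞`). -/
def reLmgf (μ : ℝ → Measure Ω) (Y : ℝ → Ω → ℝ) (ε : ℝ) (z : ℂ) : ℝ :=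
  ε * Real.log ‖cMgf μ Y ε z‖

/-- `D_0`, the lower limit of the sets `D_ε` as `ε ↓ 0`; see `Assumptions.domain_limit` for the
equality with the upper limit. -/
def limitDomain (μ : ℝ → Measure Ω) (Y : ℝ → Ω → ℝ) : Set ℝ :=
  ⋃ ε ∈ Ioi (0 : ℝ), ⋂ s ∈ Ioc 0 ε, lmgfDomain μ Y s

/-- The upper limit of the sets `D_ε` as `ε ↓ 0`. -/
def limsupDomain (μ : ℝ → Measure Ω) (Y : ℝ → Ω → ℝ) : Set ℝ :=
  ⋂ ε ∈ Ioi (0 : ℝ), ⋃ s ∈ Ioc 0 ε, lmgfDomain μ Y s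

/-- The interior of `D_0`. -/
def D0int (μ : ℝ → Measure Ω) (Y : ℝ → Ω → ℝ) : Set ℝ := interior (limitDomain μ Y)

/-- Steepness of `h` on the open set `D`: `|h'(w n)| → ∞` along every sequence in `D` that converges
to a boundary point of `D`. -/
def IsSteepOn (D : Set ℝ) (h : ℝ → ℝ) : Prop :=
  ∀ w : ℕ → ℝ, (∀ n, w n ∈ D) → ∀ b ∈ frontier D, Tendsto w atTop (𝓝 b) →
    Tendsto (fun n => |deriv h (w n)|) atTop atTop

/-- Tail error control. `G` is the analytic continuation of `Λ_0` to the complex points `p + i q`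
with `p ∈ D`, `p ≠ 0`; it is determined there by the values of `Λ_0` on the real axis. -/
structure TailControl (μ : ℝ → Measure Ω) (Y : ℝ → Ω → ℝ) (D : Set ℝ) (Λ₀ : ℝ → ℝ)
    (G : ℂ → ℂ) : Prop where
  /-- `G` is holomorphic ... -/
  holo : DifferentiableOn ℂ G {z : ℂ | z.re ∈ D ∧ z.re ≠ 0}
  /-- ... and extends `Λ_0`. -/
  extend : ∀ p ∈ D, p ≠ 0 → G (p : ℂ) = (Λ₀ p : ℂ)
  /-- `Re Λ_ε(p + i q) = Re Λ_0(p + i q) + O(ε)`, the error being uniform for `q` in bounded sets. -/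
  approx : ∀ p ∈ D, p ≠ 0 → ∀ R > (0 : ℝ), ∃ ε₁ > (0 : ℝ), ∃ C : ℝ,
    ∀ ε ∈ Ioc 0 ε₁, ∀ q : ℝ, |q| ≤ R →
      cMgf μ Y ε (p + q * Complex.I) ≠ 0 ∧
      |reLmgf μ Y ε (p + q * Complex.I) - (G (p + q * Complex.I)).re| ≤ C * ε
  /-- `q ↦ Re Λ_0(p + i q)` has its unique maximum at `0` ... -/
  unique_max : ∀ p ∈ D, p ≠ 0 → ∀ q : ℝ, q ≠ 0 → (G (p + q * Complex.I)).re < (G (p : ℂ)).re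
  /-- ... and is bounded away from this maximum as `|q| → ∞`. -/
  bounded_away : ∀ p ∈ D, p ≠ 0 → ∃ δ > (0 : ℝ), ∃ R : ℝ, ∀ q : ℝ, R ≤ |q| →
    (G (p + q * Complex.I)).re ≤ (G (p : ℂ)).re - δ
  /-- `Re [Λ_ε(p + i q) - Λ_0(p + i q)] ≤ M ε` for all large `|q|` and all small `ε`, with `M`
  independent of `q` and `ε`. -/
  upper : ∀ p ∈ D, p ≠ 0 → ∃ ε₁ > (0 : ℝ), ∃ qs > (0 : ℝ), ∃ M : ℝ,
    ∀ ε ∈ Ioc 0 ε₁, ∀ q : ℝ, qs ≤ |q| → cMgf μ Y ε (p + q * Complex.I) ≠ 0 →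
      reLmgf μ Y ε (p + q * Complex.I) - (G (p + q * Complex.I)).re ≤ M * ε

/-- The standing assumption on the family `(Y ε)` under `(μ ε)`; `Λ 0`, `Λ 1`, `Λ 2` are the
coefficients of the expansion of `Λ_ε`, which are determined on the interior of `D_0`. -/
structure Assumptions (μ : ℝ → Measure Ω) (Y : ℝ → Ω → ℝ) (Λ : Fin 3 → ℝ → ℝ) : Prop where
  /-- The limit `D_0` of the sets `D_ε` exists. -/
  domain_limit : limitDomain μ Y = limsupDomain μ Y
  /-- Expansion property. -/
  expansion : ∀ u ∈ D0int μ Y,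
    (fun ε : ℝ => lmgf μ Y ε u - ∑ i : Fin 3, Λ i u * ε ^ (i : ℕ)) =O[𝓝[>] 0] fun ε => ε ^ 3
  /-- Differentiability: `(ε, u) ↦ Λ_ε(u)` is finite and smooth on `(0, ε₀) × D_0^o`. -/
  smooth : ∃ ε₀ > (0 : ℝ), (∀ ε ∈ Ioo 0 ε₀, D0int μ Y ⊆ lmgfDomain μ Y ε) ∧
    ContDiffOn ℝ ((⊤ : ℕ∞) : WithTop ℕ∞) (fun p : ℝ × ℝ => lmgf μ Y p.1 p.2) (Ioo 0 ε₀ ×ˢ D0int μ Y)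
  /-- Non-degenerate interior. -/
  zero_mem : (0 : ℝ) ∈ D0int μ Y
  /-- Strict convexity of `Λ_0`. -/
  strictConvex : StrictConvexOn ℝ (D0int μ Y) (Λ 0)
  /-- Essential smoothness of `Λ_0`, first part. -/
  differentiable : DifferentiableOn ℝ (Λ 0) (D0int μ Y)
  /-- Essential smoothness of `Λ_0`, second part. -/
  steep : IsSteepOn (D0int μ Y) (Λ 0)
  /-- Tail error control. -/
  tail : ∃ G : ℂ → ℂ, TailControl μ Y (D0int μ Y) (Λ 0) G

/-! ### The coefficients of the expansions

Below `D` is the interior of `D_0` and `u` stands for the saddlepoint `u*(k)`, that is, the solution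
in `D` of `Λ_0'(u) = k`. -/

/-- Fenchel-Legendre transform `Λ*(k)` of `Λ_0`. -/
def rate (D : Set ℝ) (Λ : Fin 3 → ℝ → ℝ) (k : ℝ) : ℝ :=
  sSup ((fun u => u * k - Λ 0 u) '' D)

/-- `Λ_{i,l}(u)`, the `l`-th derivative of `Λ_i`. -/
def dL (Λ : Fin 3 → ℝ → ℝ) (i : Fin 3) (l : ℕ) (u : ℝ) : ℝ := iteratedDeriv l (Λ i) u

/-- `Υ(b, k)`. -/
def upsilon (Λ : Fin 3 → ℝ → ℝ) (b u : ℝ) : ℝ :=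
  Λ 2 u - 5 * dL Λ 0 3 u ^ 2 / (24 * dL Λ 0 2 u ^ 3)
    + (4 * dL Λ 1 1 u * dL Λ 0 3 u + dL Λ 0 4 u) / (8 * dL Λ 0 2 u ^ 2)
    - (dL Λ 1 1 u ^ 2 + dL Λ 1 2 u) / (2 * dL Λ 0 2 u)
    - dL Λ 0 3 u / (2 * u * dL Λ 0 2 u ^ 2)
    - dL Λ 0 3 u / (2 * (u - b) * dL Λ 0 2 u ^ 2)
    - (dL Λ 1 1 u * (b - 2 * u) + 3) / (u * (u - b) * dL Λ 0 2 u)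
    - b ^ 2 / (u ^ 2 * (u - b) ^ 2 * dL Λ 0 2 u)

/-- `v_0(k, t, τ)`. -/
def v0 (D : Set ℝ) (Λ : Fin 3 → ℝ → ℝ) (τ k : ℝ) : ℝ := k ^ 2 / (2 * τ * rate D Λ k)

/-- `v_1(k, t, τ)`. -/
def v1 (D : Set ℝ) (Λ : Fin 3 → ℝ → ℝ) (τ k u : ℝ) : ℝ :=
  v0 D Λ τ k ^ 2 * τ / k *
    (1 + 2 / k * Real.log (k ^ 2 * Real.exp (Λ 1 u) /
      (u ^ 2 * Real.sqrt (dL Λ 0 2 u) * (τ * v0 D Λ τ k) ^ (3 / 2 : ℝ))))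

/-- `v_2(k, t, τ)`. -/
def v2 (D : Set ℝ) (Λ : Fin 3 → ℝ → ℝ) (τ k u : ℝ) : ℝ :=
  2 * τ ^ 2 * v0 D Λ τ k ^ 3 / k ^ 2 * (3 / k ^ 2 + 1 / 8)
    + 2 * τ * v0 D Λ τ k ^ 2 / k ^ 2 * (upsilon Λ 0 u + 1 / u)
    + v1 D Λ τ k u ^ 2 / v0 D Λ τ k
    - 3 * τ / k ^ 2 * v0 D Λ τ k * v1 D Λ τ k u

open Classical in
/-- `v_0^∞(k, t)`, for `k` different from `Λ_{0,1}(0)` and `Λ_{0,1}(1)`. -/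
def w0 (D : Set ℝ) (Λ : Fin 3 → ℝ → ℝ) (k : ℝ) : ℝ :=
  if k ∈ Ioo (deriv (Λ 0) 0) (deriv (Λ 0) 1) then
    2 * (2 * rate D Λ k - k + 2 * Real.sqrt (rate D Λ k * (rate D Λ k - k)))
  else
    2 * (2 * rate D Λ k - k - 2 * Real.sqrt (rate D Λ k * (rate D Λ k - k)))

/-- `v_1^∞(k, t)`. -/
def w1 (D : Set ℝ) (Λ : Fin 3 → ℝ → ℝ) (k u : ℝ) : ℝ :=
  8 * w0 D Λ k ^ 2 / (4 * k ^ 2 - w0 D Λ k ^ 2) *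
    (Λ 1 u + Real.log ((4 * k ^ 2 - w0 D Λ k ^ 2) /
      (4 * (u - 1) * u * w0 D Λ k ^ (3 / 2 : ℝ) * Real.sqrt (dL Λ 0 2 u))))

/-- `v_2^∞(k, t)`. -/
def w2 (D : Set ℝ) (Λ : Fin 3 → ℝ → ℝ) (k u : ℝ) : ℝ :=
  4 / (w0 D Λ k * (w0 D Λ k ^ 2 - 4 * k ^ 2) ^ 3) *
    (8 * k ^ 4 * w1 D Λ k u * w0 D Λ k ^ 2 * (w1 D Λ k u + 6)
      - 16 * k ^ 6 * w1 D Λ k u ^ 2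
      - 2 * upsilon Λ 1 u * w0 D Λ k ^ 3 * (w0 D Λ k ^ 2 - 4 * k ^ 2) ^ 2
      - k ^ 2 * w0 D Λ k ^ 4 * (96 + w1 D Λ k u ^ 2 + 8 * w1 D Λ k u)
      - w0 D Λ k ^ 6 * (w1 D Λ k u + 8))

/-! ### Forward-start options of the second type -/

/-- Black-Scholes-Merton price of a call with maturity `τ`, strike `exp k` and volatility `σ`
(spot 1, no interest). -/
def bsCall (τ k σ : ℝ) : ℝ :=
  cdf (gaussianReal 0 1) (-k / (σ * Real.sqrt τ) + σ * Real.sqrt τ / 2)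
    - Real.exp k * cdf (gaussianReal 0 1) (-k / (σ * Real.sqrt τ) - σ * Real.sqrt τ / 2)

/-- Value `E[(exp X_{t+τ} - exp (k + X_t))⁺]` of the Type-II forward-start call. -/
def typeIICall (P : Measure Ω) (X : ℝ≥0 → Ω → ℝ) (t τ : ℝ≥0) (k : ℝ) : ℝ :=
  ∫ ω, max (Real.exp (X (t + τ) ω) - Real.exp (k + X t ω)) 0 ∂P

/-- `σ > 0` reproduces the value of the Type-II forward-start call. -/
def IsTypeIIVol (P : Measure Ω) (X : ℝ≥0 → Ω → ℝ) (t τ : ℝ≥0) (k σ : ℝ) : Prop :=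
  0 < σ ∧ typeIICall P X t τ k = bsCall τ k σ

/-- The Type-II forward implied volatility, meaningful when exactly one `σ` satisfies
`IsTypeIIVol P X t τ k σ`; it is then that `σ`. -/
def typeIIVol (P : Measure Ω) (X : ℝ≥0 → Ω → ℝ) (t τ : ℝ≥0) (k : ℝ) : ℝ :=
  sInf {σ | IsTypeIIVol P X t τ k σ}

/-- The stopped-share-price measure with density `exp X_t`. -/
def sharePriceMeasure (P : Measure Ω) (X : ℝ≥0 → Ω → ℝ) (t : ℝ≥0) : Measure Ω :=
  P.withDensity fun ω => ENNReal.ofReal (Real.exp (X t ω))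

/-- The forward increment `X_τ^{(t)} = X_{t+τ} - X_t`. -/
def fwd (X : ℝ≥0 → Ω → ℝ) (t τ : ℝ≥0) (ω : Ω) : ℝ := X (t + τ) ω - X t ω

/-- Diagonal small-maturity regime: the measures `P̃`, with forward-start date `ε t`. -/
def diagMeasure (P : Measure Ω) (X : ℝ≥0 → Ω → ℝ) (t : ℝ≥0) (ε : ℝ) : Measure Ω :=
  sharePriceMeasure P X (ε.toNNReal * t)

/-- Diagonal small-maturity regime: `Y_ε = X_{ετ}^{(εt)}`. -/
def diagProcess (X : ℝ≥0 → Ω → ℝ) (t τ : ℝ≥0) (ε : ℝ) : Ω → ℝ :=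
  fwd X (ε.toNNReal * t) (ε.toNNReal * τ)

/-- Large-maturity regime: the measure `P̃`, with fixed forward-start date `t`. -/
def largeMeasure (P : Measure Ω) (X : ℝ≥0 → Ω → ℝ) (t : ℝ≥0) (_ε : ℝ) : Measure Ω :=
  sharePriceMeasure P X t

/-- Large-maturity regime: `Y_ε = ε X_{1/ε}^{(t)}`. -/
def largeProcess (X : ℝ≥0 → Ω → ℝ) (t : ℝ≥0) (ε : ℝ) (ω : Ω) : ℝ :=
  ε * fwd X t (ε⁻¹).toNNReal ω

end FwdSmile

end

/-! ### Taylor expansions and Remez' inequality -/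

noncomputable section

namespace FwdSmile

/-! Both regimes are instances of one problem. Under the share-price measure the Type-II price
becomes E[(e^{bY/ε} − e^{bk/ε})⁺], with b = ε on the diagonal and b = 1 for large maturity. Fourier
inversion along a vertical line Re z = u that avoids the poles 0 and b writes it as explicit
residues plus a multiple of the integral of M_ε(z) e^{−kz/ε} / (z(z − b)) (`fourierIntegral_eq`). On
the line through the saddlepoint u = u*(k) the exponent (Λ₀(z) − kz)/ε is stationary at the real
point, and its real part is strictly smaller elsewhere. Laplace's method then gives e^{−Λ*(k)/ε}
√(2πε/Λ₀'') e^{Λ₁}/(u(u − b₀)) times 1 + (Υ + b₁/(u − b₀)) ε + O(ε²), where b = b₀ + b₁ε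
(`Assumptions.fourierIntegral_expansion`, `Assumptions.call_expansion`).

The hard point is regularity. The coefficient of ε involves two derivatives of Λ₁, while the
expansion of Λ_ε is assumed only at each real point separately, with no uniformity. The remedy is
complex analysis of the normalised function F_ε = M_ε e^{−G/ε} (`normMgf`). Tail control bounds it
on single vertical lines, and Phragmén–Lindelöf between two such lines bounds it on a complex disc,
uniformly in ε (`Assumptions.exists_uniform_bound`). For a bounded holomorphic family, pointwise
smallness on the real axis becomes uniform smallness by a Remez inequality with polynomial degree of
order log(1/ε) (`uniform_bound_of_pointwise`). Dyadic differences in ε eliminate the unknown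
coefficients and produce a holomorphic limit with error O(ε)
(`uniform_limit_of_pointwise_expansion`), after which Cauchy's estimates control derivatives. Strict
convexity alone does not give Λ₀''(u) > 0; this follows from the strict maximum of Re Λ₀ on nearby
vertical lines (`second_deriv_pos`).

On the Black-Scholes side, bounds for Mills' ratio give an expansion with the same residues, the
same power of ε in the prefactor, and an exponent −φ(V)/ε + ψ(V) + χ(V)ε + O(ε²), where V is the
variance (`bsTotal_small_maturity`, `bsTotal_large_maturity`). The numbers v₀, v₁, v₂ solve the
equality of exponents at orders 1/ε, 1 and ε. Shifting V by ±Kε³ then moves the Black-Scholes price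
strictly to either side of the option price (`exists_bracket`), and monotonicity in the volatility
turns this bracket into existence, uniqueness and the error bound (`implied_vol_of_bracket`). -/

open Polynomial in
/-- Taylor's formula with a bound on the remainder, for a bounded holomorphic function. -/
theorem exists_taylor {c : ℂ} {r A : ℝ} (hr : 0 < r) (n : ℕ) : ∀ {f : ℂ → ℂ},
    DifferentiableOn ℂ f (Metric.ball c r) → (∀ z ∈ Metric.ball c r, ‖f z‖ ≤ A) →
    ∃ (p : ℂ[X]) (R : ℂ → ℂ), p.degree < n ∧ DifferentiableOn ℂ R (Metric.ball c r) ∧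
      (∀ z ∈ Metric.ball c r, ‖R z‖ ≤ A * (2 / r) ^ n) ∧
      ∀ z ∈ Metric.ball c r, f z = p.eval (z - c) + (z - c) ^ n * R z := by
  -- The remainder is the n-fold iterated `dslope`. The bound A changes at every step, so it has to
  -- be generalised.
  induction n generalizing A with
  | zero =>
    intro f hf hA
    exact ⟨0, f, by simp, hf, by simpa using hA, by simp⟩
  | succ n ih =>
    intro f hf hA
    have hc : c ∈ Metric.ball c r := Metric.mem_ball_self hr
    have hd : DifferentiableOn ℂ (dslope f c) (Metric.ball c r) :=
      (Complex.differentiableOn_dslope (Metric.ball_mem_nhds c hr)).2 hf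
    -- Schwarz's lemma: f maps the disc into the closed disc of radius 2A about f(c), so one divided
    -- difference costs a factor 2/r.
    have hb : ∀ z ∈ Metric.ball c r, ‖dslope f c z‖ ≤ A * (2 / r) := by
      intro z hz
      have := Complex.norm_dslope_le_div_of_mapsTo_ball (R₂ := 2 * A) hf (fun w hw => by
        rw [Metric.mem_closedBall, dist_eq_norm]
        linarith [norm_sub_le (f w) (f c), hA w hw, hA c hc]) hz
      calc _ ≤ _ := this
        _ = _ := by ring
    obtain ⟨p, R, hp, hR, hRb, hE⟩ := ih hd hb
    refine ⟨C (f c) + X * p, R, ?_, hR, ?_, ?_⟩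
    · refine (degree_add_le _ _).trans_lt (max_lt ?_ ?_)
      · exact degree_C_le.trans_lt (by exact_mod_cast Nat.succ_pos n)
      · by_cases hp0 : p = 0
        · simp [hp0]
        · rw [degree_mul, degree_X, degree_eq_natDegree hp0] at *
          have : p.natDegree < n := by exact_mod_cast hp
          have h2 : (1 + p.natDegree : ℕ) < n + 1 := by omega
          exact_mod_cast h2
    · intro z hz
      calc _ ≤ _ := hRb z hz
        _ = _ := by ring
    · intro z hz
      have h1 : f z = f c + (z - c) * dslope f c z := by
        have := sub_smul_dslope f c z
        rw [smul_eq_mul] at this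
        rw [this]; ring
      rw [h1, hE z hz]
      simp
      ring

/-- A set of outer measure larger than `m * h` contains `m + 1` points with gaps at least `h`. -/
theorem exists_separated {h : ℝ} (hh : 0 ≤ h) (m : ℕ) : ∀ {E : Set ℝ}, BddBelow E → E.Nonempty →
    ENNReal.ofReal (m * h) < volume E →
    ∃ x : ℕ → ℝ, (∀ i ≤ m, x i ∈ E) ∧ ∀ i < m, x i + h ≤ x (i + 1) := by
  induction m with
  | zero =>
    intro E _ ⟨e, he⟩ _
    exact ⟨fun _ => e, by simpa using he, by simp⟩
  | succ m ih =>
    intro E hE hne hv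
    -- The infimum of E need not be attained. The slack d in the measure pays for starting at a
    -- point e within d of it.
    obtain ⟨d, hd, hlt⟩ : ∃ d > (0 : ℝ), ENNReal.ofReal ((m + 1 : ℕ) * h + d) < volume E := by
      have hc : Tendsto (fun d : ℝ => ENNReal.ofReal ((m + 1 : ℕ) * h + d)) (𝓝[>] 0)
          (𝓝 (ENNReal.ofReal ((m + 1 : ℕ) * h + 0))) := by
        apply ENNReal.tendsto_ofReal
        exact ((continuous_const.add continuous_id).tendsto 0).mono_left nhdsWithin_le_nhds
      rw [add_zero] at hc
      obtain ⟨d, h1, h2⟩ := ((hc.eventually (gt_mem_nhds hv)).and self_mem_nhdsWithin).exists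
      exact ⟨d, h2, h1⟩
    obtain ⟨e, he, hed⟩ := Real.lt_sInf_add_pos hne hd
    -- Only a piece of length at most h + d is discarded, so what lies beyond e + h still has
    -- measure greater than m h.
    have hsub : E ⊆ Icc (sInf E) (e + h) ∪ (E ∩ Ici (e + h)) := by
      intro y hy
      rcases le_total y (e + h) with hye | hye
      · exact Or.inl ⟨csInf_le hE hy, hye⟩
      · exact Or.inr ⟨hy, hye⟩
    have hle : volume E ≤ ENNReal.ofReal (h + d) + volume (E ∩ Ici (e + h)) := by
      refine (measure_mono hsub).trans ((measure_union_le _ _).trans ?_)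
      gcongr
      rw [Real.volume_Icc]
      exact ENNReal.ofReal_le_ofReal (by linarith)
    have hv' : ENNReal.ofReal (m * h) < volume (E ∩ Ici (e + h)) := by
      by_contra! hcon
      refine absurd hlt (not_lt.2 (hle.trans ?_))
      refine (add_le_add le_rfl hcon).trans ?_
      rw [← ENNReal.ofReal_add (by positivity) (by positivity)]
      exact ENNReal.ofReal_le_ofReal (by push_cast; linarith)
    obtain ⟨x, hx1, hx2⟩ := ih (E := E ∩ Ici (e + h)) (hE.mono inter_subset_left)
      (nonempty_of_measure_ne_zero (ne_bot_of_gt hv')) hv'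
    refine ⟨fun i => i.casesOn e x, ?_, ?_⟩
    · rintro (_ | i) hi
      · exact he
      · exact (hx1 i (by omega)).1
    · rintro (_ | i) hi
      · exact (hx1 0 (by omega)).2
      · exact hx2 i (by omega)

theorem gap_le {x : ℕ → ℝ} {h : ℝ} {m : ℕ} (hx : ∀ i < m, x i + h ≤ x (i + 1)) {i j : ℕ}
    (hij : i ≤ j) (hj : j ≤ m) : ((j : ℝ) - i) * h ≤ x j - x i := by
  induction j, hij using Nat.le_induction with
  | base => simp
  | succ j hij ih =>
    have h1 := ih (by omega)
    have h2 := hx j (by omega)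
    push_cast
    linarith

/-- These are the Lagrange denominators for the nodes 0, …, n: the nodes to the left of j contribute
j!, those to the right (n − j)!. -/
theorem prod_abs_sub_erase (n j : ℕ) (hj : j ≤ n) :
    ∏ i ∈ (Finset.range (n + 1)).erase j, |(j : ℝ) - i| = (j.factorial : ℝ) * (n - j).factorial := by
  have h1 : (Finset.range (n + 1)).erase j = Finset.range j ∪ Finset.Ico (j + 1) (n + 1) := by
    ext i; simp; omega
  rw [h1, Finset.prod_union]
  · congr 1
    · rw [← Finset.prod_range_reflect, ← Finset.prod_range_add_one_eq_factorial]
      push_cast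
      refine Finset.prod_congr rfl fun i hi => ?_
      have hi' : i < j := Finset.mem_range.1 hi
      have : ((j - 1 - i : ℕ) : ℝ) = j - 1 - i := by
        rw [Nat.cast_sub (by omega), Nat.cast_sub (by omega)]; simp
      rw [this, show (j : ℝ) - (j - 1 - i) = i + 1 by ring, abs_of_pos (by positivity)]
    · rw [Finset.prod_Ico_eq_prod_range, ← Finset.prod_range_add_one_eq_factorial]
      push_cast
      refine Finset.prod_congr rfl fun i _ => ?_
      rw [show (j : ℝ) - (j + 1 + i) = -(i + 1) by ring, abs_neg, abs_of_pos (by positivity)]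
  · rw [Finset.disjoint_left]; intro i; simp; omega

open Polynomial in
/-- A Remez type inequality: a polynomial of degree at most `n` that is small at `n + 1` separated
real points is not too large nearby. -/
theorem norm_eval_le_of_separated {n : ℕ} {s B : ℝ} (hs : 0 < s) (hB : 0 ≤ B) {u : ℝ}
    {x : ℕ → ℝ} (hx : ∀ i < n, x i + s / n ≤ x (i + 1)) (hxs : ∀ i ≤ n, |x i - u| ≤ s)
    {p : ℂ[X]} (hp : p.degree < (n + 1 : ℕ)) (hpB : ∀ i ≤ n, ‖p.eval (x i : ℂ)‖ ≤ B)
    {z : ℂ} (hz : ‖z - u‖ ≤ s) : ‖p.eval z‖ ≤ 16 ^ n * B := by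
  -- For n = 0 the gap s / n is the default value 0; the polynomial is then constant and is treated
  -- separately.
  rcases Nat.eq_zero_or_pos n with rfl | hn
  · have h0 : p.degree ≤ 0 := by
      rcases eq_or_ne p 0 with rfl | h0
      · simp
      · rw [degree_eq_natDegree h0] at hp ⊢
        have : p.natDegree < 0 + 1 := by exact_mod_cast hp
        simp [show p.natDegree = 0 by omega]
    have hpB0 := hpB 0 le_rfl
    rw [eq_C_of_degree_le_zero h0] at hpB0 ⊢
    simpa using hpB0
  set h := s / n with hh
  have hh0 : 0 < h := by positivity
  have hgap : ∀ i ≤ n, ∀ j ≤ n, |(j : ℝ) - i| * h ≤ |x j - x i| := by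
    intro i hi j hj
    rcases le_total i j with hij | hij
    · have := gap_le hx hij hj
      rw [abs_of_nonneg (sub_nonneg.2 (by exact_mod_cast hij))]
      exact this.trans (le_abs_self _)
    · have := gap_le hx hij hi
      rw [abs_sub_comm, abs_of_nonneg (sub_nonneg.2 (by exact_mod_cast hij)), abs_sub_comm]
      exact this.trans (le_abs_self _)
  have hinj : Set.InjOn (fun i : ℕ => (x i : ℂ)) (Finset.range (n + 1)) := by
    intro i hi j hj hij
    have hi' : i ≤ n := by simpa [Nat.lt_succ_iff] using hi
    have hj' : j ≤ n := by simpa [Nat.lt_succ_iff] using hj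
    have h1 := hgap i hi' j hj'
    have h2 : x i = x j := Complex.ofReal_injective hij
    rw [h2, sub_self, abs_zero] at h1
    have h3 : |(j : ℝ) - i| ≤ 0 := by
      by_contra! hc
      nlinarith
    have h4 : (j : ℝ) - i = 0 := abs_eq_zero.1 (le_antisymm h3 (abs_nonneg _))
    have : (j : ℝ) = i := by linarith
    exact_mod_cast this.symm
  -- Interpolation at the n + 1 nodes is exact. The basis polynomials are compared with those of
  -- equally spaced nodes of gap s/n: each numerator factor is at most 2s and each denominator
  -- factor at least |j − i| s/n.
  have hL := Lagrange.eq_interpolate hinj (f := p) (by simpa using hp)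
  rw [hL, Lagrange.interpolate_apply, eval_finsetSum]
  have hterm : ∀ j ∈ Finset.range (n + 1),
      ‖(C (p.eval (x j : ℂ)) * Lagrange.basis (Finset.range (n + 1)) (fun i : ℕ => (x i : ℂ)) j).eval z‖
        ≤ B * ((2 * n) ^ n / n.factorial * n.choose j) := by
    intro j hj
    have hj' : j ≤ n := by simpa [Nat.lt_succ_iff] using hj
    rw [eval_mul, eval_C, norm_mul]
    refine mul_le_mul (hpB j hj') ?_ (norm_nonneg _) hB
    rw [Lagrange.basis, eval_prod, norm_prod]
    have hcard : ((Finset.range (n + 1)).erase j).card = n := by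
      rw [Finset.card_erase_of_mem hj]; simp
    calc ∏ i ∈ (Finset.range (n + 1)).erase j, ‖(Lagrange.basisDivisor (x j : ℂ) (x i)).eval z‖
        ≤ ∏ i ∈ (Finset.range (n + 1)).erase j, (2 * s / h) * |(j : ℝ) - i|⁻¹ := by
          refine Finset.prod_le_prod (fun _ _ => norm_nonneg _) fun i hi => ?_
          have hi' : i ≤ n := by
            have := (Finset.mem_erase.1 hi).2
            simpa [Nat.lt_succ_iff] using this
          have hne : (j : ℝ) - i ≠ 0 := by
            have := (Finset.mem_erase.1 hi).1
            rw [sub_ne_zero]; exact_mod_cast this.symm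
          simp only [Lagrange.basisDivisor, eval_mul, eval_C, eval_sub, eval_X, norm_mul, norm_inv]
          rw [← Complex.ofReal_sub, Complex.norm_real, Real.norm_eq_abs]
          have h1 : ‖z - x i‖ ≤ 2 * s := by
            have : z - x i = (z - u) - ((x i - u : ℝ) : ℂ) := by push_cast; ring
            rw [this]
            refine (norm_sub_le _ _).trans ?_
            rw [Complex.norm_real, Real.norm_eq_abs]
            linarith [hxs i hi']
          have h2 := hgap i hi' j hj'
          have h3 : 0 < |(j : ℝ) - i| * h := by positivity
          calc |x j - x i|⁻¹ * ‖z - x i‖ ≤ (|(j : ℝ) - i| * h)⁻¹ * (2 * s) := by gcongr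
            _ = _ := by field_simp
      _ = (2 * n) ^ n * (∏ i ∈ (Finset.range (n + 1)).erase j, |(j : ℝ) - i|)⁻¹ := by
          rw [Finset.prod_mul_distrib, Finset.prod_const, hcard, Finset.prod_inv_distrib]
          congr 2
          rw [hh]; field_simp
      _ = (2 * n) ^ n / n.factorial * n.choose j := by
          rw [prod_abs_sub_erase n j hj', Nat.cast_choose ℝ hj']
          field_simp
  refine (norm_sum_le _ _).trans ((Finset.sum_le_sum hterm).trans ?_)
  rw [← Finset.mul_sum, ← Finset.mul_sum]
  have h2 : (∑ i ∈ Finset.range (n + 1), (n.choose i : ℝ)) = 2 ^ n := by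
    exact_mod_cast Nat.sum_range_choose n
  rw [h2]
  -- The sum over the basis is 2^n (2n)^n / n! = 4^n · n^n / n!, and n^n / n! ≤ e^n ≤ 4^n; together
  -- this is 16^n.
  have h3 : (n : ℝ) ^ n / n.factorial ≤ 4 ^ n := by
    calc (n : ℝ) ^ n / n.factorial ≤ Real.exp n := Real.pow_div_factorial_le_exp _ (by positivity) _
      _ = Real.exp 1 ^ n := by rw [← Real.exp_nat_mul, mul_one]
      _ ≤ 4 ^ n := by
        gcongr
        linarith [Real.exp_one_lt_d9]
  calc B * ((2 * n) ^ n / n.factorial * 2 ^ n) = B * (4 ^ n * ((n : ℝ) ^ n / n.factorial)) := by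
        rw [mul_pow, show (4 : ℝ) = 2 * 2 by norm_num, mul_pow]; ring
    _ ≤ B * (4 ^ n * 4 ^ n) := by gcongr
    _ = 16 ^ n * B := by rw [← mul_pow]; norm_num; ring

end FwdSmile

end

/-! ### Uniform expansions from pointwise ones -/

noncomputable section

namespace FwdSmile

/-- If a uniformly bounded family of holomorphic functions is `O(ε ^ 2)` at each real point, then it
is uniformly `O(ε ^ (3 / 2))` on a smaller disc. -/
theorem uniform_bound_of_pointwise {D : ℝ → ℂ → ℂ} {u r A ε₀ : ℝ} (hr : 0 < r) (hε₀ : 0 < ε₀)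
    (hA : 0 ≤ A)
    (hD : ∀ ε ∈ Ioc 0 ε₀, DifferentiableOn ℂ (D ε) (Metric.ball (u : ℂ) r))
    (hDA : ∀ ε ∈ Ioc 0 ε₀, ∀ z ∈ Metric.ball (u : ℂ) r, ‖D ε z‖ ≤ A)
    (hpt : ∀ x : ℝ, |x - u| < r → ∃ C : ℝ, ∃ ε₁ > 0, ∀ ε ∈ Ioc 0 ε₁, ‖D ε x‖ ≤ C * ε ^ 2) :
    ∃ s > 0, s < r ∧ ∃ C : ℝ, 0 ≤ C ∧ ∃ ε₂ > 0, ε₂ ≤ ε₀ ∧ ∀ ε ∈ Ioc 0 ε₂, ∀ z : ℂ, ‖z - u‖ ≤ s →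
      ‖D ε z‖ ≤ C * (ε * √ε) := by
  -- With this radius the Taylor remainder of order n + 1 is at most A · 16^{−4(n+1)} on the smaller
  -- disc. After the Remez factor 16^n it is still below 16^{−3(n+1)}, the size of ε^{3/2} for the
  -- degree chosen below.
  set s : ℝ := r / (2 * 16 ^ 4) with hs
  have hs0 : 0 < s := by positivity
  have hsr : s < r := by rw [hs]; exact div_lt_self hr (by norm_num)
  -- The constants in `hpt` depend on x. E N collects the points where N and 1/(N + 1) serve as
  -- constant and threshold; these sets increase to the whole interval.
  set E : ℕ → Set ℝ := fun N => {x | x ∈ Icc (u - s) (u + s) ∧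
    ∀ ε ∈ Ioc (0 : ℝ) (1 / (N + 1)), ‖D ε x‖ ≤ N * ε ^ 2} with hE
  have hmono : Monotone E := by
    intro N N' hNN x hx
    have hc : (N : ℝ) ≤ N' := by exact_mod_cast hNN
    refine ⟨hx.1, fun ε hε => (hx.2 ε ⟨hε.1, hε.2.trans ?_⟩).trans ?_⟩
    · gcongr
    · gcongr
  have hU : ⋃ N, E N = Icc (u - s) (u + s) := by
    refine Subset.antisymm (iUnion_subset fun N x hx => hx.1) fun x hx => ?_
    obtain ⟨C, ε₁, hε₁, hC⟩ := hpt x (by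
      rw [abs_lt]; constructor <;> linarith [hx.1, hx.2])
    obtain ⟨N₁, hN₁⟩ := exists_nat_ge C
    obtain ⟨N₂, hN₂⟩ := exists_nat_one_div_lt hε₁
    refine mem_iUnion.2 ⟨max N₁ N₂, hx, fun ε hε => (hC ε ⟨hε.1, hε.2.trans ?_⟩).trans ?_⟩
    · refine le_trans ?_ hN₂.le
      have : (N₂ : ℝ) ≤ (max N₁ N₂ : ℕ) := by exact_mod_cast le_max_right _ _
      gcongr
    · have : (N₁ : ℝ) ≤ (max N₁ N₂ : ℕ) := by exact_mod_cast le_max_left _ _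
      have : C ≤ (max N₁ N₂ : ℕ) := hN₁.trans this
      gcongr
  -- Continuity from below along the increasing sequence needs no measurability of E N, which is not
  -- available. The interval has length 2s, so some E N has outer measure above s.
  obtain ⟨N, hN⟩ : ∃ N, ENNReal.ofReal s < volume (E N) := by
    have h1 := hmono.measure_iUnion (μ := volume)
    rw [hU, Real.volume_Icc] at h1
    have h2 : ENNReal.ofReal s < ⨆ N, volume (E N) := by
      rw [← h1]
      exact (ENNReal.ofReal_lt_ofReal_iff (by linarith)).2 (by linarith)
    exact lt_iSup_iff.1 h2
  set ε₂ : ℝ := min ε₀ (min 1 (1 / (N + 1))) with hε₂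
  refine ⟨s, hs0, hsr, N + 2 * A, by positivity, ε₂, by positivity, min_le_left _ _,
    fun ε hε z hz => ?_⟩
  have hε0 : ε ∈ Ioc 0 ε₀ := ⟨hε.1, hε.2.trans (min_le_left _ _)⟩
  have hε1 : ε ≤ 1 := hε.2.trans ((min_le_right _ _).trans (min_le_left _ _))
  have hεN : ε ∈ Ioc (0 : ℝ) (1 / (N + 1)) :=
    ⟨hε.1, hε.2.trans ((min_le_right _ _).trans (min_le_right _ _))⟩
  -- The degree is tied to ε by 16^{−2(n+1)} < ε ≤ 16^{−2n}. Then 16^n ≤ ε^{−1/2}, so the Remez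
  -- factor costs only half a power of ε.
  obtain ⟨n, hn1, hn2⟩ := exists_nat_pow_near_of_lt_one hε.1 hε1
    (show (0 : ℝ) < 1 / 16 ^ 2 by norm_num) (by norm_num)
  obtain ⟨p, R, hp, -, hRb, hpR⟩ := exists_taylor hr (n + 1) (hD ε hε0) (hDA ε hε0)
  obtain ⟨x, hx1, hx2⟩ := exists_separated (h := s / n) (by positivity) n (E := E N)
    (⟨u - s, fun y hy => hy.1.1⟩) (nonempty_of_measure_ne_zero (ne_bot_of_gt hN)) (by
      refine lt_of_le_of_lt (ENNReal.ofReal_le_ofReal ?_) hN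
      rcases Nat.eq_zero_or_pos n with rfl | hn
      · simpa using hs0.le
      · have : (0 : ℝ) < n := by exact_mod_cast hn
        field_simp
        exact le_rfl)
  have hrem : ∀ w : ℂ, ‖w - u‖ ≤ s → ‖(w - u) ^ (n + 1) * R w‖ ≤ A * (1 / 16 ^ 4) ^ (n + 1) := by
    intro w hw
    rw [norm_mul, norm_pow]
    calc ‖w - u‖ ^ (n + 1) * ‖R w‖ ≤ s ^ (n + 1) * (A * (2 / r) ^ (n + 1)) := by
          gcongr
          exact hRb w (by rw [Metric.mem_ball, dist_eq_norm]; linarith)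
      _ = A * (s * (2 / r)) ^ (n + 1) := by rw [mul_pow]; ring
      _ = _ := by congr 2; rw [hs]; field_simp
  have hmem : ∀ w : ℂ, ‖w - u‖ ≤ s → w ∈ Metric.ball (u : ℂ) r := fun w hw => by
    rw [Metric.mem_ball, dist_eq_norm]; linarith
  have habs : ∀ i ≤ n, |x i - u| ≤ s := fun i hi => by
    have := (hx1 i hi).1
    rw [abs_le]; constructor <;> linarith [this.1, this.2]
  have hpx : ∀ i ≤ n, ‖p.eval ((x i - u : ℝ) : ℂ)‖ ≤ N * ε ^ 2 + A * (1 / 16 ^ 4) ^ (n + 1) := by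
    intro i hi
    have hw : ‖((x i : ℝ) : ℂ) - u‖ ≤ s := by
      rw [← Complex.ofReal_sub, Complex.norm_real]; exact habs i hi
    have h1 := hpR _ (hmem _ hw)
    have h2 : p.eval ((x i - u : ℝ) : ℂ) = D ε (x i) - ((x i : ℂ) - u) ^ (n + 1) * R (x i) := by
      rw [h1]; push_cast; ring
    rw [h2]
    exact (norm_sub_le _ _).trans (add_le_add ((hx1 i hi).2 ε hεN) (hrem _ hw))
  have key := norm_eval_le_of_separated (u := 0) (x := fun i => x i - u) hs0
    (by positivity : 0 ≤ N * ε ^ 2 + A * (1 / 16 ^ 4 : ℝ) ^ (n + 1))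
    (fun i hi => by linarith [hx2 i hi]) (fun i hi => by simpa using habs i hi)
    (by exact_mod_cast hp) hpx (z := z - u) (by simpa using hz)
  rw [hpR z (hmem z hz)]
  refine (norm_add_le _ _).trans ((add_le_add key (hrem z hz)).trans ?_)
  have hεpos : 0 < ε := hε.1
  have hsq := Real.sq_sqrt hε.1.le
  have hsq0 := Real.sqrt_nonneg ε
  have e1 : (16 : ℝ) ^ n * ε ^ 2 ≤ ε * √ε := by
    have h1 : (16 : ℝ) ^ n * √ε ≤ 1 := by
      refine abs_le_of_sq_le_sq' ?_ zero_le_one |>.2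
      rw [mul_pow, hsq, one_pow, ← pow_mul, mul_comm n 2, pow_mul]
      calc ((16 : ℝ) ^ 2) ^ n * ε ≤ (16 ^ 2) ^ n * (1 / 16 ^ 2) ^ n := by gcongr
        _ = 1 := by rw [← mul_pow]; norm_num
    calc (16 : ℝ) ^ n * ε ^ 2 = (16 ^ n * √ε) * (ε * √ε) := by
          conv_lhs => rw [pow_two]
          conv_rhs => rw [show (16 : ℝ) ^ n * √ε * (ε * √ε) = 16 ^ n * (ε * √ε ^ 2) by ring, hsq]
      _ ≤ 1 * (ε * √ε) := by gcongr
      _ = _ := one_mul _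
  have e2 : (16 : ℝ) ^ n * (1 / 16 ^ 4) ^ (n + 1) ≤ ε * √ε := by
    set w : ℝ := (1 / 16) ^ (n + 1) with hw
    have hw0 : 0 < w := by positivity
    have hw2 : w ^ 2 ≤ ε := by
      rw [hw, ← pow_mul, mul_comm (n + 1) 2, pow_mul]
      refine le_trans (le_of_eq ?_) hn1.le
      norm_num
    have hw1 : w ≤ √ε := Real.le_sqrt_of_sq_le hw2
    calc (16 : ℝ) ^ n * (1 / 16 ^ 4) ^ (n + 1) ≤ 16 ^ (n + 1) * (1 / 16 ^ 4) ^ (n + 1) := by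
          gcongr
          · norm_num
          · omega
      _ = w ^ 2 * w := by
          rw [hw, ← mul_pow, ← pow_mul, ← pow_add,
            show (n + 1) * 2 + (n + 1) = 3 * (n + 1) by ring, pow_mul]
          norm_num
      _ ≤ ε * √ε := by gcongr
  have e3 : (1 / 16 ^ 4 : ℝ) ^ (n + 1) ≤ ε * √ε := by
    refine le_trans ?_ e2
    have : (1 : ℝ) ≤ 16 ^ n := one_le_pow₀ (by norm_num)
    have h0 : (0 : ℝ) < (1 / 16 ^ 4 : ℝ) ^ (n + 1) := by positivity
    nlinarith
  calc (16 : ℝ) ^ n * (N * ε ^ 2 + A * (1 / 16 ^ 4) ^ (n + 1)) + A * (1 / 16 ^ 4) ^ (n + 1)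
      = N * (16 ^ n * ε ^ 2) + A * (16 ^ n * (1 / 16 ^ 4) ^ (n + 1)) + A * (1 / 16 ^ 4) ^ (n + 1) := by
        ring
    _ ≤ N * (ε * √ε) + A * (ε * √ε) + A * (ε * √ε) := by gcongr
    _ = _ := by ring

/-- A bounded function on `(0, ε₂]` whose dyadic second differences are `O(ε ^ (3 / 2))` has dyadic
first differences `O(ε)`. -/
theorem first_difference_bound {K C ε₂ : ℝ} (hC : 0 ≤ C) (hε₂ : 0 < ε₂) :
    ∃ A : ℝ, 0 ≤ A ∧ ∀ f : ℝ → ℂ, (∀ ε ∈ Ioc 0 ε₂, ‖f ε‖ ≤ K) →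
      (∀ ε ∈ Ioc 0 ε₂, ‖f ε - 3 * f (ε / 2) + 2 * f (ε / 2 / 2)‖ ≤ C * (ε * √ε)) →
      ∀ ε ∈ Ioc 0 ε₂, ‖f ε - f (ε / 2)‖ ≤ A * ε := by
  -- The constant is fixed before f, since it is later needed for all points of a disc at once.
  refine ⟨|4 * K / ε₂| + 4 * C * √ε₂, by positivity, fun f hf hD => ?_⟩
  set A := |4 * K / ε₂| + 4 * C * √ε₂ with hA
  -- With g(ε) = f(ε) − f(ε/2) the hypothesis controls g(ε) − 2g(ε/2). Passing from 2ε to ε, the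
  -- bound A − 4C√(2ε) plus the new error √2 C√ε gives A − 3√2 C√ε, and 3√2 ≥ 4 closes the
  -- induction. The term −4C√ε thus stores room for all later errors.
  have key : ∀ m : ℕ, ∀ ε ∈ Ioc (ε₂ / 2 ^ (m + 1)) (ε₂ / 2 ^ m),
      ‖f ε - f (ε / 2)‖ ≤ ε * (A - 4 * C * √ε) := by
    intro m
    induction m with
    | zero =>
      intro ε hε
      have h0 : 0 < ε := lt_trans (by positivity) hε.1
      have h1 : ε ≤ ε₂ := by simpa using hε.2
      have h2 : ε₂ / 2 < ε := by simpa using hε.1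
      have hK : 0 ≤ K := (norm_nonneg _).trans (hf ε ⟨h0, h1⟩)
      have h3 : ‖f ε - f (ε / 2)‖ ≤ 2 * K := by
        refine (norm_sub_le _ _).trans ?_
        linarith [hf ε ⟨h0, h1⟩, hf (ε / 2) ⟨by positivity, by linarith⟩]
      refine h3.trans ?_
      have h4 : √ε ≤ √ε₂ := Real.sqrt_le_sqrt h1
      have h5 : 4 * K / ε₂ ≤ A - 4 * C * √ε := by
        have := le_abs_self (4 * K / ε₂)
        have : C * √ε ≤ C * √ε₂ := by gcongr
        rw [hA]; linarith
      calc 2 * K = (ε₂ / 2) * (4 * K / ε₂) := by field_simp; ring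
        _ ≤ ε * (4 * K / ε₂) := by gcongr
        _ ≤ _ := by gcongr
    | succ m ih =>
      intro ε hε
      have h0 : 0 < ε := lt_trans (by positivity) hε.1
      have hm : 2 * ε ∈ Ioc (ε₂ / 2 ^ (m + 1)) (ε₂ / 2 ^ m) := by
        have e1 : ε₂ / 2 ^ (m + 1 + 1) = ε₂ / 2 ^ (m + 1) / 2 := by rw [pow_succ]; field_simp
        have e2 : ε₂ / 2 ^ (m + 1) = ε₂ / 2 ^ m / 2 := by rw [pow_succ]; field_simp
        constructor
        · have := hε.1; rw [e1] at this; linarith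
        · have := hε.2; rw [e2] at this; linarith
      have h1 : 2 * ε ≤ ε₂ := hm.2.trans (div_le_self hε₂.le (one_le_pow₀ (by norm_num)))
      have h2 := ih (2 * ε) hm
      have h3 := hD (2 * ε) ⟨by positivity, h1⟩
      rw [show 2 * ε / 2 = ε by ring] at h2 h3
      have h4 : f ε - f (ε / 2) = ((f (2 * ε) - f ε) -
          (f (2 * ε) - 3 * f ε + 2 * f (ε / 2))) / 2 := by ring
      rw [h4, norm_div, Complex.norm_ofNat]
      have h5 := norm_sub_le (f (2 * ε) - f ε) (f (2 * ε) - 3 * f ε + 2 * f (ε / 2))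
      have h6 : √(2 * ε) = √2 * √ε := Real.sqrt_mul (by norm_num) _
      have h7 : (1.4 : ℝ) ≤ √2 := Real.le_sqrt_of_sq_le (by norm_num)
      rw [h6] at h2 h3
      have h8 : 0 ≤ C * √ε := by positivity
      rw [div_le_iff₀ (by norm_num)]
      refine h5.trans ((add_le_add h2 h3).trans ?_)
      have h9 : 0 ≤ ε * (C * √ε) := by positivity
      nlinarith
  intro ε hε
  obtain ⟨m, hm1, hm2⟩ := exists_nat_pow_near_of_lt_one (div_pos hε.1 hε₂)
    ((div_le_one hε₂).2 hε.2) (show (0 : ℝ) < 1 / 2 by norm_num) (by norm_num)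
  have := key m ε ⟨by
      rw [lt_div_iff₀ hε₂] at hm1
      calc ε₂ / 2 ^ (m + 1) = (1 / 2) ^ (m + 1) * ε₂ := by rw [one_div, inv_pow]; field_simp
        _ < ε := hm1, by
      rw [div_le_iff₀ hε₂] at hm2
      calc ε ≤ (1 / 2) ^ m * ε₂ := hm2
        _ = _ := by rw [one_div, inv_pow]; field_simp⟩
  refine this.trans ?_
  have : 0 ≤ ε * (4 * C * √ε) := by have := hε.1; positivity
  linarith

/-- A uniformly bounded family of holomorphic functions with a first order expansion in `ε` at each
real point converges at rate `O(ε)`, uniformly on a smaller disc. -/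
theorem uniform_limit_of_pointwise_expansion {F : ℝ → ℂ → ℂ} {a₀ a₁ : ℝ → ℂ} {u r K ε₀ : ℝ}
    (hr : 0 < r) (hε₀ : 0 < ε₀)
    (hF : ∀ ε ∈ Ioc 0 ε₀, DifferentiableOn ℂ (F ε) (Metric.ball (u : ℂ) r))
    (hFK : ∀ ε ∈ Ioc 0 ε₀, ∀ z ∈ Metric.ball (u : ℂ) r, ‖F ε z‖ ≤ K)
    (hpt : ∀ x : ℝ, |x - u| < r → ∃ C : ℝ, ∃ ε₁ > 0, ∀ ε ∈ Ioc 0 ε₁,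
      ‖F ε x - (a₀ x + a₁ x * ε)‖ ≤ C * ε ^ 2) :
    ∃ s > 0, s < r ∧ ∃ F₀ : ℂ → ℂ, DifferentiableOn ℂ F₀ (Metric.ball (u : ℂ) s) ∧
      (∀ x : ℝ, |x - u| < s → F₀ x = a₀ x) ∧
      ∃ C : ℝ, 0 ≤ C ∧ ∃ ε₂ > 0, ε₂ ≤ ε₀ ∧ ∀ ε ∈ Ioc 0 ε₂, ∀ z ∈ Metric.ball (u : ℂ) s,
        ‖F ε z - F₀ z‖ ≤ C * ε := by
  have hK : 0 ≤ K := (norm_nonneg _).trans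
    (hFK ε₀ ⟨hε₀, le_rfl⟩ u (Metric.mem_ball_self hr))
  have half : ∀ {η ε : ℝ}, ε ∈ Ioc 0 η → ε / 2 ∈ Ioc 0 η := fun {η ε} h =>
    ⟨by linarith [h.1], by linarith [h.1, h.2]⟩
  -- The weights 1, −3, 2 at ε, ε/2, ε/4 annihilate both 1 and ε, since 1 − 3 + 2 = 0 and 1 − 3/2 +
  -- 2/4 = 0. Hence a₀ and a₁, of which no regularity is known, drop out and a holomorphic family
  -- remains that is O(ε²) at each real point.
  obtain ⟨s, hs, hsr, C, hC, ε₂, hε₂, hε₂₀, hbd⟩ := uniform_bound_of_pointwise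
    (D := fun ε z => F ε z - 3 * F (ε / 2) z + 2 * F (ε / 2 / 2) z) (A := 6 * K) hr hε₀
    (by positivity)
    (fun ε hε => ((hF ε hε).sub ((hF _ (half hε)).const_mul 3)).add
      ((hF _ (half (half hε))).const_mul 2))
    (fun ε hε z hz => by
      have h1 := hFK ε hε z hz
      have h2 := hFK _ (half hε) z hz
      have h3 := hFK _ (half (half hε)) z hz
      have h4 := norm_add_le (F ε z - 3 * F (ε / 2) z) (2 * F (ε / 2 / 2) z)
      have h5 := norm_sub_le (F ε z) (3 * F (ε / 2) z)
      simp only [norm_mul, Complex.norm_ofNat] at h4 h5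
      linarith)
    (fun x hx => by
      obtain ⟨C, ε₁, hε₁, h⟩ := hpt x hx
      refine ⟨2 * |C|, ε₁, hε₁, fun ε hε => ?_⟩
      have h' : ∀ ε ∈ Ioc 0 ε₁, ‖F ε x - (a₀ x + a₁ x * ε)‖ ≤ |C| * ε ^ 2 := fun ε hε =>
        (h ε hε).trans (by gcongr; exact le_abs_self C)
      have h1 := h' ε hε
      have h2 := h' _ (half hε)
      have h3 := h' _ (half (half hε))
      have e : F ε x - 3 * F (ε / 2) x + 2 * F (ε / 2 / 2) x =
          (F ε x - (a₀ x + a₁ x * ε)) - 3 * (F (ε / 2) x - (a₀ x + a₁ x * ((ε / 2 : ℝ) : ℂ)))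
          + 2 * (F (ε / 2 / 2) x - (a₀ x + a₁ x * ((ε / 2 / 2 : ℝ) : ℂ))) := by
        push_cast; ring
      rw [e]
      generalize F ε x - (a₀ x + a₁ x * ε) = y1 at *
      generalize F (ε / 2) x - (a₀ x + a₁ x * ((ε / 2 : ℝ) : ℂ)) = y2 at *
      generalize F (ε / 2 / 2) x - (a₀ x + a₁ x * ((ε / 2 / 2 : ℝ) : ℂ)) = y3 at *
      have h4 := norm_add_le (y1 - 3 * y2) (2 * y3)
      have h5 := norm_sub_le y1 (3 * y2)
      simp only [norm_mul, Complex.norm_ofNat] at h4 h5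
      have h0 : 0 ≤ |C| * ε ^ 2 := by positivity
      nlinarith)
  obtain ⟨A, hA, hAb⟩ := first_difference_bound (K := K) hC hε₂
  have hstep : ∀ z ∈ Metric.ball (u : ℂ) s, ∀ ε ∈ Ioc 0 ε₂, ‖F ε z - F (ε / 2) z‖ ≤ A * ε := by
    intro z hz ε hε
    have hz' : ‖z - u‖ ≤ s := by rw [← dist_eq_norm]; exact (Metric.mem_ball.1 hz).le
    refine hAb (fun ε => F ε z) (fun ε hε => hFK ε ⟨hε.1, hε.2.trans hε₂₀⟩ z ?_)
      (fun ε hε => hbd ε hε z hz') ε hε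
    exact Metric.ball_subset_ball hsr.le hz
  have hdy : ∀ {ε : ℝ}, ε ∈ Ioc 0 ε₂ → ∀ m : ℕ, ε / 2 ^ m ∈ Ioc 0 ε₂ := fun {ε} hε m =>
    ⟨by have := hε.1; positivity, (div_le_self hε.1.le (one_le_pow₀ (by norm_num))).trans hε.2⟩
  -- The first differences along ε, ε/2, ε/4, … are dominated by a geometric series, which yields a
  -- limit with an explicit rate.
  have hlim : ∀ ε ∈ Ioc 0 ε₂, ∃ G : ℂ → ℂ, (∀ z ∈ Metric.ball (u : ℂ) s,
      Tendsto (fun m : ℕ => F (ε / 2 ^ m) z) atTop (𝓝 (G z)) ∧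
      ∀ m : ℕ, ‖F (ε / 2 ^ m) z - G z‖ ≤ 2 * A * (ε / 2 ^ m)) := by
    intro ε hε
    have hd : ∀ z ∈ Metric.ball (u : ℂ) s, ∀ m : ℕ,
        dist (F (ε / 2 ^ m) z) (F (ε / 2 ^ (m + 1)) z) ≤ 2 * (A * ε) / 2 / 2 ^ m := by
      intro z hz m
      rw [dist_eq_norm]
      have := hstep z hz _ (hdy hε m)
      rw [pow_succ, ← div_div]
      refine this.trans (le_of_eq ?_)
      ring
    have : ∀ z, ∃ g, z ∈ Metric.ball (u : ℂ) s →
        Tendsto (fun m : ℕ => F (ε / 2 ^ m) z) atTop (𝓝 g) := by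
      intro z
      by_cases hz : z ∈ Metric.ball (u : ℂ) s
      · obtain ⟨g, hg⟩ := cauchySeq_tendsto_of_complete (cauchySeq_of_le_geometric_two (hd z hz))
        exact ⟨g, fun _ => hg⟩
      · exact ⟨0, fun h => absurd h hz⟩
    choose G hG using this
    refine ⟨G, fun z hz => ⟨hG z hz, fun m => ?_⟩⟩
    have := dist_le_of_le_geometric_two_of_tendsto (hd z hz) (hG z hz) m
    rw [dist_eq_norm] at this
    refine this.trans (le_of_eq ?_)
    ring
  choose! G hG using hlim
  have hGd : ∀ ε ∈ Ioc 0 ε₂, DifferentiableOn ℂ (G ε) (Metric.ball (u : ℂ) s) := by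
    intro ε hε
    refine TendstoLocallyUniformlyOn.differentiableOn (φ := atTop)
      (F := fun (m : ℕ) z => F (ε / 2 ^ m) z) ?_
      (Eventually.of_forall fun m => (hF _ ⟨(hdy hε m).1, (hdy hε m).2.trans hε₂₀⟩).mono
        (Metric.ball_subset_ball hsr.le)) Metric.isOpen_ball
    refine TendstoUniformlyOn.tendstoLocallyUniformlyOn ?_
    rw [Metric.tendstoUniformlyOn_iff]
    intro η hη
    have ht : Tendsto (fun m : ℕ => 2 * A * (ε / 2 ^ m)) atTop (𝓝 (2 * A * (ε * 0))) := by
      refine (Tendsto.const_mul _ (Tendsto.congr (fun m => ?_)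
        ((tendsto_pow_atTop_nhds_zero_of_lt_one (r := (1 / 2 : ℝ)) (by norm_num)
          (by norm_num)).const_mul ε)))
      rw [one_div, inv_pow]; field_simp
    simp only [mul_zero] at ht
    filter_upwards [ht.eventually (gt_mem_nhds hη)] with m hm z hz
    rw [dist_comm, dist_eq_norm]
    exact ((hG ε hε z hz).2 m).trans_lt hm
  have hGr : ∀ ε ∈ Ioc 0 ε₂, ∀ x : ℝ, |x - u| < s → G ε x = a₀ x := by
    intro ε hε x hx
    have hxs : (x : ℂ) ∈ Metric.ball (u : ℂ) s := by
      rw [Metric.mem_ball, dist_eq_norm, ← Complex.ofReal_sub, Complex.norm_real]; exact hx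
    refine tendsto_nhds_unique (hG ε hε x hxs).1 ?_
    obtain ⟨C, ε₁, hε₁, h⟩ := hpt x (hx.trans hsr)
    have ht : Tendsto (fun m : ℕ => ε / 2 ^ m) atTop (𝓝 0) := by
      have := (tendsto_pow_atTop_nhds_zero_of_lt_one (r := (1 / 2 : ℝ)) (by norm_num)
          (by norm_num)).const_mul ε
      rw [mul_zero] at this
      refine this.congr fun m => ?_
      rw [one_div, inv_pow]; field_simp
    rw [tendsto_iff_norm_sub_tendsto_zero]
    have hb : Tendsto (fun m : ℕ => C * (ε / 2 ^ m) ^ 2 + ‖a₁ x‖ * (ε / 2 ^ m)) atTop (𝓝 0) := by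
      have := ((ht.pow 2).const_mul C).add (ht.const_mul ‖a₁ x‖)
      simpa using this
    refine squeeze_zero' (Eventually.of_forall fun _ => norm_nonneg _) ?_ hb
    filter_upwards [ht.eventually (gt_mem_nhds hε₁)] with m hm
    have hp := (hdy hε m).1
    have h1 := h _ ⟨hp, hm.le⟩
    have e : F (ε / 2 ^ m) x - a₀ x =
        (F (ε / 2 ^ m) x - (a₀ x + a₁ x * ((ε / 2 ^ m : ℝ) : ℂ))) + a₁ x * ((ε / 2 ^ m : ℝ) : ℂ) := by
      ring
    rw [e]
    refine (norm_add_le _ _).trans (add_le_add h1 (le_of_eq ?_))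
    rw [norm_mul, Complex.norm_real, Real.norm_eq_abs, abs_of_pos hp]
  -- The limit could depend on the starting point of the dyadic sequence. All these limits equal a₀
  -- on the real axis, so the identity theorem makes them coincide on the disc.
  have hGeq : ∀ ε ∈ Ioc 0 ε₂, EqOn (G ε) (G ε₂) (Metric.ball (u : ℂ) s) := by
    intro ε hε
    have h₂ : ε₂ ∈ Ioc 0 ε₂ := ⟨hε₂, le_rfl⟩
    refine AnalyticOnNhd.eqOn_of_preconnected_of_frequently_eq (z₀ := (u : ℂ))
      ((hGd ε hε).analyticOnNhd Metric.isOpen_ball) ((hGd ε₂ h₂).analyticOnNhd Metric.isOpen_ball)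
      (convex_ball _ _).isPreconnected (Metric.mem_ball_self hs) ?_
    have hc : Tendsto (fun x : ℝ => (x : ℂ)) (𝓝[≠] u) (𝓝[≠] (u : ℂ)) :=
      Complex.continuous_ofReal.continuousAt.continuousWithinAt.tendsto_nhdsWithin
        (fun x hx => by simpa using hx)
    refine hc.frequently (Eventually.frequently ?_)
    have : ∀ᶠ x in 𝓝[≠] u, |x - u| < s := by
      refine nhdsWithin_le_nhds ?_
      filter_upwards [Metric.ball_mem_nhds u hs] with x hx
      exact hx
    filter_upwards [this] with x hx
    rw [hGr ε hε x hx, hGr ε₂ h₂ x hx]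
  refine ⟨s, hs, hsr, G ε₂, hGd ε₂ ⟨hε₂, le_rfl⟩, hGr ε₂ ⟨hε₂, le_rfl⟩, 2 * A, by positivity, ε₂,
    hε₂, hε₂₀, fun ε hε z hz => ?_⟩
  rw [← hGeq ε hε hz]
  simpa using (hG ε hε z hz).2 0

/-- Cauchy estimates for the convergence of derivatives. -/
theorem iteratedDeriv_sub_le {f g : ℂ → ℂ} {c : ℂ} {s η : ℝ} (hs : 0 < s) (n : ℕ)
    (hf : DifferentiableOn ℂ f (Metric.ball c s)) (hg : DifferentiableOn ℂ g (Metric.ball c s))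
    (h : ∀ z ∈ Metric.ball c s, ‖f z - g z‖ ≤ η) :
    ‖iteratedDeriv n f c - iteratedDeriv n g c‖ ≤ n.factorial * η / (s / 2) ^ n := by
  have hsub : Metric.closedBall c (s / 2) ⊆ Metric.ball c s :=
    Metric.closedBall_subset_ball (by linarith)
  have hfa := (hf.analyticOnNhd Metric.isOpen_ball) c (Metric.mem_ball_self hs)
  have hga := (hg.analyticOnNhd Metric.isOpen_ball) c (Metric.mem_ball_self hs)
  have := Complex.norm_iteratedDeriv_le_of_forall_mem_sphere_norm_le (f := f - g) (c := c) (C := η) n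
    (by positivity : 0 < s / 2) (((hf.sub hg).mono hsub).diffContOnCl_ball subset_rfl)
    (fun z hz => h z (hsub (Metric.sphere_subset_closedBall hz)))
  rwa [iteratedDeriv_sub hfa.contDiffAt hga.contDiffAt] at this

end FwdSmile

end

/-! ### Bounds for moment generating functions -/

noncomputable section

namespace FwdSmile

/-- A holomorphic function on a vertical strip whose real part is bounded above grows at most
exponentially. -/
theorem norm_le_exp_of_re_le {G : ℂ → ℂ} {u ρ A : ℝ} (hρ : 0 < ρ)
    (hG : DifferentiableOn ℂ G {z | |z.re - u| < ρ}) (hA : ∀ z : ℂ, |z.re - u| < ρ → (G z).re ≤ A) :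
    ∃ B : ℝ, 0 ≤ B ∧ ∀ z : ℂ, |z.re - u| ≤ ρ / 2 → ‖G z‖ ≤ B * Real.exp (5 / (2 * ρ) * |z.im|) := by
  -- By Borel–Carathéodory in discs of radius ρ centred on the line Re z = u, N at most triples over
  -- a distance ρ/2. Chaining such steps along the line gives exponential growth in Im z.
  set N : ℂ → ℝ := fun z => ‖G z - A‖ + 1 with hN
  have step : ∀ c z : ℂ, c.re = u → ‖z - c‖ ≤ ρ / 2 → N z ≤ 3 * N c := by
    intro c z hc hz
    have hmem : ∀ w ∈ Metric.ball (0 : ℂ) ρ, |(c + w).re - u| < ρ := by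
      intro w hw
      rw [Complex.add_re, hc, add_sub_cancel_left]
      exact (Complex.abs_re_le_norm w).trans_lt (by simpa using hw)
    have := Complex.borelCaratheodory (f := fun w => G (c + w) - A) (M := 1) (R := ρ) (z := z - c)
      one_pos (((hG.comp ((differentiable_const c).add differentiable_id).differentiableOn
        hmem)).sub_const _) (fun w hw => by
          have := hA _ (hmem w hw)
          simp only [mem_ofPred_eq, Complex.sub_re, Complex.ofReal_re]
          linarith) hρ (by simp only [mem_ball_zero_iff]; linarith)
    simp only [add_sub_cancel, add_zero, mul_one] at this
    have hz0 := norm_nonneg (z - c)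
    have e1 : 2 * ‖z - c‖ / (ρ - ‖z - c‖) ≤ 2 := by
      rw [div_le_iff₀ (by linarith)]; linarith
    have e2 : ‖G c - A‖ * (ρ + ‖z - c‖) / (ρ - ‖z - c‖) ≤ 3 * ‖G c - A‖ := by
      rw [div_le_iff₀ (by linarith)]
      nlinarith [norm_nonneg (G c - A)]
    simp only [hN]
    linarith
  have line : ∀ n : ℕ, ∀ q : ℝ, |q| ≤ n * (ρ / 2) → N (u + q * Complex.I) ≤ 3 ^ n * N u := by
    intro n
    induction n with
    | zero =>
      intro q hq
      have : q = 0 := by simpa using hq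
      simp [this]
    | succ n ih =>
      intro q hq
      have hn : (0 : ℝ) < n + 1 := by positivity
      push_cast at hq
      have h1 := ih (q * (n / (n + 1))) (by
        rw [abs_mul, abs_of_nonneg (by positivity : (0 : ℝ) ≤ n / (n + 1))]
        calc |q| * (n / (n + 1)) ≤ ((n + 1) * (ρ / 2)) * (n / (n + 1)) := by gcongr
          _ = _ := by field_simp)
      have h2 := step (u + (q * (n / (n + 1)) : ℝ) * Complex.I) (u + q * Complex.I)
        (by rw [Complex.add_re, Complex.re_ofReal_mul]; simp) (by
        have : (u : ℂ) + q * Complex.I - (u + (q * (n / (n + 1)) : ℝ) * Complex.I)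
            = ((q / (n + 1) : ℝ) : ℂ) * Complex.I := by
          have : ((n : ℂ) + 1) ≠ 0 := by exact_mod_cast hn.ne'
          push_cast; field_simp; ring
        rw [this, norm_mul, Complex.norm_I, mul_one, Complex.norm_real, Real.norm_eq_abs, abs_div,
          abs_of_pos hn, div_le_iff₀ hn]
        linarith)
      calc _ ≤ _ := h2
        _ ≤ 3 * (3 ^ n * N u) := by gcongr
        _ = _ := by ring
  have hNu : 0 ≤ N u := by simp only [hN]; positivity
  -- In 9 = 3 · 3 one factor is the final step away from the central line, the other the rounding up
  -- of the number of steps. The rate 5/(2ρ) is 2/ρ steps per unit length times 5/4 ≥ log 3.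
  refine ⟨9 * N u + |A|, by positivity, fun z hz => ?_⟩
  set n := ⌈|z.im| / (ρ / 2)⌉₊ with hn
  have h1 := line n z.im (by
    have := Nat.le_ceil (|z.im| / (ρ / 2))
    rwa [div_le_iff₀ (by positivity)] at this)
  have h2 := step (u + z.im * Complex.I) z (by simp) (by
    have : z - (u + z.im * Complex.I) = ((z.re - u : ℝ) : ℂ) := by
      apply Complex.ext <;> simp
    rw [this, Complex.norm_real]; exact hz)
  have h3 : (3 : ℝ) ^ n ≤ 3 * Real.exp (5 / (2 * ρ) * |z.im|) := by
    have h4 : (n : ℝ) ≤ |z.im| / (ρ / 2) + 1 := (Nat.ceil_lt_add_one (by positivity)).le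
    have h5 : (3 : ℝ) ≤ Real.exp (5 / 4) := by
      have := Real.quadratic_le_exp_of_nonneg (show (0 : ℝ) ≤ 5 / 4 by norm_num)
      linarith
    have h6 : Real.log 3 ≤ 5 / 4 := (Real.log_le_iff_le_exp (by norm_num)).2 h5
    have h7 : 0 ≤ Real.log 3 := Real.log_nonneg (by norm_num)
    calc (3 : ℝ) ^ n = Real.exp (n * Real.log 3) := by
          rw [mul_comm, Real.exp_mul, Real.exp_log (by norm_num), Real.rpow_natCast]
      _ ≤ Real.exp ((|z.im| / (ρ / 2) + 1) * Real.log 3) := by gcongr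
      _ = 3 * Real.exp (|z.im| / (ρ / 2) * Real.log 3) := by
          rw [add_mul, one_mul, Real.exp_add, Real.exp_log (by norm_num), mul_comm]
      _ ≤ 3 * Real.exp (|z.im| / (ρ / 2) * (5 / 4)) := by gcongr
      _ = _ := by congr 2; field_simp; ring
  have h8 : ‖G z‖ ≤ N z + |A| := by
    have : G z = (G z - A) + A := by ring
    have h9 := norm_add_le (G z - A) A
    rw [← this, Complex.norm_real, Real.norm_eq_abs] at h9
    simp only [hN]; linarith
  have h10 : 1 ≤ Real.exp (5 / (2 * ρ) * |z.im|) := Real.one_le_exp (by positivity)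
  calc ‖G z‖ ≤ 3 * (3 ^ n * N u) + |A| * 1 := by linarith
    _ ≤ 3 * ((3 * Real.exp (5 / (2 * ρ) * |z.im|)) * N u)
        + |A| * Real.exp (5 / (2 * ρ) * |z.im|) := by gcongr
    _ = _ := by ring

/-- A function of the form `M * exp (-G / ε)` that is bounded on two vertical lines is bounded on the
strip between them, if `M` is bounded and `Re G` is bounded above. -/
theorem strip_bound {G M : ℂ → ℂ} {u ρ A B C ε : ℝ} (hρ : 0 < ρ) (hε : 0 < ε)
    (hG : DifferentiableOn ℂ G {z | |z.re - u| < ρ}) (hA : ∀ z : ℂ, |z.re - u| < ρ → (G z).re ≤ A)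
    (hM : DifferentiableOn ℂ M {z | |z.re - u| < ρ})
    (hMB : ∀ z : ℂ, |z.re - u| ≤ ρ / 2 → ‖M z‖ ≤ B)
    (hC : ∀ z : ℂ, |z.re - u| = ρ / 4 → ‖M z * Complex.exp (-G z / ε)‖ ≤ C) {z : ℂ}
    (hz : |z.re - u| ≤ ρ / 4) : ‖M z * Complex.exp (-G z / ε)‖ ≤ C := by
  obtain ⟨B', hB', hexp⟩ := norm_le_exp_of_re_le hρ hG hA
  have hd : DifferentiableOn ℂ (fun z => M z * Complex.exp (-G z / ε)) {z | |z.re - u| < ρ} :=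
    hM.mul ((hG.neg.div_const _).cexp)
  have hcl : closure (Complex.re ⁻¹' Ioo (u - ρ / 4) (u + ρ / 4)) ⊆ {z | |z.re - u| < ρ} := by
    refine (closure_minimal (t := Complex.re ⁻¹' Icc (u - ρ / 4) (u + ρ / 4))
      (preimage_mono Ioo_subset_Icc_self) (isClosed_Icc.preimage Complex.continuous_re)).trans ?_
    intro w hw
    simp only [mem_preimage, mem_Icc] at hw
    simp only [mem_ofPred_eq, abs_lt]
    constructor <;> linarith [hw.1, hw.2]
  rw [abs_le] at hz
  refine PhragmenLindelof.vertical_strip (f := fun z => M z * Complex.exp (-G z / ε))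
    (a := u - ρ / 4) (b := u + ρ / 4) (hd.mono hcl).diffContOnCl
    ⟨5 / (2 * ρ), ?_, B' / ε, ?_⟩ (fun w hw => hC w ?_) (fun w hw => hC w ?_) (by linarith)
    (by linarith)
  -- The strip has width ρ/2, so Phragmén–Lindelöf tolerates growth exp(B e^{c|Im z|}) for every c <
  -- 2π/ρ. The growth rate found for G satisfies this.
  · have := Real.pi_gt_three
    rw [div_lt_div_iff₀ (by positivity) (by linarith)]
    nlinarith
  · refine Asymptotics.IsBigO.of_bound B ?_
    refine mem_inf_of_right ?_
    intro w hw
    simp only [mem_preimage, mem_Ioo] at hw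
    have hw' : |w.re - u| ≤ ρ / 2 := by rw [abs_le]; constructor <;> linarith
    simp only [mem_ofPred_eq, norm_mul, Complex.norm_exp, Real.norm_eq_abs, Real.abs_exp]
    gcongr
    · exact (norm_nonneg _).trans (hMB w hw')
    · exact hMB w hw'
    · rw [Complex.div_ofReal_re, div_mul_eq_mul_div]
      gcongr
      exact (Complex.re_le_norm _).trans (by rw [norm_neg]; exact hexp w hw')
  · rw [hw, abs_of_nonpos] <;> linarith
  · rw [hw, abs_of_nonneg] <;> linarith

variable {Ω : Type*} [MeasurableSpace Ω]

/-- The moment generating function divided by its leading exponential part. -/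
def normMgf (μ : ℝ → Measure Ω) (Y : ℝ → Ω → ℝ) (G : ℂ → ℂ) (ε : ℝ) (z : ℂ) : ℂ :=
  cMgf μ Y ε z * Complex.exp (-G z / ε)

variable {μ : ℝ → Measure Ω} {Y : ℝ → Ω → ℝ} {G : ℂ → ℂ}

theorem differentiableOn_cMgf {D : Set ℝ} (hD : IsOpen D) {ε : ℝ} (hε : 0 < ε)
    (h : D ⊆ lmgfDomain μ Y ε) : DifferentiableOn ℂ (cMgf μ Y ε) {z | z.re ∈ D} := by
  refine (differentiableOn_complexMGF (X := Y ε) (μ := μ ε)).comp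
    (g := complexMGF (Y ε) (μ ε)) (f := fun z : ℂ => z / ε) (by fun_prop) ?_
  intro z hz
  simp only [mem_ofPred_eq, Complex.div_ofReal_re]
  refine mem_interior.2 ⟨(fun x => x / ε) '' D, ?_, ?_, mem_image_of_mem _ hz⟩
  · rintro _ ⟨x, hx, rfl⟩
    exact h hx
  · have : (fun x : ℝ => x / ε) '' D = (fun y => y * ε) ⁻¹' D := by
      ext y
      constructor
      · rintro ⟨x, hx, rfl⟩
        simpa [hε.ne'] using hx
      · intro hy
        exact ⟨y * ε, hy, by field_simp⟩
    rw [this]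
    exact hD.preimage (by fun_prop)

/-- Triangle inequality under the expectation. For fixed ε it reduces boundedness on a vertical
strip to boundedness on a compact real segment, an a priori bound that may depend on ε. -/
theorem norm_cMgf_le {ε : ℝ} (z : ℂ) : ‖cMgf μ Y ε z‖ ≤ ‖cMgf μ Y ε (z.re : ℂ)‖ := by
  unfold cMgf
  rw [show ((z.re : ℂ) / ε) = ((z.re / ε : ℝ) : ℂ) by push_cast; rfl, complexMGF_ofReal,
    Complex.norm_real, Real.norm_eq_abs, abs_of_nonneg mgf_nonneg]
  refine norm_complexMGF_le_mgf.trans (le_of_eq ?_)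
  rw [Complex.div_ofReal_re]

/-- At zeros of `cMgf` the normalised function vanishes, so the bound on the logarithm is required
only elsewhere. This matters because `reLmgf` takes a default value at the zeros, where the true
value is −∞. -/
theorem norm_normMgf_le_of_re_le {ε C : ℝ} (hε : 0 < ε) {z : ℂ}
    (h : cMgf μ Y ε z ≠ 0 → reLmgf μ Y ε z - (G z).re ≤ C * ε) :
    ‖normMgf μ Y G ε z‖ ≤ Real.exp C := by
  unfold normMgf
  rcases eq_or_ne (cMgf μ Y ε z) 0 with h0 | h0
  · simp [h0, Real.exp_nonneg]
  · rw [norm_mul, Complex.norm_exp, Complex.div_ofReal_re, Complex.neg_re,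
      ← Real.exp_log (norm_pos_iff.2 h0), ← Real.exp_add]
    refine Real.exp_le_exp.2 ?_
    have := h h0
    unfold reLmgf at this
    have h2 : Real.log ‖cMgf μ Y ε z‖ + -(G z).re / ε =
        (ε * Real.log ‖cMgf μ Y ε z‖ - (G z).re) / ε := by field_simp; ring
    rw [h2, div_le_iff₀ hε]
    exact this

/-- On each vertical line the normalised moment generating function is bounded. -/
theorem TailControl.line_bound {D : Set ℝ} {Λ₀ : ℝ → ℝ} (hT : TailControl μ Y D Λ₀ G) {p : ℝ}
    (hp : p ∈ D) (hp0 : p ≠ 0) : ∃ C : ℝ, ∃ ε₁ > (0 : ℝ), ∀ ε ∈ Ioc 0 ε₁, ∀ z : ℂ, z.re = p →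
      ‖normMgf μ Y G ε z‖ ≤ C := by
  obtain ⟨ε₁, hε₁, qs, hqs, M, hM⟩ := hT.upper p hp hp0
  obtain ⟨ε₂, hε₂, C, hC⟩ := hT.approx p hp hp0 qs hqs
  refine ⟨max (Real.exp C) (Real.exp M), min ε₁ ε₂, lt_min hε₁ hε₂, fun ε hε z hz => ?_⟩
  have hzq : z = p + z.im * Complex.I := by
    rw [← hz]; exact (Complex.re_add_im z).symm
  rcases le_total |z.im| qs with hq | hq
  · refine (norm_normMgf_le_of_re_le hε.1 fun _ => ?_).trans (le_max_left _ _)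
    rw [hzq]
    exact (le_abs_self _).trans (hC ε ⟨hε.1, hε.2.trans (min_le_right _ _)⟩ _ hq).2
  · refine (norm_normMgf_le_of_re_le hε.1 fun h0 => ?_).trans (le_max_right _ _)
    rw [hzq] at h0 ⊢
    exact hM ε ⟨hε.1, hε.2.trans (min_le_left _ _)⟩ _ hq h0

/-- On each vertical line Re G is largest on the real axis. The consequence is an upper bound for Re
G on thin strips, which is the input of Borel–Carathéodory. -/
theorem TailControl.re_le {D : Set ℝ} {Λ₀ : ℝ → ℝ} (hT : TailControl μ Y D Λ₀ G) {z : ℂ}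
    (hz : z.re ∈ D) (hz0 : z.re ≠ 0) : (G z).re ≤ Λ₀ z.re := by
  rcases eq_or_ne z.im 0 with h | h
  · have : z = (z.re : ℂ) := by apply Complex.ext <;> simp [h]
    rw [this, hT.extend _ (by simpa using hz) (by simpa using hz0)]
    simp
  · have := hT.unique_max _ hz hz0 _ h
    rw [Complex.re_add_im, hT.extend _ hz hz0] at this
    simpa using this.le

/-- The normalised moment generating functions are holomorphic and uniformly bounded in a complex
neighbourhood of each nonzero point of the domain. -/
theorem Assumptions.exists_uniform_bound {Λ : Fin 3 → ℝ → ℝ} (hA : Assumptions μ Y Λ)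
    (hT : TailControl μ Y (D0int μ Y) (Λ 0) G) {u : ℝ} (hu : u ∈ D0int μ Y) (hu0 : u ≠ 0) :
    ∃ r > 0, (∀ x : ℝ, |x - u| < r → x ∈ D0int μ Y ∧ x ≠ 0) ∧
      ∃ K : ℝ, ∃ ε₀ > 0, ∀ ε ∈ Ioc 0 ε₀, D0int μ Y ⊆ lmgfDomain μ Y ε ∧
        DifferentiableOn ℂ (normMgf μ Y G ε) (Metric.ball (u : ℂ) r) ∧
        ∀ z ∈ Metric.ball (u : ℂ) r, ‖normMgf μ Y G ε z‖ ≤ K := by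
  have hDo : IsOpen (D0int μ Y) := isOpen_interior
  obtain ⟨ρ, hρ, hball⟩ := Metric.isOpen_iff.1 (hDo.inter isOpen_ne) u ⟨hu, hu0⟩
  have hball' : ∀ x : ℝ, |x - u| < ρ → x ∈ D0int μ Y ∧ x ≠ 0 := fun x hx =>
    hball (by rw [Metric.mem_ball, Real.dist_eq]; exact hx)
  obtain ⟨e₀, he₀, hsub, -⟩ := hA.smooth
  set σ := ρ / 2 with hσ
  have hσ0 : 0 < σ := by positivity
  have hin : ∀ {x : ℝ}, |x - u| ≤ σ → x ∈ D0int μ Y ∧ x ≠ 0 := fun {x} hx =>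
    hball' x (by linarith)
  have hIcc : Icc (u - σ) (u + σ) ⊆ D0int μ Y := fun x hx =>
    (hin (by rw [abs_le]; constructor <;> linarith [hx.1, hx.2])).1
  obtain ⟨A, hAb⟩ := isCompact_Icc.bddAbove_image ((hA.differentiable.continuousOn).mono hIcc)
  have hGd : DifferentiableOn ℂ G {z | |z.re - u| < σ} := hT.holo.mono fun z hz => hin (le_of_lt hz)
  have hGA : ∀ z : ℂ, |z.re - u| < σ → (G z).re ≤ A := fun z hz => by
    have hz' := hin hz.le
    refine (hT.re_le hz'.1 hz'.2).trans (hAb (mem_image_of_mem _ ?_))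
    rw [abs_lt] at hz
    constructor <;> linarith
  have hl : |u - σ / 4 - u| ≤ σ := by rw [abs_le]; constructor <;> linarith
  have hr : |u + σ / 4 - u| ≤ σ := by rw [abs_le]; constructor <;> linarith
  -- The constants of tail control depend on the abscissa. They are used only on the two lines u ±
  -- σ/4, and the strip between inherits their maximum, independent of ε.
  obtain ⟨C₁, e₁, he₁, hC₁⟩ := hT.line_bound (hin hl).1 (hin hl).2
  obtain ⟨C₂, e₂, he₂, hC₂⟩ := hT.line_bound (hin hr).1 (hin hr).2
  refine ⟨σ / 4, by positivity, fun x hx => hin (by linarith), max C₁ C₂,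
    min (e₀ / 2) (min e₁ e₂), by positivity, fun ε hε => ?_⟩
  have hεe₀ : ε ∈ Ioo 0 e₀ := ⟨hε.1, lt_of_le_of_lt (hε.2.trans (min_le_left _ _)) (by linarith)⟩
  have hMd := differentiableOn_cMgf hDo hε.1 (hsub ε hεe₀)
  have hre : ∀ z ∈ Metric.ball (u : ℂ) (σ / 4), |z.re - u| < σ / 4 := fun z hz => by
    have := Complex.abs_re_le_norm (z - u)
    rw [Complex.sub_re, Complex.ofReal_re] at this
    rw [Metric.mem_ball, dist_eq_norm] at hz
    linarith
  refine ⟨hsub ε hεe₀, ?_, fun z hz => ?_⟩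
  · refine DifferentiableOn.mul (hMd.mono fun z hz => (hin ((hre z hz).le.trans (by linarith))).1)
      (((hGd.mono fun z hz => ?_).neg.div_const _).cexp)
    exact (hre z hz).trans (by linarith)
  · have hcont : ContinuousOn (fun x : ℝ => cMgf μ Y ε (x : ℂ)) (Icc (u - σ) (u + σ)) :=
      hMd.continuousOn.comp Complex.continuous_ofReal.continuousOn fun x hx => hIcc hx
    obtain ⟨B, hB⟩ := isCompact_Icc.exists_bound_of_continuousOn hcont
    refine strip_bound (M := cMgf μ Y ε) (B := B) hσ0 hε.1 hGd hGA
      (hMd.mono fun z hz => (hin (le_of_lt hz)).1) (fun w hw => ?_) (fun w hw => ?_) (hre z hz).le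
    · refine (norm_cMgf_le w).trans (hB _ ?_)
      rw [abs_le] at hw
      constructor <;> linarith
    · rcases (abs_eq (by positivity)).1 hw with h | h
      · exact (hC₂ ε ⟨hε.1, hε.2.trans ((min_le_right _ _).trans (min_le_right _ _))⟩ w
          (by linarith)).trans (le_max_right _ _)
      · exact (hC₁ ε ⟨hε.1, hε.2.trans ((min_le_right _ _).trans (min_le_left _ _))⟩ w
          (by linarith)).trans (le_max_left _ _)

end FwdSmile

end

/-! ### Even parts and Gaussian moments -/

noncomputable section

namespace FwdSmile

open Polynomial in
theorem iteratedDeriv_eval_sub (p : ℂ[X]) (c : ℂ) (j : ℕ) :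
    iteratedDeriv j (fun z => p.eval (z - c)) = fun z => (derivative^[j] p).eval (z - c) := by
  induction j with
  | zero => simp
  | succ j ih =>
    rw [iteratedDeriv_succ, ih]
    ext z
    rw [Function.iterate_succ_apply']
    have := ((derivative^[j] p).hasDerivAt (z - c)).comp z ((hasDerivAt_id z).sub_const c)
    simpa [Function.comp_def] using this.deriv

open Polynomial in
/-- The coefficients in Taylor's formula. -/
theorem iteratedDeriv_of_taylor {f R : ℂ → ℂ} {c : ℂ} {r : ℝ} (hr : 0 < r) {p : ℂ[X]} {n : ℕ}
    (hR : DifferentiableOn ℂ R (Metric.ball c r))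
    (h : ∀ z ∈ Metric.ball c r, f z = p.eval (z - c) + (z - c) ^ n * R z) {j : ℕ} (hj : j < n) :
    iteratedDeriv j f c = j.factorial * p.coeff j := by
  have hev : f =ᶠ[𝓝 c] (fun z => p.eval (z - c)) + fun z => (z - c) ^ n * R z := by
    filter_upwards [Metric.ball_mem_nhds c hr] with z hz
    exact h z hz
  have hRa : AnalyticAt ℂ R c := hR.analyticAt (Metric.ball_mem_nhds c hr)
  have h1 : AnalyticAt ℂ (fun z => p.eval (z - c)) c := by
    refine Differentiable.analyticAt ?_ c
    exact p.differentiable.comp (differentiable_id.sub_const c)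
  have h2 : AnalyticAt ℂ (fun z => (z - c) ^ n * R z) c := by fun_prop
  rw [hev.iteratedDeriv_eq, iteratedDeriv_add h1.contDiffAt h2.contDiffAt]
  have h3 : (n : ℕ∞) ≤ analyticOrderAt (fun z => (z - c) ^ n * R z) c := by
    rw [natCast_le_analyticOrderAt h2]
    exact ⟨R, hRa, Eventually.of_forall fun z => by simp⟩
  rw [(natCast_le_analyticOrderAt_iff_iteratedDeriv_eq_zero h2).1 h3 j hj, add_zero,
    iteratedDeriv_eval_sub]
  simp only [sub_self]
  rw [← coeff_zero_eq_eval_zero, coeff_iterate_derivative]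
  simp [Nat.descFactorial_self]

/-- Second order Taylor expansion of the even part of a bounded holomorphic function. -/
theorem norm_even_part_sub_le {f : ℂ → ℂ} {r A : ℝ} (hr : 0 < r)
    (hf : DifferentiableOn ℂ f (Metric.ball 0 r)) (hA : ∀ z ∈ Metric.ball 0 r, ‖f z‖ ≤ A) {z : ℂ}
    (hz : z ∈ Metric.ball 0 r) :
    ‖(f z + f (-z)) / 2 - (f 0 + iteratedDeriv 2 f 0 / 2 * z ^ 2)‖ ≤ A * (2 / r) ^ 4 * ‖z‖ ^ 4 := by
  obtain ⟨p, R, hp, hR, hRb, h⟩ := exists_taylor hr 4 hf hA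
  have h0 := iteratedDeriv_of_taylor hr hR h (j := 0) (by norm_num)
  have h2 := iteratedDeriv_of_taylor hr hR h (j := 2) (by norm_num)
  have hz' : -z ∈ Metric.ball 0 r := by simpa using hz
  have hev : ∀ w : ℂ, p.eval w = p.coeff 0 + p.coeff 1 * w + p.coeff 2 * w ^ 2 + p.coeff 3 * w ^ 3 := by
    intro w
    rw [Polynomial.eval_eq_sum_range' (n := 4)]
    · simp [Finset.sum_range_succ]
    · rcases eq_or_ne p 0 with rfl | hp0
      · simp
      · exact (Polynomial.natDegree_lt_iff_degree_lt hp0).2 hp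
  simp only [iteratedDeriv_zero, Nat.factorial] at h0 h2
  -- The coefficients of degree 1 and 3 cancel, so the remainder is of fourth order.
  have e : (f z + f (-z)) / 2 - (f 0 + iteratedDeriv 2 f 0 / 2 * z ^ 2) =
      z ^ 4 * ((R z + R (-z)) / 2) := by
    rw [h0, h2, h z hz, h (-z) hz', sub_zero, sub_zero, hev, hev]
    push_cast
    ring
  rw [e, norm_mul, norm_pow, mul_comm]
  gcongr
  rw [norm_div, Complex.norm_ofNat, div_le_iff₀ (by norm_num)]
  linarith [norm_add_le (R z) (R (-z)), hRb z hz, hRb (-z) hz']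

/-- Even Gaussian moments. -/
theorem gaussian_moment {b : ℝ} (hb : 0 < b) (n : ℕ) :
    Integrable (fun x : ℝ => x ^ (2 * n) * Real.exp (-b * x ^ 2)) ∧
    ∫ x : ℝ, x ^ (2 * n) * Real.exp (-b * x ^ 2) =
      (2 * n - 1 : ℕ).doubleFactorial / (2 * b) ^ n * √(Real.pi / b) := by
  constructor
  · have := integrable_rpow_mul_exp_neg_mul_sq hb (s := (2 * n : ℕ))
      (by linarith [(Nat.cast_nonneg (2 * n) : (0 : ℝ) ≤ _)])
    simpa only [Real.rpow_natCast] using this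
  · have h1 : ∀ x : ℝ, x ^ (2 * n) * Real.exp (-b * x ^ 2) =
        (fun y : ℝ => y ^ (2 * n) * Real.exp (-b * y ^ 2)) |x| := by
      intro x
      simp only [sq_abs, pow_mul]
    rw [integral_congr_ae (Eventually.of_forall h1), integral_comp_abs (f := fun y : ℝ => y ^ (2 * n) * Real.exp (-b * y ^ 2))]
    have h2 := integral_rpow_mul_exp_neg_mul_rpow (p := 2) (q := (2 * n : ℕ)) (b := b) two_pos
      (by linarith [(Nat.cast_nonneg (2 * n) : (0 : ℝ) ≤ _)]) hb
    have h3 : ∫ x in Ioi (0 : ℝ), x ^ (2 * n) * Real.exp (-b * x ^ 2) =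
        ∫ x in Ioi (0 : ℝ), x ^ ((2 * n : ℕ) : ℝ) * Real.exp (-b * x ^ (2 : ℝ)) := by
      refine setIntegral_congr_fun measurableSet_Ioi fun x _ => ?_
      simp only [Real.rpow_natCast, Real.rpow_two]
    rw [h3, h2]
    have h4 : (((2 * n : ℕ) : ℝ) + 1) / 2 = n + 1 / 2 := by push_cast; ring
    have h5 : -(((2 * n : ℕ) : ℝ) + 1) / 2 = -((n : ℝ) + 1 / 2) := by push_cast; ring
    rw [h4, h5, Real.Gamma_nat_add_half, Real.rpow_neg hb.le, Real.rpow_add hb, Real.rpow_natCast,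
      ← Real.sqrt_eq_rpow, Real.sqrt_div Real.pi_pos.le, mul_pow]
    field_simp

end FwdSmile

end

/-! ### Laplace's method -/

noncomputable section

namespace FwdSmile

/-- Used with w = −q²/ε and z = iq. Multiplied by z², the terms free of w, linear in w and quadratic
in w become q², q⁴/ε and q⁶/ε², and each of these has a Gaussian moment of order ε. -/
theorem iteratedDeriv_two_mul_exp {f κ : ℂ → ℂ} (hf : AnalyticAt ℂ f 0) (hκ : AnalyticAt ℂ κ 0)
    (hκ0 : κ 0 = 0) (w : ℂ) :
    iteratedDeriv 2 (fun z => f z * Complex.exp (w * κ z)) 0 =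
      iteratedDeriv 2 f 0 + w * (2 * deriv κ 0 * deriv f 0 + iteratedDeriv 2 κ 0 * f 0)
        + w ^ 2 * (deriv κ 0 ^ 2 * f 0) := by
  have h1 : ∀ᶠ z in 𝓝 (0 : ℂ), deriv (fun z => f z * Complex.exp (w * κ z)) z =
      (deriv f z + w * deriv κ z * f z) * Complex.exp (w * κ z) := by
    filter_upwards [hf.eventually_analyticAt, hκ.eventually_analyticAt] with z h1 h2
    have := h1.differentiableAt.hasDerivAt.mul ((h2.differentiableAt.hasDerivAt.const_mul w).cexp)
    rw [HasDerivAt.deriv (f := fun z => f z * Complex.exp (w * κ z)) this]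
    ring
  have hf' : AnalyticAt ℂ (deriv f) 0 := hf.deriv
  have hκ' : AnalyticAt ℂ (deriv κ) 0 := hκ.deriv
  rw [iteratedDeriv_succ, iteratedDeriv_one, Filter.EventuallyEq.deriv_eq h1]
  have := (hf'.differentiableAt.hasDerivAt.add ((hκ'.differentiableAt.hasDerivAt.const_mul w).mul
    hf.differentiableAt.hasDerivAt)).mul ((hκ.differentiableAt.hasDerivAt.const_mul w).cexp)
  rw [HasDerivAt.deriv (f := fun z => (deriv f z + w * deriv κ z * f z) * Complex.exp (w * κ z)) this]
  simp only [hκ0, mul_zero, Complex.exp_zero, mul_one, iteratedDeriv_succ, iteratedDeriv_zero,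
    Pi.add_apply, Pi.mul_apply]
  ring

theorem integral_add_four {E : Type*} [NormedAddCommGroup E] [NormedSpace ℝ E]
    {f₀ f₁ f₂ f₃ : ℝ → E} (h₀ : Integrable f₀) (h₁ : Integrable f₁) (h₂ : Integrable f₂)
    (h₃ : Integrable f₃) : ∫ x, (f₀ x + f₁ x + f₂ x + f₃ x) =
      (∫ x, f₀ x) + (∫ x, f₁ x) + (∫ x, f₂ x) + ∫ x, f₃ x := by
  have h₀₁ : Integrable fun x => f₀ x + f₁ x := h₀.add h₁
  have h₀₂ : Integrable fun x => f₀ x + f₁ x + f₂ x := h₀₁.add h₂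
  rw [integral_add h₀₂ h₃, integral_add h₀₁ h₂, integral_add h₀ h₁]

/-- Second order Laplace expansion along the imaginary axis, uniform over bounded holomorphic
amplitudes. -/
theorem laplace_expansion {a r K : ℝ} {κ : ℂ → ℂ} (ha : 0 < a) (hr : 0 < r) (hK : 0 ≤ K)
    (hκ : DifferentiableOn ℂ κ (Metric.ball 0 r)) (hκ0 : κ 0 = 0) :
    ∃ δ > 0, δ < r ∧ ∃ C : ℝ, 0 ≤ C ∧ (∀ q : ℝ, |q| ≤ δ → ‖κ (q * Complex.I)‖ ≤ a / 8) ∧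
      ∀ f : ℂ → ℂ, DifferentiableOn ℂ f (Metric.ball 0 r) → (∀ z ∈ Metric.ball 0 r, ‖f z‖ ≤ K) →
      ∀ ε ∈ Ioc (0 : ℝ) 1,
      ‖(∫ q in -δ..δ, f (q * Complex.I) *
          Complex.exp ((a / 2 + κ (q * Complex.I)) * (q * Complex.I) ^ 2 / ε)) -
        √(2 * Real.pi * ε / a) * (f 0 - ε * (iteratedDeriv 2 f 0 / (2 * a)
          - 3 * (2 * deriv κ 0 * deriv f 0 + iteratedDeriv 2 κ 0 * f 0) / (2 * a ^ 2)
          + 15 * (deriv κ 0 ^ 2 * f 0) / (2 * a ^ 3)))‖ ≤ C * (ε ^ 2 * √ε) := by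
  have h0 : (0 : ℂ) ∈ Metric.ball (0 : ℂ) r := Metric.mem_ball_self hr
  have hκc : ContinuousAt κ 0 := (hκ.differentiableAt (Metric.ball_mem_nhds 0 hr)).continuousAt
  -- With |κ| ≤ a/8 the perturbation of the exponent costs at most exp(aq²/(8ε)), so the Gaussian
  -- rate a/(2ε) only drops to 3a/(8ε).
  obtain ⟨ρ₀, hρ₀, hκρ₀⟩ := Metric.continuousAt_iff.1 hκc (a / 8) (by positivity)
  set ρ := min ρ₀ r with hρdef
  have hρ : 0 < ρ := lt_min hρ₀ hr
  have hρr : ρ ≤ r := min_le_right _ _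
  have hκρ : ∀ z ∈ Metric.ball (0 : ℂ) ρ, ‖κ z‖ ≤ a / 8 := by
    intro z hz
    have := hκρ₀ ((Metric.mem_ball.1 hz).trans_le (min_le_left _ _))
    rw [hκ0, dist_zero_right] at this
    exact this.le
  have hsub : Metric.ball (0 : ℂ) ρ ⊆ Metric.ball 0 r := Metric.ball_subset_ball hρr
  set δ := ρ / 2 with hδ
  have hδ0 : 0 < δ := by positivity
  have hmem : ∀ q : ℝ, |q| ≤ δ → (q * Complex.I : ℂ) ∈ Metric.ball (0 : ℂ) ρ := by
    intro q hq
    rw [mem_ball_zero_iff, norm_mul, Complex.norm_I, mul_one, Complex.norm_real, Real.norm_eq_abs]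
    linarith
  set k1 := ‖deriv κ 0‖ with hk1
  set k2 := ‖iteratedDeriv 2 κ 0‖ with hk2
  -- bounds for the derivatives of the amplitude
  set B1 : ℝ := K / (r / 2) with hB1
  set B2 : ℝ := 2 * K / (r / 2) ^ 2 with hB2
  set L1 : ℝ := 2 * k1 * B1 + k2 * K with hL1
  set L2 : ℝ := k1 ^ 2 * K with hL2
  set P : ℝ := K * (2 / ρ) ^ 4 with hP
  have hB1' : 0 ≤ B1 := by positivity
  have hB2' : 0 ≤ B2 := by positivity
  have hL1' : 0 ≤ L1 := by positivity
  have hL2' : 0 ≤ L2 := by positivity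
  have hP' : 0 ≤ P := by positivity
  set S := √(Real.pi / (a / 2)) with hS
  set S' := √(Real.pi / (3 * a / 8)) with hS'
  -- The first summand bounds the error near 0 through the fourth moment at rate 3a/(8ε). The others
  -- bound the tail of the approximation; 3, 15, 105, 945 are the double factorials of the moments
  -- of order 4 to 10.
  refine ⟨δ, hδ0, by linarith, P * (3 / (3 * a / 4) ^ 2 * S')
    + (K * (3 / a ^ 2 * S) + B2 / 2 * (15 / a ^ 3 * S) + L1 / 2 * (105 / a ^ 4 * S)
      + L2 / 2 * (945 / a ^ 5 * S)) / δ ^ 4, by positivity, fun q hq => hκρ _ (hmem q hq),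
    fun f hf hfK ε hε => ?_⟩
  have hε0 : 0 < ε := hε.1
  have hfa : AnalyticAt ℂ f 0 := hf.analyticAt (Metric.ball_mem_nhds 0 hr)
  have hκa : AnalyticAt ℂ κ 0 := hκ.analyticAt (Metric.ball_mem_nhds 0 hr)
  have hf0 : ‖f 0‖ ≤ K := hfK 0 h0
  have hcl : Metric.closedBall (0 : ℂ) (r / 2) ⊆ Metric.ball 0 r :=
    Metric.closedBall_subset_ball (by linarith)
  have hd1 : ‖deriv f 0‖ ≤ B1 := by
    refine Complex.norm_deriv_le_of_forall_mem_sphere_norm_le (by positivity)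
      ((hf.mono hcl).diffContOnCl_ball subset_rfl) fun z hz => hfK z (hcl (Metric.sphere_subset_closedBall hz))
  have hd2 : ‖iteratedDeriv 2 f 0‖ ≤ B2 := by
    have := Complex.norm_iteratedDeriv_le_of_forall_mem_sphere_norm_le 2 (by positivity)
      ((hf.mono hcl).diffContOnCl_ball subset_rfl) fun z hz => hfK z (hcl (Metric.sphere_subset_closedBall hz))
    simpa [Nat.factorial] using this
  set ℓ1 : ℂ := 2 * deriv κ 0 * deriv f 0 + iteratedDeriv 2 κ 0 * f 0 with hℓ1
  set ℓ2 : ℂ := deriv κ 0 ^ 2 * f 0 with hℓ2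
  have hℓ1b : ‖ℓ1‖ ≤ L1 := by
    refine (norm_add_le _ _).trans ?_
    rw [norm_mul, norm_mul, norm_mul, Complex.norm_ofNat, hL1]
    gcongr
  have hℓ2b : ‖ℓ2‖ ≤ L2 := by
    rw [hℓ2, norm_mul, norm_pow, hL2]
    gcongr
  set b : ℝ := a / (2 * ε) with hb
  have hb0 : 0 < b := by positivity
  set b' : ℝ := 3 * a / (8 * ε) with hb'
  have hb'0 : 0 < b' := by positivity
  -- the integrand and the approximation of its even part
  set I : ℝ → ℂ := fun q => f (q * Complex.I) *
    Complex.exp ((a / 2 + κ (q * Complex.I)) * (q * Complex.I) ^ 2 / ε) with hI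
  set T : ℝ → ℂ := fun q => (Real.exp (-b * q ^ 2) : ℂ) * (f 0 - q ^ 2 / 2 *
    (iteratedDeriv 2 f 0 - q ^ 2 / ε * ℓ1 + (q ^ 2 / ε) ^ 2 * ℓ2)) with hT
  have hnear : ∀ q : ℝ, |q| ≤ δ →
      ‖(I q + I (-q)) / 2 - T q‖ ≤ P * (q ^ (2 * 2) * Real.exp (-b' * q ^ 2)) := by
    intro q hq
    -- Here q is frozen: w is a constant while the even part of z ↦ f(z) e^{wκ(z)} is expanded at 0,
    -- and z = iq is inserted only afterwards.
    set w : ℂ := -(q ^ 2 / ε : ℝ) with hw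
    have hΘ := norm_even_part_sub_le (f := fun z => f z * Complex.exp (w * κ z)) (r := ρ)
      (A := K * Real.exp (q ^ 2 / ε * (a / 8))) hρ
      ((hf.mono hsub).mul ((hκ.mono hsub).const_mul w).cexp) (fun z hz => by
        rw [norm_mul, Complex.norm_exp]
        gcongr
        · exact hfK z (hsub hz)
        · refine (Complex.re_le_norm _).trans ?_
          rw [norm_mul, hw, norm_neg, Complex.norm_real, Real.norm_eq_abs,
            abs_of_nonneg (by positivity)]
          gcongr
          exact hκρ z hz) (hmem q hq)
    rw [iteratedDeriv_two_mul_exp hfa hκa hκ0, hκ0, mul_zero, Complex.exp_zero, mul_one] at hΘ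
    have hIq : ∀ x : ℝ, x ^ 2 = q ^ 2 → I x = (Real.exp (-b * q ^ 2) : ℂ) *
        (f (x * Complex.I) * Complex.exp (w * κ (x * Complex.I))) := by
      intro x hx
      simp only [hI]
      rw [Complex.ofReal_exp, mul_left_comm, ← Complex.exp_add]
      congr 2
      have hε' : (ε : ℂ) ≠ 0 := by exact_mod_cast hε0.ne'
      have hx' : (x : ℂ) ^ 2 = q ^ 2 := by exact_mod_cast hx
      rw [mul_pow, Complex.I_sq, hx', hw, hb]
      push_cast
      field_simp
      ring
    rw [hIq q rfl, hIq (-q) (by ring)]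
    have e : (((Real.exp (-b * q ^ 2) : ℂ) * (f (q * Complex.I) * Complex.exp (w * κ (q * Complex.I)))
        + (Real.exp (-b * q ^ 2) : ℂ) * (f ((-q : ℝ) * Complex.I) *
          Complex.exp (w * κ ((-q : ℝ) * Complex.I)))) / 2 - T q) =
        (Real.exp (-b * q ^ 2) : ℂ) * ((f (q * Complex.I) * Complex.exp (w * κ (q * Complex.I))
          + f (-(q * Complex.I)) * Complex.exp (w * κ (-(q * Complex.I)))) / 2
          - (f 0 + (iteratedDeriv 2 f 0 + w * ℓ1 + w ^ 2 * ℓ2) / 2 * (q * Complex.I) ^ 2)) := by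
      simp only [hT]
      rw [mul_pow, Complex.I_sq, hw]
      push_cast
      rw [neg_mul]
      ring_nf
    rw [e, norm_mul, Complex.norm_real, Real.norm_eq_abs, Real.abs_exp]
    calc Real.exp (-b * q ^ 2) * _ ≤ Real.exp (-b * q ^ 2) *
          (K * Real.exp (q ^ 2 / ε * (a / 8)) * (2 / ρ) ^ 4 * ‖(q * Complex.I : ℂ)‖ ^ 4) := by
          gcongr
      _ = P * (q ^ (2 * 2) * (Real.exp (-b * q ^ 2) * Real.exp (q ^ 2 / ε * (a / 8)))) := by
          rw [norm_mul, Complex.norm_I, mul_one, Complex.norm_real, Real.norm_eq_abs,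
            Even.pow_abs (by decide)]
          simp only [hP]; ring
      _ = _ := by
          rw [← Real.exp_add]
          congr 3
          simp only [hb, hb']; field_simp; ring
  have hTb : ∀ q : ℝ, ‖T q‖ ≤ K * Real.exp (-b * q ^ 2)
      + B2 / 2 * (q ^ 2 * Real.exp (-b * q ^ 2)) + L1 / (2 * ε) * (q ^ 4 * Real.exp (-b * q ^ 2))
      + L2 / (2 * ε ^ 2) * (q ^ 6 * Real.exp (-b * q ^ 2)) := by
    intro q
    have hq2 : ‖((q : ℂ) ^ 2)‖ = q ^ 2 := by
      rw [norm_pow, Complex.norm_real, Real.norm_eq_abs, sq_abs]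
    have hεn : ‖(ε : ℂ)‖ = ε := by rw [Complex.norm_real, Real.norm_eq_abs, abs_of_pos hε0]
    simp only [hT]
    rw [norm_mul, Complex.norm_real, Real.norm_eq_abs, Real.abs_exp]
    have h1 : ‖f 0 - (q : ℂ) ^ 2 / 2 *
        (iteratedDeriv 2 f 0 - q ^ 2 / ε * ℓ1 + (q ^ 2 / ε) ^ 2 * ℓ2)‖ ≤
        K + q ^ 2 / 2 * (B2 + q ^ 2 / ε * L1 + (q ^ 2 / ε) ^ 2 * L2) := by
      refine (norm_sub_le _ _).trans (add_le_add hf0 ?_)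
      rw [norm_mul, norm_div, hq2, Complex.norm_ofNat]
      gcongr
      refine (norm_add_le _ _).trans (add_le_add ((norm_sub_le _ _).trans (add_le_add hd2 ?_)) ?_)
      · rw [norm_mul, norm_div, hq2, hεn]; gcongr
      · rw [norm_mul, norm_pow, norm_div, hq2, hεn]; gcongr
    calc _ ≤ Real.exp (-b * q ^ 2) * (K + q ^ 2 / 2 *
          (B2 + q ^ 2 / ε * L1 + (q ^ 2 / ε) ^ 2 * L2)) := by gcongr
      _ = _ := by field_simp; ring
  have hmom := fun n => gaussian_moment hb0 n
  have hmom' := fun n => gaussian_moment hb'0 n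
  have hTint : Integrable T ∧ ∫ q, T q = √(2 * Real.pi * ε / a) *
      (f 0 - ε * (iteratedDeriv 2 f 0 / (2 * a) - 3 * ℓ1 / (2 * a ^ 2)
        + 15 * ℓ2 / (2 * a ^ 3))) := by
    have i0 := (hmom 0).1.ofReal (𝕜 := ℂ) |>.mul_const (f 0)
    have i1 := (hmom 1).1.ofReal (𝕜 := ℂ) |>.mul_const (-(iteratedDeriv 2 f 0 / 2))
    have i2 := (hmom 2).1.ofReal (𝕜 := ℂ) |>.mul_const (ℓ1 / (2 * ε))
    have i3 := (hmom 3).1.ofReal (𝕜 := ℂ) |>.mul_const (-(ℓ2 / (2 * ε ^ 2)))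
    have hε' : (ε : ℂ) ≠ 0 := by exact_mod_cast hε0.ne'
    have ha' : (a : ℂ) ≠ 0 := by exact_mod_cast ha.ne'
    have hTe : T = fun q => ((q ^ (2 * 0) * Real.exp (-b * q ^ 2) : ℝ) : ℂ) * f 0
        + ((q ^ (2 * 1) * Real.exp (-b * q ^ 2) : ℝ) : ℂ) * (-(iteratedDeriv 2 f 0 / 2))
        + ((q ^ (2 * 2) * Real.exp (-b * q ^ 2) : ℝ) : ℂ) * (ℓ1 / (2 * ε))
        + ((q ^ (2 * 3) * Real.exp (-b * q ^ 2) : ℝ) : ℂ) * (-(ℓ2 / (2 * ε ^ 2))) := by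
      ext q
      simp only [hT]
      push_cast
      field_simp
      ring
    refine ⟨hTe ▸ ((i0.add i1).add i2).add i3, ?_⟩
    rw [hTe]
    refine (integral_add_four i0 i1 i2 i3).trans ?_
    simp only [integral_mul_const]
    rw [integral_ofReal (𝕜 := ℂ), integral_ofReal (𝕜 := ℂ), integral_ofReal (𝕜 := ℂ),
      integral_ofReal (𝕜 := ℂ), (hmom 0).2, (hmom 1).2, (hmom 2).2, (hmom 3).2]
    have hsq : Real.pi / b = 2 * Real.pi * ε / a := by simp only [hb]; field_simp
    rw [hsq]
    norm_num [Nat.doubleFactorial, hb]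
    field_simp
    ring
  have hII : IntervalIntegrable I volume (-δ) δ := by
    refine ContinuousOn.intervalIntegrable ?_
    have hm : MapsTo (fun q : ℝ => (q * Complex.I : ℂ)) (uIcc (-δ) δ) (Metric.ball 0 r) := by
      intro q hq
      rw [uIcc_of_le (by linarith)] at hq
      exact hsub (hmem q (abs_le.2 hq))
    have c1 : ContinuousOn (fun q : ℝ => (q * Complex.I : ℂ)) (uIcc (-δ) δ) := by fun_prop
    exact (hf.continuousOn.comp c1 hm).mul
      ((((continuousOn_const.add (hκ.continuousOn.comp c1 hm)).mul (c1.pow 2)).div_const _).cexp)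
  have hII' : IntervalIntegrable (fun q => I (-q)) volume (-δ) δ := by
    have := (hII.comp_sub_left 0).symm
    simpa using this
  -- The interval is symmetric, so only the even part of the integrand matters.
  have hsym : ∫ q in -δ..δ, I q = ∫ q in -δ..δ, (I q + I (-q)) / 2 := by
    have h1 : ∫ q in -δ..δ, I (-q) = ∫ q in -δ..δ, I q := by
      rw [intervalIntegral.integral_comp_neg]; simp
    rw [intervalIntegral.integral_div, intervalIntegral.integral_add hII hII', h1]
    ring
  have hle : -δ ≤ δ := by linarith
  have hsplit : (∫ q in -δ..δ, I q) - ∫ q, T q =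
      (∫ q in Ioc (-δ) δ, ((I q + I (-q)) / 2 - T q)) - ∫ q in (Ioc (-δ) δ)ᶜ, T q := by
    rw [hsym, intervalIntegral.integral_of_le hle, integral_sub
      (((intervalIntegrable_iff_integrableOn_Ioc_of_le hle).1 (hII.add hII')).div_const 2)
      hTint.1.integrableOn, ← integral_add_compl (measurableSet_Ioc (a := -δ) (b := δ)) hTint.1]
    ring
  rw [← hTint.2, hsplit]
  refine (norm_sub_le _ _).trans ?_
  have hsqS : √(Real.pi / b) = S * √ε := by
    rw [hS, ← Real.sqrt_mul (by positivity)]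
    congr 1; simp only [hb]; field_simp
  have hsqS' : √(Real.pi / b') = S' * √ε := by
    rw [hS', ← Real.sqrt_mul (by positivity)]
    congr 1; simp only [hb']; field_simp
  have hI1 : ‖∫ q in Ioc (-δ) δ, ((I q + I (-q)) / 2 - T q)‖ ≤
      P * (3 / (3 * a / 4) ^ 2 * S') * (ε ^ 2 * √ε) := by
    have hint := ((hmom' 2).1.const_mul P)
    calc _ ≤ ∫ q in Ioc (-δ) δ, P * (q ^ (2 * 2) * Real.exp (-b' * q ^ 2)) := by
          refine norm_integral_le_of_norm_le hint.integrableOn ?_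
          refine (ae_restrict_iff' measurableSet_Ioc).2 (Eventually.of_forall fun q hq => ?_)
          exact hnear q (abs_le.2 ⟨hq.1.le, hq.2⟩)
      _ ≤ ∫ q, P * (q ^ (2 * 2) * Real.exp (-b' * q ^ 2)) :=
          setIntegral_le_integral hint (Eventually.of_forall fun q => by
            simp only [Pi.zero_apply]
            have : 0 ≤ q ^ (2 * 2) := by rw [pow_mul]; positivity
            positivity)
      _ = _ := by
          rw [integral_const_mul, (hmom' 2).2, hsqS']
          simp only [Nat.doubleFactorial, hb']
          push_cast
          field_simp
          ring
  have hI2 : ‖∫ q in (Ioc (-δ) δ)ᶜ, T q‖ ≤ (K * (3 / a ^ 2 * S) + B2 / 2 * (15 / a ^ 3 * S)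
      + L1 / 2 * (105 / a ^ 4 * S) + L2 / 2 * (945 / a ^ 5 * S)) / δ ^ 4 * (ε ^ 2 * √ε) := by
    set W : ℝ → ℝ := fun q => (K * (q ^ (2 * 2) * Real.exp (-b * q ^ 2))
      + B2 / 2 * (q ^ (2 * 3) * Real.exp (-b * q ^ 2))
      + L1 / (2 * ε) * (q ^ (2 * 4) * Real.exp (-b * q ^ 2))
      + L2 / (2 * ε ^ 2) * (q ^ (2 * 5) * Real.exp (-b * q ^ 2))) / δ ^ 4 with hW
    have j0 := (hmom 2).1.const_mul K
    have j1 := (hmom 3).1.const_mul (B2 / 2)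
    have j2 := (hmom 4).1.const_mul (L1 / (2 * ε))
    have j3 := (hmom 5).1.const_mul (L2 / (2 * ε ^ 2))
    have hWi : Integrable W := (((j0.add j1).add j2).add j3).div_const _
    have hp : ∀ (q : ℝ) (n : ℕ), 0 ≤ q ^ (2 * n) := fun q n => by rw [pow_mul]; positivity
    calc _ ≤ ∫ q in (Ioc (-δ) δ)ᶜ, W q := by
          refine norm_integral_le_of_norm_le hWi.integrableOn ?_
          refine (ae_restrict_iff' measurableSet_Ioc.compl).2 (Eventually.of_forall fun q hq => ?_)
          have hq' : δ ≤ |q| := by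
            by_contra! hc
            rw [abs_lt] at hc
            exact hq ⟨hc.1, hc.2.le⟩
          -- Inserting q⁴/δ⁴ ≥ 1 turns the tail into full Gaussian moments and gains the factor ε².
          have h4 : δ ^ 4 ≤ q ^ 4 := by
            calc δ ^ 4 ≤ |q| ^ 4 := by gcongr
              _ = q ^ 4 := Even.pow_abs (by decide) q
          have hN : 0 ≤ K * Real.exp (-b * q ^ 2)
              + B2 / 2 * (q ^ 2 * Real.exp (-b * q ^ 2))
              + L1 / (2 * ε) * (q ^ 4 * Real.exp (-b * q ^ 2))
              + L2 / (2 * ε ^ 2) * (q ^ 6 * Real.exp (-b * q ^ 2)) :=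
            (norm_nonneg _).trans (hTb q)
          refine (hTb q).trans ?_
          simp only [hW]
          rw [le_div_iff₀ (by positivity)]
          refine (mul_le_mul_of_nonneg_left h4 hN).trans (le_of_eq ?_)
          ring
      _ ≤ ∫ q, W q := by
          refine setIntegral_le_integral hWi (Eventually.of_forall fun q => ?_)
          have h2 := hp q 2
          have h3 := hp q 3
          have h4 := hp q 4
          have h5 := hp q 5
          simp only [Pi.zero_apply, hW]
          positivity
      _ = (K * (3 / a ^ 2 * S) + ε * (B2 / 2 * (15 / a ^ 3 * S) + L1 / 2 * (105 / a ^ 4 * S)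
            + L2 / 2 * (945 / a ^ 5 * S))) / δ ^ 4 * (ε ^ 2 * √ε) := by
          simp only [hW]
          rw [integral_div, integral_add_four j0 j1 j2 j3]
          simp only [integral_const_mul]
          rw [(hmom 2).2, (hmom 3).2, (hmom 4).2, (hmom 5).2, hsqS]
          simp only [Nat.doubleFactorial, hb]
          push_cast
          field_simp
          ring
      _ ≤ (K * (3 / a ^ 2 * S) + 1 * (B2 / 2 * (15 / a ^ 3 * S) + L1 / 2 * (105 / a ^ 4 * S)
            + L2 / 2 * (945 / a ^ 5 * S))) / δ ^ 4 * (ε ^ 2 * √ε) := by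
          gcongr
          exact hε.2
      _ = _ := by ring
  calc _ ≤ _ := add_le_add hI1 hI2
    _ = _ := by ring

end FwdSmile

end

/-! ### Positivity of the second derivative -/

noncomputable section

namespace FwdSmile

/-- The derivatives of a holomorphic extension of a real function. -/
theorem iteratedDeriv_ofReal_eq {f : ℂ → ℂ} {φ : ℝ → ℝ} {c : ℝ} (hf : AnalyticAt ℂ f c)
    (h : ∀ᶠ x : ℝ in 𝓝 c, f x = φ x) (n : ℕ) :
    ∀ᶠ x : ℝ in 𝓝 c, iteratedDeriv n f x = iteratedDeriv n φ x := by
  induction n with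
  | zero => simpa using h
  | succ n ih =>
    have ha : ∀ᶠ x : ℝ in 𝓝 c, AnalyticAt ℂ f x :=
      Complex.continuous_ofReal.continuousAt.eventually hf.eventually_analyticAt
    filter_upwards [ih.eventually_nhds, ha] with x hx hax
    rw [iteratedDeriv_succ, iteratedDeriv_succ]
    set d := deriv (iteratedDeriv n f) x with hd
    have h1 : HasDerivAt (iteratedDeriv n f) d (x : ℂ) :=
      (by rw [hd, iteratedDeriv_eq_iterate]; exact (hax.iterated_deriv n).differentiableAt.hasDerivAt)
    have h2 : HasDerivAt (iteratedDeriv n φ) d.re x := by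
      refine h1.real_of_complex.congr_of_eventuallyEq ?_
      filter_upwards [hx] with y hy
      rw [hy, Complex.ofReal_re]
    have h3 : HasDerivAt (fun y : ℝ => iteratedDeriv n f y) d x := h1.comp_ofReal
    have h4 : HasDerivAt (fun y : ℝ => iteratedDeriv n f y) (d.re : ℂ) x :=
      h2.ofReal_comp.congr_of_eventuallyEq hx
    rw [h3.unique h4, h2.deriv]

/-- If `Re G` has, on each vertical line close to `u`, its strict maximum on the real axis, then
the second derivative of `G` at `u` is positive. -/
theorem second_deriv_pos {G : ℂ → ℂ} {φ : ℝ → ℝ} {u : ℝ} (hG : AnalyticAt ℂ G u)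
    (hφ : ∀ᶠ x : ℝ in 𝓝 u, G x = φ x)
    (hmax : ∀ᶠ z : ℂ in 𝓝 (u : ℂ), z.im ≠ 0 → (G z).re < (G z.re).re) :
    0 < iteratedDeriv 2 φ u := by
  have hder : ∀ n, iteratedDeriv n G u = iteratedDeriv n φ u := fun n =>
    (iteratedDeriv_ofReal_eq hG hφ n).self_of_nhds
  have hd1 : deriv G u = (deriv φ u : ℝ) := by simpa using hder 1
  -- The slope of G at u is real, so subtracting the tangent line preserves the comparison of real
  -- parts on vertical lines.
  set h : ℂ → ℂ := fun z => G z - G u - deriv G u * (z - u) with hh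
  have hha : AnalyticAt ℂ h u := by
    have : AnalyticAt ℂ (fun z : ℂ => deriv G u * (z - u)) u := by fun_prop
    exact (hG.sub analyticAt_const).sub this
  have hre : ∀ᶠ z : ℂ in 𝓝 (u : ℂ), z.im ≠ 0 → (h z).re < (h z.re).re := by
    filter_upwards [hmax] with z hz hz0
    have := hz hz0
    simp only [hh, hd1, Complex.sub_re, Complex.mul_re, Complex.ofReal_re, Complex.ofReal_im,
      zero_mul, sub_zero]
    linarith
  have hu0 : h u = 0 := by simp [hh]
  have hne : ¬ ∀ᶠ z in 𝓝 (u : ℂ), h z = 0 := by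
    intro h0
    have ht : Tendsto (fun y : ℝ => (u : ℂ) + y * Complex.I) (𝓝[≠] 0) (𝓝 (u : ℂ)) := by
      have : Continuous fun y : ℝ => (u : ℂ) + y * Complex.I := by fun_prop
      simpa using (this.tendsto 0).mono_left (nhdsWithin_le_nhds (s := {0}ᶜ))
    obtain ⟨y, ⟨h1, h2⟩, h3⟩ := ((ht.eventually (h0.and hre)).and self_mem_nhdsWithin).exists
    have := h2 (by simpa using h3)
    rw [h1] at this
    simp [hu0] at this
  obtain ⟨m, g, hga, hg0, hg⟩ := hha.exists_eventuallyEq_pow_smul_nonzero_iff.2 hne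
  simp only [smul_eq_mul] at hg
  -- the leading coefficient is real
  have hgr : (g u).im = 0 := by
    have h1 : ∀ᶠ x : ℝ in 𝓝[≠] u, (g x).im = 0 := by
      have hc := Complex.continuous_ofReal.continuousAt (x := u)
      filter_upwards [nhdsWithin_le_nhds (hc.eventually hg), nhdsWithin_le_nhds hφ,
        self_mem_nhdsWithin] with x h1 h2 hx
      have h3 : h x = ((φ x - φ u - deriv φ u * (x - u) : ℝ) : ℂ) := by
        simp only [hh, hd1, h2, hφ.self_of_nhds]; push_cast; ring
      rw [h3] at h1
      have hx' : (x - u) ^ m ≠ 0 := pow_ne_zero _ (sub_ne_zero.2 hx)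
      have h4 : g x = (((φ x - φ u - deriv φ u * (x - u)) / (x - u) ^ m : ℝ) : ℂ) := by
        have : ((x : ℂ) - u) ^ m ≠ 0 := by exact_mod_cast hx'
        push_cast at h1 ⊢
        rw [h1]; field_simp
      rw [h4, Complex.ofReal_im]
    have h2 : Tendsto (fun x : ℝ => (g x).im) (𝓝[≠] u) (𝓝 (g u).im) :=
      ((Complex.continuous_im.continuousAt.comp (hga.continuousAt.comp
        Complex.continuous_ofReal.continuousAt)).tendsto).mono_left nhdsWithin_le_nhds
    exact tendsto_nhds_unique h2 ((tendsto_congr' h1).2 tendsto_const_nhds)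
  set c := (g u).re with hc
  have hgc : g u = (c : ℂ) := Complex.ext rfl (by simpa using hgr)
  have hc0 : c ≠ 0 := fun h0 => hg0 (by rw [hgc, h0]; simp)
  -- the inequality for the leading coefficient in each direction
  have hdir : ∀ θ : ℝ, Real.sin θ ≠ 0 → Real.cos (m * θ) * c ≤ Real.cos θ ^ m * c := by
    intro θ hθ
    have h1 : Tendsto (fun ρ : ℝ => (u : ℂ) + ρ * Complex.exp (θ * Complex.I)) (𝓝[>] 0)
        (𝓝 (u : ℂ)) := by
      have : Continuous fun ρ : ℝ => (u : ℂ) + ρ * Complex.exp (θ * Complex.I) := by fun_prop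
      simpa using (this.tendsto 0).mono_left nhdsWithin_le_nhds
    have h2 : Tendsto (fun ρ : ℝ => (u : ℂ) + ((ρ * Real.cos θ : ℝ) : ℂ)) (𝓝[>] 0)
        (𝓝 (u : ℂ)) := by
      have : Continuous fun ρ : ℝ => (u : ℂ) + ((ρ * Real.cos θ : ℝ) : ℂ) := by fun_prop
      simpa using (this.tendsto 0).mono_left nhdsWithin_le_nhds
    have t1 : Tendsto (fun ρ : ℝ => (Complex.exp (θ * Complex.I) ^ m *
        g (u + ρ * Complex.exp (θ * Complex.I))).re) (𝓝[>] 0)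
        (𝓝 (Complex.exp (θ * Complex.I) ^ m * g u).re) :=
      (Complex.continuous_re.tendsto _).comp ((hga.continuousAt.tendsto.comp h1).const_mul _)
    have t2 : Tendsto (fun ρ : ℝ => (((Real.cos θ ^ m : ℝ) : ℂ) *
        g (u + ((ρ * Real.cos θ : ℝ) : ℂ))).re) (𝓝[>] 0)
        (𝓝 (((Real.cos θ ^ m : ℝ) : ℂ) * g u).re) :=
      (Complex.continuous_re.tendsto _).comp ((hga.continuousAt.tendsto.comp h2).const_mul _)
    have h3 := le_of_tendsto_of_tendsto t1 t2 (by
      filter_upwards [h1.eventually hg, h2.eventually hg, h1.eventually hre, self_mem_nhdsWithin]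
        with ρ e1 e2 e3 hρ
      have hρ0 : 0 < ρ := hρ
      have him : ((u : ℂ) + ρ * Complex.exp (θ * Complex.I)).im = ρ * Real.sin θ := by
        rw [Complex.exp_mul_I, ← Complex.ofReal_cos, ← Complex.ofReal_sin]
        simp [Complex.sin_ofReal_re]
      have hree : (((u : ℂ) + ρ * Complex.exp (θ * Complex.I)).re : ℂ)
          = u + ((ρ * Real.cos θ : ℝ) : ℂ) := by
        rw [Complex.exp_mul_I, ← Complex.ofReal_cos, ← Complex.ofReal_sin]; simp
      have h4 := e3 (by rw [him]; exact mul_ne_zero hρ0.ne' hθ)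
      rw [hree, e1, e2, add_sub_cancel_left, add_sub_cancel_left, mul_pow, Complex.ofReal_mul,
        mul_pow, mul_assoc, mul_assoc, ← Complex.ofReal_pow, Complex.re_ofReal_mul,
        Complex.re_ofReal_mul, mul_lt_mul_iff_right₀ (by positivity)] at h4
      simpa using h4.le)
    rw [hgc, ← Complex.exp_nat_mul, Complex.re_mul_ofReal, ← Complex.ofReal_mul,
      Complex.ofReal_re, ← mul_assoc, ← Complex.ofReal_natCast, ← Complex.ofReal_mul,
      Complex.exp_ofReal_mul_I_re] at h3
    exact h3
  -- exclude orders `0` and `1`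
  have hm0 : m ≠ 0 := by
    rintro rfl
    have := hg.self_of_nhds
    rw [hu0] at this
    simp at this
    exact hg0 this.symm
  have hm1 : m ≠ 1 := by
    rintro rfl
    have h1 : deriv h u = g u := by
      rw [Filter.EventuallyEq.deriv_eq hg]
      have := ((hasDerivAt_id (u : ℂ)).sub_const (u : ℂ)).pow 1 |>.mul
        hga.differentiableAt.hasDerivAt
      have h2 := HasDerivAt.deriv (f := fun z : ℂ => (z - u) ^ 1 * g z) this
      simpa using h2
    have h2 : deriv h u = 0 := by
      have h3 := (hG.differentiableAt.hasDerivAt.sub_const (G u)).sub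
        (((hasDerivAt_id (u : ℂ)).sub_const (u : ℂ)).const_mul (deriv G u))
      have := HasDerivAt.deriv (f := h) h3
      simpa using this
    exact hg0 (h1.symm.trans h2)
  have hm2 : (2 : ℝ) ≤ m := by exact_mod_cast (show 2 ≤ m by omega)
  have hmR : (0 : ℝ) < m := by linarith
  have hpi := Real.pi_pos
  -- Direction θ = π/m: cos(mθ) = −1 while cos θ ≥ 0 because m ≥ 2, which is incompatible with c <
  -- 0.
  have hcpos : 0 < c := by
    by_contra! hcneg
    have hclt : c < 0 := lt_of_le_of_ne hcneg hc0
    have hle : Real.pi / m ≤ Real.pi / 2 := by gcongr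
    have hs : 0 < Real.sin (Real.pi / m) :=
      Real.sin_pos_of_pos_of_lt_pi (by positivity) (by linarith)
    have h1 := hdir (Real.pi / m) hs.ne'
    rw [mul_div_cancel₀ _ hmR.ne', Real.cos_pi] at h1
    have h2 : 0 ≤ Real.cos (Real.pi / m) ^ m :=
      pow_nonneg (Real.cos_nonneg_of_neg_pi_div_two_le_of_le (by
        have : 0 < Real.pi / m := by positivity
        linarith) hle) _
    nlinarith
  -- Direction θ = 2π/m with m ≥ 3: cos(mθ) = 1 while |cos θ| < 1, so c ≤ c cos(θ)^m < c.
  have hmeq : m = 2 := by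
    by_contra hm
    have hm3 : (3 : ℝ) ≤ m := by exact_mod_cast (show 3 ≤ m by omega)
    have hle : 2 * Real.pi / m < Real.pi := by
      rw [div_lt_iff₀ hmR]; nlinarith
    have hs : 0 < Real.sin (2 * Real.pi / m) := Real.sin_pos_of_pos_of_lt_pi (by positivity) hle
    have h1 := hdir (2 * Real.pi / m) hs.ne'
    rw [mul_div_cancel₀ _ hmR.ne', Real.cos_two_pi] at h1
    have h2 : |Real.cos (2 * Real.pi / m)| < 1 := by
      rw [abs_lt]
      have := Real.sin_sq_add_cos_sq (2 * Real.pi / m)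
      constructor <;> nlinarith
    have h3 : |Real.cos (2 * Real.pi / m)| ^ m < 1 := pow_lt_one₀ (abs_nonneg _) h2 hm0
    have h4 : Real.cos (2 * Real.pi / m) ^ m ≤ |Real.cos (2 * Real.pi / m)| ^ m := by
      rw [← abs_pow]; exact le_abs_self _
    nlinarith
  subst hmeq
  obtain ⟨r, hr, hball⟩ := Metric.eventually_nhds_iff_ball.1
    (hg.and (hga.eventually_analyticAt))
  have hgd : DifferentiableOn ℂ g (Metric.ball (u : ℂ) r) := fun z hz =>
    (hball z hz).2.differentiableAt.differentiableWithinAt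
  have hT := iteratedDeriv_of_taylor (f := G) (R := dslope g u) (c := u) hr
    (p := Polynomial.C (G u) + Polynomial.C (deriv G u) * Polynomial.X
      + Polynomial.C (g u) * Polynomial.X ^ 2) (n := 3)
    ((Complex.differentiableOn_dslope (Metric.ball_mem_nhds _ hr)).2 hgd) (fun z hz => by
      have h1 := (hball z hz).1
      have h2 := sub_smul_dslope g (u : ℂ) z
      simp only [smul_eq_mul] at h2
      simp only [hh] at h1
      simp only [Polynomial.eval_add, Polynomial.eval_mul, Polynomial.eval_C, Polynomial.eval_X,
        Polynomial.eval_pow]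
      linear_combination h1 - (z - u) ^ 2 * h2) (j := 2) (by norm_num)
  rw [hder 2, hgc] at hT
  have h5 := congrArg Complex.re hT
  simp only [Polynomial.coeff_add, Polynomial.coeff_C_mul, Polynomial.coeff_X_pow,
    Polynomial.coeff_X, Polynomial.coeff_C] at h5
  norm_num [Nat.factorial] at h5
  rw [h5]
  positivity

end FwdSmile

end

/-! ### The exponent near a saddlepoint -/

noncomputable section

namespace FwdSmile

/-- Taylor's formula of order five for the exponent at the saddlepoint. -/
theorem exists_saddle_expansion {G : ℂ → ℂ} {φ : ℝ → ℝ} {u r : ℝ} (hr : 0 < r)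
    (hG : DifferentiableOn ℂ G (Metric.ball (u : ℂ) r)) (hφ : ∀ᶠ x : ℝ in 𝓝 u, G x = φ x) :
    ∃ κ : ℂ → ℂ, DifferentiableOn ℂ κ (Metric.ball 0 (r / 2)) ∧ κ 0 = 0 ∧
      deriv κ 0 = (iteratedDeriv 3 φ u / 6 : ℝ) ∧
      iteratedDeriv 2 κ 0 = (iteratedDeriv 4 φ u / 12 : ℝ) ∧
      ∀ z ∈ Metric.ball (0 : ℂ) (r / 2), G (u + z) - G u - (deriv φ u : ℝ) * z =
        ((iteratedDeriv 2 φ u : ℝ) / 2 + κ z) * z ^ 2 := by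
  have hr2 : 0 < r / 2 := by positivity
  have hsub : Metric.closedBall (u : ℂ) (r / 2) ⊆ Metric.ball (u : ℂ) r :=
    Metric.closedBall_subset_ball (by linarith)
  obtain ⟨B, hB⟩ := (isCompact_closedBall (u : ℂ) (r / 2)).exists_bound_of_continuousOn
    (hG.continuousOn.mono hsub)
  have hGa : AnalyticAt ℂ G u := hG.analyticAt (Metric.ball_mem_nhds _ hr)
  have hder : ∀ n, iteratedDeriv n G u = iteratedDeriv n φ u := fun n =>
    (iteratedDeriv_ofReal_eq hGa hφ n).self_of_nhds
  -- Order five, because κ is needed up to its second derivative and is the exponent divided by z².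
  obtain ⟨p, R, hp, hR, -, h⟩ := exists_taylor hr2 5
    (hG.mono (Metric.ball_subset_closedBall.trans hsub))
    (fun z hz => hB z (Metric.ball_subset_closedBall hz))
  have hc := fun j (hj : j < 5) => iteratedDeriv_of_taylor hr2 hR h hj
  have hev : ∀ w : ℂ, p.eval w = p.coeff 0 + p.coeff 1 * w + p.coeff 2 * w ^ 2
      + p.coeff 3 * w ^ 3 + p.coeff 4 * w ^ 4 := by
    intro w
    rw [Polynomial.eval_eq_sum_range' (n := 5)]
    · simp [Finset.sum_range_succ]
    · rcases eq_or_ne p 0 with rfl | hp0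
      · simp
      · exact (Polynomial.natDegree_lt_iff_degree_lt hp0).2 hp
  have c0 := hc 0 (by norm_num)
  have c1 := hc 1 (by norm_num)
  have c2 := hc 2 (by norm_num)
  have c3 := hc 3 (by norm_num)
  have c4 := hc 4 (by norm_num)
  rw [hder] at c0 c1 c2 c3 c4
  norm_num [Nat.factorial] at c0 c1 c2 c3 c4
  have hmem : ∀ z ∈ Metric.ball (0 : ℂ) (r / 2), (u : ℂ) + z ∈ Metric.ball (u : ℂ) (r / 2) := by
    intro z hz
    simpa [dist_eq_norm] using hz
  set q : Polynomial ℂ := Polynomial.C (p.coeff 3) * Polynomial.X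
    + Polynomial.C (p.coeff 4) * Polynomial.X ^ 2 with hq
  have hRd : DifferentiableOn ℂ (fun z => R (u + z)) (Metric.ball 0 (r / 2)) :=
    hR.comp (by fun_prop) hmem
  -- The polynomial q consists of the terms of degree 3 and 4 divided by z². Hence the derivatives
  -- of κ at 0 are φ'''/6 and 2 · φ''''/24.
  set κ : ℂ → ℂ := fun z => q.eval (z - 0) + (z - 0) ^ 3 * R (u + z) with hκ
  have hκd : DifferentiableOn ℂ κ (Metric.ball 0 (r / 2)) := by
    have h1 : Differentiable ℂ fun z : ℂ => q.eval (z - 0) :=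
      q.differentiable.comp (differentiable_id.sub_const 0)
    have h2 : Differentiable ℂ fun z : ℂ => (z - 0) ^ 3 := by fun_prop
    exact h1.differentiableOn.add (h2.differentiableOn.mul hRd)
  have hk := fun j (hj : j < 3) => iteratedDeriv_of_taylor (f := κ) hr2 hRd (fun z _ => rfl) hj
  refine ⟨κ, hκd, by simp [hκ, hq], ?_, ?_, ?_⟩
  · have := hk 1 (by norm_num)
    rw [iteratedDeriv_one] at this
    rw [this]
    simp only [hq, Polynomial.coeff_add, Polynomial.coeff_C_mul, Polynomial.coeff_X_pow,
      Polynomial.coeff_X]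
    norm_num
    rw [c3]; ring
  · rw [hk 2 (by norm_num)]
    simp only [hq, Polynomial.coeff_add, Polynomial.coeff_C_mul, Polynomial.coeff_X_pow,
      Polynomial.coeff_X]
    norm_num [Nat.factorial]
    rw [c4]; ring
  · intro z hz
    have h1 := h _ (hmem z hz)
    have h2 : G u = p.coeff 0 := by
      have := h u (Metric.mem_ball_self hr2)
      rw [this, hev]; simp
    rw [add_sub_cancel_left, hev] at h1
    rw [h1, h2, c1, c2]
    simp only [hκ, hq, sub_zero, Polynomial.eval_add, Polynomial.eval_mul, Polynomial.eval_C,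
      Polynomial.eval_X, Polynomial.eval_pow]
    ring

/-- The amplitude in the inverse Fourier representation of option prices. -/
def amplitude (F : ℂ → ℂ) (b : ℝ) (z : ℂ) : ℂ := F z / (z * (z - b))

/-- The distance of the saddlepoint to the poles of the amplitude, up to a factor. -/
def poleDist (u b : ℝ) : ℝ := min |u| |u - b| / 4

theorem poleDist_pos {u b : ℝ} (hu : u ≠ 0) (hub : u ≠ b) : 0 < poleDist u b := by
  have := abs_pos.2 hu
  have := abs_pos.2 (sub_ne_zero.2 hub)
  unfold poleDist
  positivity

/-- The quarter in `poleDist` leaves room for two displacements: of z away from u, and of the pole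
away from its limit b, since the pole b₀ + b₁ε moves with ε on the diagonal. -/
theorem norm_ge_of_mem_ball {u b b' : ℝ} (hb' : |b' - b| ≤ poleDist u b) {z : ℂ}
    (hz : z ∈ Metric.ball (u : ℂ) (poleDist u b)) :
    poleDist u b ≤ ‖z‖ ∧ poleDist u b ≤ ‖z - b'‖ := by
  have h1 : 4 * poleDist u b ≤ |u| := by
    unfold poleDist; linarith [min_le_left |u| |u - b|]
  have h2 : 4 * poleDist u b ≤ |u - b| := by
    unfold poleDist; linarith [min_le_right |u| |u - b|]
  rw [Metric.mem_ball, dist_eq_norm] at hz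
  have e1 : ‖(u : ℂ)‖ = |u| := by simp
  have e2 : ‖((u : ℂ) - b)‖ = |u - b| := by
    rw [← Complex.ofReal_sub, Complex.norm_real, Real.norm_eq_abs]
  have e3 : ‖((b' : ℂ) - b)‖ = |b' - b| := by
    rw [← Complex.ofReal_sub, Complex.norm_real, Real.norm_eq_abs]
  have h3 := norm_sub_le z (z - u)
  rw [sub_sub_cancel, e1] at h3
  have h4 := norm_add_le (z - b') (-(z - u) + (b' - b))
  have h5 := norm_add_le (-(z - u)) ((b' : ℂ) - b)
  rw [show z - b' + (-(z - u) + ((b' : ℂ) - b)) = u - b by ring, e2] at h4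
  rw [norm_neg, e3] at h5
  constructor <;> linarith [norm_nonneg (z - u), abs_nonneg (b' - b)]

theorem norm_amplitude_le {F : ℂ → ℂ} {K u b b' : ℝ} (hd : 0 < poleDist u b)
    (hb' : |b' - b| ≤ poleDist u b) {z : ℂ} (hz : z ∈ Metric.ball (u : ℂ) (poleDist u b))
    (hF : ‖F z‖ ≤ K) : ‖amplitude F b' z‖ ≤ K / poleDist u b ^ 2 := by
  obtain ⟨h1, h2⟩ := norm_ge_of_mem_ball hb' hz
  have hK : 0 ≤ K := (norm_nonneg _).trans hF
  unfold amplitude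
  rw [norm_div, norm_mul, pow_two]
  gcongr

theorem differentiableOn_amplitude {F : ℂ → ℂ} {u b b' : ℝ} (hd : 0 < poleDist u b)
    (hb' : |b' - b| ≤ poleDist u b) {s : Set ℂ} (hs : s ⊆ Metric.ball (u : ℂ) (poleDist u b))
    (hF : DifferentiableOn ℂ F s) : DifferentiableOn ℂ (amplitude F b') s := by
  unfold amplitude
  refine hF.div (by fun_prop) fun z hz => ?_
  obtain ⟨h1, h2⟩ := norm_ge_of_mem_ball hb' (hs hz)
  exact mul_ne_zero (norm_pos_iff.1 (hd.trans_le h1)) (norm_pos_iff.1 (hd.trans_le h2))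

/-- The two poles supply a decay of order q^{−2}. This gives integrability along the line when F is
merely bounded. -/
theorem norm_amplitude_line_le {F : ℂ → ℂ} {K u b b' : ℝ} (hd : 0 < poleDist u b)
    (hb' : |b' - b| ≤ poleDist u b) {q : ℝ} (hF : ‖F (u + q * Complex.I)‖ ≤ K) :
    ‖amplitude F b' (u + q * Complex.I)‖ ≤ K * (poleDist u b ^ 2 + q ^ 2)⁻¹ := by
  have hK : 0 ≤ K := (norm_nonneg _).trans hF
  obtain ⟨h1, h2⟩ := norm_ge_of_mem_ball hb' (Metric.mem_ball_self (x := (u : ℂ)) hd)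
  rw [← Complex.ofReal_sub, Complex.norm_real, Real.norm_eq_abs] at h2
  rw [Complex.norm_real, Real.norm_eq_abs] at h1
  unfold amplitude
  rw [norm_div, norm_mul, ← div_eq_mul_inv]
  have key : ∀ x : ℝ, poleDist u b ≤ |x| →
      √(poleDist u b ^ 2 + q ^ 2) ≤ ‖(x : ℂ) + q * Complex.I‖ := by
    intro x hx
    rw [Complex.norm_add_mul_I, ← sq_abs x]
    gcongr
  have e : ((u : ℂ) + q * Complex.I - b') = ((u - b' : ℝ) : ℂ) + q * Complex.I := by
    push_cast; ring
  rw [e]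
  have h3 : poleDist u b ^ 2 + q ^ 2 ≤
      ‖(u : ℂ) + q * Complex.I‖ * ‖((u - b' : ℝ) : ℂ) + q * Complex.I‖ := by
    rw [← Real.mul_self_sqrt (by positivity : 0 ≤ poleDist u b ^ 2 + q ^ 2)]
    exact mul_le_mul (key _ h1) (key _ h2) (Real.sqrt_nonneg _) (norm_nonneg _)
  gcongr

theorem integrable_inv_sq_add_sq {d : ℝ} (hd : 0 < d) :
    Integrable fun q : ℝ => (d ^ 2 + q ^ 2)⁻¹ := by
  have := (integrable_inv_one_add_sq.comp_div hd.ne').const_mul (d ^ 2)⁻¹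
  refine this.congr (Eventually.of_forall fun q => ?_)
  simp only
  field_simp

/-- The cubic term of the exponential series suffices, as ε³ ≤ ε²√ε for ε ≤ 1. This absorbs the
contribution away from the saddlepoint into the Laplace error. -/
theorem exp_neg_div_le {η ε : ℝ} (hη : 0 < η) (hε : ε ∈ Ioc (0 : ℝ) 1) :
    Real.exp (-η / ε) ≤ 6 / η ^ 3 * (ε ^ 2 * √ε) := by
  have hε0 := hε.1
  have h1 : (η / ε) ^ 3 / 6 ≤ Real.exp (η / ε) := by
    simpa [Nat.factorial] using Real.pow_div_factorial_le_exp _ (by positivity : 0 ≤ η / ε) 3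
  have h2 : ε ≤ √ε := by
    refine Real.le_sqrt_of_sq_le ?_
    nlinarith [hε.2]
  rw [neg_div, Real.exp_neg]
  calc (Real.exp (η / ε))⁻¹ ≤ ((η / ε) ^ 3 / 6)⁻¹ := by gcongr
    _ = 6 / η ^ 3 * (ε ^ 2 * ε) := by field_simp
    _ ≤ _ := by gcongr

end FwdSmile

end

/-! ### The saddlepoint integral -/

noncomputable section

namespace FwdSmile

/-- The first correction in the Laplace expansion of an integral with amplitude `H` and exponent
`φ` along the vertical line through `u`. -/
def laplaceCorrection (φ : ℝ → ℝ) (H : ℂ → ℂ) (u : ℝ) : ℂ :=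
  iteratedDeriv 2 H u / (2 * (iteratedDeriv 2 φ u : ℝ))
    - 3 * (2 * (iteratedDeriv 3 φ u / 6 : ℝ) * deriv H u + (iteratedDeriv 4 φ u / 12 : ℝ) * H u)
      / (2 * (iteratedDeriv 2 φ u : ℝ) ^ 2)
    + 15 * ((iteratedDeriv 3 φ u / 6 : ℝ) ^ 2 * H u) / (2 * (iteratedDeriv 2 φ u : ℝ) ^ 3)

/-- The integrand of the inverse Fourier representation along the vertical line through `u`. -/
def saddleIntegrand (F : ℂ → ℂ) (G : ℂ → ℂ) (φ : ℝ → ℝ) (u b ε q : ℝ) : ℂ :=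
  amplitude F b (u + q * Complex.I) *
    Complex.exp ((G (u + q * Complex.I) - G u - (deriv φ u : ℝ) * (q * Complex.I)) / ε)

theorem norm_saddle_exp (G : ℂ → ℂ) (k u ε q : ℝ) :
    ‖Complex.exp ((G (u + q * Complex.I) - G u - (k : ℝ) * (q * Complex.I)) / ε)‖ =
      Real.exp (((G (u + q * Complex.I)).re - (G u).re) / ε) := by
  rw [Complex.norm_exp, Complex.div_ofReal_re]
  simp

/-- Asymptotics of the inverse Fourier integral along a vertical line through the saddlepoint. -/
theorem saddle_integral_laplace {F : ℝ → ℂ → ℂ} {G : ℂ → ℂ} {φ : ℝ → ℝ} {u r K b₀ b₁ ε₀ : ℝ}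
    (hu : u ≠ 0) (hub : u ≠ b₀) (hr : 0 < r) (hε₀ : 0 < ε₀)
    (hG : DifferentiableOn ℂ G (Metric.ball (u : ℂ) r)) (hφ : ∀ᶠ x : ℝ in 𝓝 u, G x = φ x)
    (ha : 0 < iteratedDeriv 2 φ u) (hGc : Continuous fun q : ℝ => G (u + q * Complex.I))
    (htail : ∀ δ > 0, ∃ η > 0, ∀ q : ℝ, δ ≤ |q| → (G (u + q * Complex.I)).re ≤ (G u).re - η)
    (hF : ∀ ε ∈ Ioc 0 ε₀, DifferentiableOn ℂ (F ε) (Metric.ball (u : ℂ) r))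
    (hFK : ∀ ε ∈ Ioc 0 ε₀, ∀ z ∈ Metric.ball (u : ℂ) r, ‖F ε z‖ ≤ K)
    (hFc : ∀ ε ∈ Ioc 0 ε₀, Continuous fun q : ℝ => F ε (u + q * Complex.I))
    (hFl : ∀ ε ∈ Ioc 0 ε₀, ∀ q : ℝ, ‖F ε (u + q * Complex.I)‖ ≤ K) :
    ∃ C : ℝ, ∃ ε₁ > 0, ∀ ε ∈ Ioc 0 ε₁,
      ‖(∫ q : ℝ, saddleIntegrand (F ε) G φ u (b₀ + b₁ * ε) ε q) -
        √(2 * Real.pi * ε / iteratedDeriv 2 φ u) * (amplitude (F ε) (b₀ + b₁ * ε) u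
          - ε * laplaceCorrection φ (amplitude (F ε) (b₀ + b₁ * ε)) u)‖ ≤ C * (ε ^ 2 * √ε) := by
  have hd := poleDist_pos hu hub
  set d := poleDist u b₀ with hdd
  have hK : 0 ≤ K := (norm_nonneg _).trans (hFl ε₀ ⟨hε₀, le_rfl⟩ 0)
  obtain ⟨κ, hκd, hκ0, hκ1, hκ2, hκE⟩ := exists_saddle_expansion hr hG hφ
  set ρ := min (r / 2) d with hρ
  have hρ0 : 0 < ρ := by positivity
  have hρr : Metric.ball (0 : ℂ) ρ ⊆ Metric.ball 0 (r / 2) :=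
    Metric.ball_subset_ball (min_le_left _ _)
  -- The Laplace expansion is uniform over amplitudes with a common bound, so a single C serves the
  -- amplitudes of all ε. Its δ then fixes the gap η on the rest of the line, where the integrand is
  -- of size exp(−η/ε).
  obtain ⟨δ, hδ, hδρ, C, hC, hκδ, hLap⟩ := laplace_expansion (K := K / d ^ 2) ha hρ0 (by positivity)
    (hκd.mono hρr) hκ0
  obtain ⟨η, hη, hηq⟩ := htail δ hδ
  have hint := integrable_inv_sq_add_sq hd
  set J := ∫ q : ℝ, (d ^ 2 + q ^ 2)⁻¹ with hJ
  refine ⟨C + K * (6 / η ^ 3) * J, min ε₀ (min 1 (d / (|b₁| + 1))), by positivity,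
    fun ε hε => ?_⟩
  have hεε₀ : ε ∈ Ioc 0 ε₀ := ⟨hε.1, hε.2.trans (min_le_left _ _)⟩
  have hε1 : ε ∈ Ioc (0 : ℝ) 1 := ⟨hε.1, hε.2.trans ((min_le_right _ _).trans (min_le_left _ _))⟩
  have hε0 : 0 < ε := hε.1
  set b := b₀ + b₁ * ε with hb
  have hbb : |b - b₀| ≤ d := by
    have h1 : ε ≤ d / (|b₁| + 1) := hε.2.trans ((min_le_right _ _).trans (min_le_right _ _))
    rw [le_div_iff₀ (by positivity)] at h1
    rw [hb, add_sub_cancel_left, abs_mul, abs_of_pos hε0]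
    nlinarith
  set H := amplitude (F ε) b with hH
  set f : ℂ → ℂ := fun z => H (u + z) with hf
  have hmem : ∀ z ∈ Metric.ball (0 : ℂ) ρ, (u : ℂ) + z ∈ Metric.ball (u : ℂ) ρ := by
    intro z hz
    simpa [dist_eq_norm] using hz
  have hρd : Metric.ball (u : ℂ) ρ ⊆ Metric.ball (u : ℂ) d :=
    Metric.ball_subset_ball (min_le_right _ _)
  have hρr' : Metric.ball (u : ℂ) ρ ⊆ Metric.ball (u : ℂ) r :=
    Metric.ball_subset_ball ((min_le_left _ _).trans (by linarith))
  have hHd : DifferentiableOn ℂ H (Metric.ball (u : ℂ) ρ) :=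
    differentiableOn_amplitude hd hbb hρd ((hF ε hεε₀).mono hρr')
  have hfd : DifferentiableOn ℂ f (Metric.ball 0 ρ) := hHd.comp (by fun_prop) hmem
  have hfK : ∀ z ∈ Metric.ball (0 : ℂ) ρ, ‖f z‖ ≤ K / d ^ 2 := fun z hz =>
    norm_amplitude_le hd hbb (hρd (hmem z hz)) (hFK ε hεε₀ _ (hρr' (hmem z hz)))
  have hL := hLap f hfd hfK ε hε1
  set I : ℝ → ℂ := saddleIntegrand (F ε) G φ u b ε with hI
  have hIb : ∀ q : ℝ, ‖I q‖ ≤ K * (d ^ 2 + q ^ 2)⁻¹ *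
      Real.exp (((G (u + q * Complex.I)).re - (G u).re) / ε) := by
    intro q
    rw [hI, saddleIntegrand, norm_mul, norm_saddle_exp]
    gcongr
    exact norm_amplitude_line_le hd hbb (hFl ε hεε₀ q)
  have hfar : ∀ q : ℝ, δ ≤ |q| → ‖I q‖ ≤ K * (6 / η ^ 3 * (ε ^ 2 * √ε)) * (d ^ 2 + q ^ 2)⁻¹ := by
    intro q hq
    refine (hIb q).trans ?_
    have h1 : Real.exp (((G (u + q * Complex.I)).re - (G u).re) / ε) ≤ Real.exp (-η / ε) := by
      gcongr
      linarith [hηq q hq]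
    calc _ ≤ K * (d ^ 2 + q ^ 2)⁻¹ * (6 / η ^ 3 * (ε ^ 2 * √ε)) := by
          gcongr
          exact h1.trans (exp_neg_div_le hη hε1)
      _ = _ := by ring
  have hnear : ∀ q : ℝ, |q| ≤ δ → I q = f (q * Complex.I) *
      Complex.exp (((iteratedDeriv 2 φ u : ℝ) / 2 + κ (q * Complex.I)) * (q * Complex.I) ^ 2 / ε) := by
    intro q hq
    have hz : (q * Complex.I : ℂ) ∈ Metric.ball (0 : ℂ) (r / 2) := by
      rw [mem_ball_zero_iff, norm_mul, Complex.norm_I, mul_one, Complex.norm_real, Real.norm_eq_abs]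
      exact (hq.trans_lt hδρ).trans_le (min_le_left _ _)
    rw [hI, saddleIntegrand, hκE _ hz]
  have hIc : Continuous I := by
    have h1 : Continuous fun q : ℝ => amplitude (F ε) b (u + q * Complex.I) := by
      unfold amplitude
      refine (hFc ε hεε₀).div (by fun_prop) fun q => ?_
      obtain ⟨h1, h2⟩ := norm_ge_of_mem_ball hbb (Metric.mem_ball_self (x := (u : ℂ)) hd)
      rw [← Complex.ofReal_sub, Complex.norm_real, Real.norm_eq_abs] at h2
      rw [Complex.norm_real, Real.norm_eq_abs] at h1
      have h3 : u - b ≠ 0 := fun h => by rw [h, abs_zero] at h2; linarith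
      refine mul_ne_zero (fun h => hu ?_) (fun h => h3 ?_)
      · simpa using congrArg Complex.re h
      · simpa using congrArg Complex.re h
    exact h1.mul (((hGc.sub continuous_const).sub (by fun_prop)).div_const _).cexp
  have hle : -δ ≤ δ := by linarith
  have hIi : Integrable I := by
    have h1 : IntegrableOn I (Icc (-δ) δ) := hIc.continuousOn.integrableOn_Icc
    have h2 : IntegrableOn I (Icc (-δ) δ)ᶜ := by
      refine Integrable.mono' (hint.const_mul (K * (6 / η ^ 3 * (ε ^ 2 * √ε)))).integrableOn
        hIc.aestronglyMeasurable.restrict ?_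
      refine (ae_restrict_iff' measurableSet_Icc.compl).2 (Eventually.of_forall fun q hq => ?_)
      refine hfar q ?_
      by_contra! hc
      rw [abs_lt] at hc
      exact hq ⟨hc.1.le, hc.2.le⟩
    have := h1.union h2
    rwa [union_compl_self, integrableOn_univ] at this
  have hsplit : ∫ q, I q = (∫ q in -δ..δ, I q) + ∫ q in (Ioc (-δ) δ)ᶜ, I q := by
    rw [intervalIntegral.integral_of_le hle, integral_add_compl measurableSet_Ioc hIi]
  have hnear' : ∫ q in -δ..δ, I q = ∫ q in -δ..δ, f (q * Complex.I) *
      Complex.exp (((iteratedDeriv 2 φ u : ℝ) / 2 + κ (q * Complex.I)) * (q * Complex.I) ^ 2 / ε) := by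
    refine intervalIntegral.integral_congr fun q hq => ?_
    rw [uIcc_of_le hle] at hq
    exact hnear q (abs_le.2 hq)
  have hfarI : ‖∫ q in (Ioc (-δ) δ)ᶜ, I q‖ ≤ K * (6 / η ^ 3) * J * (ε ^ 2 * √ε) := by
    have hWi := hint.const_mul (K * (6 / η ^ 3 * (ε ^ 2 * √ε)))
    calc _ ≤ ∫ q in (Ioc (-δ) δ)ᶜ, K * (6 / η ^ 3 * (ε ^ 2 * √ε)) * (d ^ 2 + q ^ 2)⁻¹ := by
          refine norm_integral_le_of_norm_le hWi.integrableOn ?_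
          refine (ae_restrict_iff' measurableSet_Ioc.compl).2 (Eventually.of_forall fun q hq => ?_)
          refine hfar q ?_
          by_contra! hc
          rw [abs_lt] at hc
          exact hq ⟨hc.1, hc.2.le⟩
      _ ≤ ∫ q, K * (6 / η ^ 3 * (ε ^ 2 * √ε)) * (d ^ 2 + q ^ 2)⁻¹ := by
          refine setIntegral_le_integral hWi (Eventually.of_forall fun q => ?_)
          simp only [Pi.zero_apply]
          positivity
      _ = _ := by rw [integral_const_mul]; ring
  have hshift : ∀ n, iteratedDeriv n f 0 = iteratedDeriv n H u := by
    intro n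
    have := congrFun (iteratedDeriv_comp_const_add n H (u : ℂ)) 0
    rw [add_zero] at this
    exact this
  have hf0 : f 0 = H u := by simp [hf]
  have hf1 : deriv f 0 = deriv H u := by simpa using hshift 1
  rw [hshift 2, hf1, hf0, hκ1, hκ2] at hL
  rw [hsplit, hnear', add_sub_right_comm]
  refine (norm_add_le _ _).trans ?_
  rw [add_mul]
  exact add_le_add hL hfarI

end FwdSmile

end

/-! ### Expansion of the saddlepoint integral -/

noncomputable section

namespace FwdSmile

/-- Logarithmic derivatives of `exp (L x) / (x * (x - b))`. -/
theorem derivs_exp_div {L : ℝ → ℝ} {u b : ℝ} (hL : AnalyticAt ℝ L u) (hu : u ≠ 0) (hub : u ≠ b) :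
    deriv (fun x => Real.exp (L x) / (x * (x - b))) u =
      Real.exp (L u) / (u * (u - b)) * (deriv L u - 1 / u - 1 / (u - b)) ∧
    iteratedDeriv 2 (fun x => Real.exp (L x) / (x * (x - b))) u =
      Real.exp (L u) / (u * (u - b)) * ((deriv L u - 1 / u - 1 / (u - b)) ^ 2
        + (iteratedDeriv 2 L u + 1 / u ^ 2 + 1 / (u - b) ^ 2)) := by
  set ψ : ℝ → ℝ := fun x => Real.exp (L x) / (x * (x - b)) with hψ
  have h1 : ∀ᶠ x in 𝓝 u, HasDerivAt ψ (ψ x * (deriv L x - 1 / x - 1 / (x - b))) x := by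
    filter_upwards [hL.eventually_analyticAt, eventually_ne_nhds hu, eventually_ne_nhds hub]
      with x hx hx0 hxb
    have hxb' : x - b ≠ 0 := sub_ne_zero.2 hxb
    have := hx.differentiableAt.hasDerivAt.exp.div
      ((hasDerivAt_id x).mul ((hasDerivAt_id x).sub_const b)) (mul_ne_zero hx0 hxb')
    refine this.congr_deriv ?_
    simp only [hψ, id_eq, Pi.mul_apply]
    field_simp
    ring
  refine ⟨h1.self_of_nhds.deriv, ?_⟩
  have h2 : deriv ψ =ᶠ[𝓝 u] fun x => ψ x * (deriv L x - 1 / x - 1 / (x - b)) :=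
    h1.mono fun x hx => hx.deriv
  rw [iteratedDeriv_succ, iteratedDeriv_one, h2.deriv_eq]
  have hub' : u - b ≠ 0 := sub_ne_zero.2 hub
  have h3 : HasDerivAt (fun x : ℝ => 1 / x) (-1 / u ^ 2) u := by
    simpa [one_div, neg_div] using hasDerivAt_inv hu
  have h4 : HasDerivAt (fun x : ℝ => 1 / (x - b)) (-1 / (u - b) ^ 2) u := by
    simpa [one_div] using ((hasDerivAt_id u).sub_const b).fun_inv hub'
  have h5 := h1.self_of_nhds.mul ((hL.deriv.differentiableAt.hasDerivAt.sub h3).sub h4)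
  rw [HasDerivAt.deriv (f := fun x => ψ x * (deriv L x - 1 / x - 1 / (x - b))) h5]
  simp only [iteratedDeriv_succ, iteratedDeriv_zero, hψ, Pi.sub_apply]
  field_simp
  ring

/-- Expansion of the amplitude and of its derivatives at the saddlepoint. -/
theorem amplitude_expansion {F : ℝ → ℂ → ℂ} {L₁ L₂ : ℝ → ℝ} {u r K b₀ b₁ ε₀ : ℝ}
    (hu : u ≠ 0) (hub : u ≠ b₀) (hr : 0 < r) (hε₀ : 0 < ε₀)
    (hF : ∀ ε ∈ Ioc 0 ε₀, DifferentiableOn ℂ (F ε) (Metric.ball (u : ℂ) r))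
    (hFK : ∀ ε ∈ Ioc 0 ε₀, ∀ z ∈ Metric.ball (u : ℂ) r, ‖F ε z‖ ≤ K)
    (hpt : ∀ x : ℝ, |x - u| < r → ∃ C : ℝ, ∃ ε₁ > 0, ∀ ε ∈ Ioc 0 ε₁,
      ‖F ε x - ((Real.exp (L₁ x) : ℝ) + (Real.exp (L₁ x) * L₂ x : ℝ) * ε)‖ ≤ C * ε ^ 2) :
    ∃ C : ℝ, 0 ≤ C ∧ ∃ ε₂ > 0, ∀ ε ∈ Ioc 0 ε₂,
      ‖amplitude (F ε) (b₀ + b₁ * ε) u - (Real.exp (L₁ u) / (u * (u - b₀)) : ℝ) *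
        (1 + (L₂ u + b₁ / (u - b₀) : ℝ) * ε)‖ ≤ C * ε ^ 2 ∧
      ‖deriv (amplitude (F ε) (b₀ + b₁ * ε)) u - (Real.exp (L₁ u) / (u * (u - b₀)) : ℝ) *
        (deriv L₁ u - 1 / u - 1 / (u - b₀) : ℝ)‖ ≤ C * ε ∧
      ‖iteratedDeriv 2 (amplitude (F ε) (b₀ + b₁ * ε)) u - (Real.exp (L₁ u) / (u * (u - b₀)) : ℝ) *
        ((deriv L₁ u - 1 / u - 1 / (u - b₀)) ^ 2
        + (iteratedDeriv 2 L₁ u + 1 / u ^ 2 + 1 / (u - b₀) ^ 2) : ℝ)‖ ≤ C * ε := by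
  have hd := poleDist_pos hu hub
  set d := poleDist u b₀ with hdd
  -- The holomorphic limit serves twice: it makes the derivatives of F ε converge at rate ε, and,
  -- being exp(L₁) on the real axis, it provides the smoothness of L₁, which is not assumed.
  obtain ⟨s, hs, hsr, F₀, hF₀, hF₀r, C₀, hC₀, ε₂, hε₂, hε₂₀, hFF₀⟩ :=
    uniform_limit_of_pointwise_expansion hr hε₀ hF hFK hpt
  set ρ := min s d with hρ
  have hρ0 : 0 < ρ := by positivity
  have hρs : Metric.ball (u : ℂ) ρ ⊆ Metric.ball (u : ℂ) s := Metric.ball_subset_ball (min_le_left _ _)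
  have hρd : Metric.ball (u : ℂ) ρ ⊆ Metric.ball (u : ℂ) d := Metric.ball_subset_ball (min_le_right _ _)
  have hsr' : Metric.ball (u : ℂ) s ⊆ Metric.ball (u : ℂ) r := Metric.ball_subset_ball hsr.le
  have hus : (u : ℂ) ∈ Metric.ball (u : ℂ) s := Metric.mem_ball_self hs
  have hF₀K : ∀ z ∈ Metric.ball (u : ℂ) s, ‖F₀ z‖ ≤ K + C₀ * ε₂ := by
    intro z hz
    have h1 := hFF₀ ε₂ ⟨hε₂, le_rfl⟩ z hz
    have h2 := hFK ε₂ ⟨hε₂, hε₂₀⟩ z (hsr' hz)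
    have h3 := norm_sub_le (F ε₂ z) (F ε₂ z - F₀ z)
    rw [sub_sub_cancel] at h3
    linarith
  set K₀ := K + C₀ * ε₂ with hK₀
  have hK₀0 : 0 ≤ K₀ := (norm_nonneg _).trans (hF₀K u hus)
  have hb0 : |b₀ - b₀| ≤ d := by rw [sub_self, abs_zero]; exact hd.le
  set H₀ := amplitude F₀ b₀ with hH₀
  have hH₀d : DifferentiableOn ℂ H₀ (Metric.ball (u : ℂ) ρ) :=
    differentiableOn_amplitude hd hb0 hρd (hF₀.mono hρs)
  -- the logarithm of the limit is analytic
  have hF₀a : AnalyticAt ℂ F₀ u := hF₀.analyticAt (Metric.ball_mem_nhds _ hs)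
  have hnear : ∀ᶠ x : ℝ in 𝓝 u, F₀ x = ((Real.exp (L₁ x) : ℝ) : ℂ) := by
    filter_upwards [Metric.ball_mem_nhds u hs] with x hx
    exact hF₀r x hx
  have hL₁a : AnalyticAt ℝ L₁ u := by
    have h1 : AnalyticAt ℝ (fun x : ℝ => (F₀ x).re) u := hF₀a.re_ofReal
    have h2 : AnalyticAt ℝ (fun x : ℝ => Real.log (F₀ x).re) u :=
      h1.log (by rw [hnear.self_of_nhds, Complex.ofReal_re]; exact Real.exp_pos _)
    refine h2.congr ?_
    filter_upwards [hnear] with x hx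
    rw [hx, Complex.ofReal_re, Real.log_exp]
  have hH₀a : AnalyticAt ℂ H₀ u := hH₀d.analyticAt (Metric.ball_mem_nhds _ hρ0)
  have hH₀r : ∀ᶠ x : ℝ in 𝓝 u, H₀ x = ((Real.exp (L₁ x) / (x * (x - b₀)) : ℝ) : ℂ) := by
    filter_upwards [hnear] with x hx
    rw [hH₀, amplitude, hx]
    push_cast
    rfl
  have hder : ∀ n, iteratedDeriv n H₀ u = _ := fun n =>
    (iteratedDeriv_ofReal_eq hH₀a hH₀r n).self_of_nhds
  obtain ⟨hd1, hd2⟩ := derivs_exp_div hL₁a hu hub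
  have hder1 := hder 1
  have hder2 := hder 2
  rw [iteratedDeriv_one, iteratedDeriv_one, hd1, Complex.ofReal_mul] at hder1
  rw [hd2, Complex.ofReal_mul] at hder2
  -- distance of the amplitudes
  set P := C₀ / d ^ 2 + K₀ * |b₁| / d ^ 3 with hP
  have hP0 : 0 ≤ P := by positivity
  have hdist : ∀ ε ∈ Ioc 0 (min ε₂ (d / (|b₁| + 1))), |b₀ + b₁ * ε - b₀| ≤ d ∧
      ∀ z ∈ Metric.ball (u : ℂ) ρ, ‖amplitude (F ε) (b₀ + b₁ * ε) z - H₀ z‖ ≤ P * ε := by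
    intro ε hε
    have hε0 : 0 < ε := hε.1
    have hbb : |b₀ + b₁ * ε - b₀| ≤ d := by
      have h1 : ε ≤ d / (|b₁| + 1) := hε.2.trans (min_le_right _ _)
      rw [le_div_iff₀ (by positivity)] at h1
      rw [add_sub_cancel_left, abs_mul, abs_of_pos hε0]
      nlinarith
    refine ⟨hbb, fun z hz => ?_⟩
    obtain ⟨n1, n2⟩ := norm_ge_of_mem_ball hbb (hρd hz)
    obtain ⟨-, n3⟩ := norm_ge_of_mem_ball hb0 (hρd hz)
    have z1 : z ≠ 0 := norm_pos_iff.1 (hd.trans_le n1)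
    have z2 : z - ((b₀ + b₁ * ε : ℝ) : ℂ) ≠ 0 := norm_pos_iff.1 (hd.trans_le n2)
    have z3 : z - b₀ ≠ 0 := norm_pos_iff.1 (hd.trans_le n3)
    have e : amplitude (F ε) (b₀ + b₁ * ε) z - H₀ z =
        (F ε z - F₀ z) / (z * (z - ((b₀ + b₁ * ε : ℝ) : ℂ)))
        + F₀ z * (b₁ * ε) / (z * (z - ((b₀ + b₁ * ε : ℝ) : ℂ)) * (z - b₀)) := by
      rw [hH₀, amplitude, amplitude]
      field_simp
      push_cast
      ring
    rw [e]
    refine (norm_add_le _ _).trans ?_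
    have hε2 : ε ∈ Ioc 0 ε₂ := ⟨hε0, hε.2.trans (min_le_left _ _)⟩
    have t1 : ‖(F ε z - F₀ z) / (z * (z - ((b₀ + b₁ * ε : ℝ) : ℂ)))‖ ≤ C₀ * ε / d ^ 2 := by
      rw [norm_div, norm_mul, pow_two]
      gcongr
      exact hFF₀ ε hε2 z (hρs hz)
    have t2 : ‖F₀ z * (b₁ * ε) / (z * (z - ((b₀ + b₁ * ε : ℝ) : ℂ)) * (z - b₀))‖ ≤
        K₀ * (|b₁| * ε) / d ^ 3 := by
      rw [norm_div, norm_mul, norm_mul, norm_mul, norm_mul, Complex.norm_real, Complex.norm_real,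
        Real.norm_eq_abs, Real.norm_eq_abs, abs_of_pos hε0, show d ^ 3 = d * d * d by ring]
      gcongr
      exact hF₀K z (hρs hz)
    calc _ ≤ _ := add_le_add t1 t2
      _ = _ := by simp only [hP]; ring
  -- the value at the saddlepoint
  obtain ⟨C₁, e₁, he₁, hC₁⟩ := hpt u (by simpa using hr)
  set A₀ := Real.exp (L₁ u) / (u * (u - b₀)) with hA₀
  set E := Real.exp (L₁ u) with hE
  set Q := |C₁| / d ^ 2 + |E| * |b₁| ^ 2 / d ^ 4 + |E| * |L₂ u| * |b₁| / d ^ 3 with hQ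
  refine ⟨Q + Nat.factorial 1 * P / (ρ / 2) ^ 1 + Nat.factorial 2 * P / (ρ / 2) ^ 2, by positivity,
    min e₁ (min ε₂ (d / (|b₁| + 1))), by positivity, fun ε hε => ?_⟩
  have hε0 : 0 < ε := hε.1
  have hεd : ε ∈ Ioc 0 (min ε₂ (d / (|b₁| + 1))) := ⟨hε0, hε.2.trans (min_le_right _ _)⟩
  have hε₂' : ε ∈ Ioc 0 ε₀ :=
    ⟨hε0, (hεd.2.trans (min_le_left _ _)).trans hε₂₀⟩
  obtain ⟨hbb, hdz⟩ := hdist ε hεd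
  have hHd : DifferentiableOn ℂ (amplitude (F ε) (b₀ + b₁ * ε)) (Metric.ball (u : ℂ) ρ) :=
    differentiableOn_amplitude hd hbb hρd ((hF ε hε₂').mono (hρs.trans hsr'))
  -- Derivatives enter the integral with an extra factor ε, so precision O(ε) from Cauchy's
  -- estimates is enough. The value at u needs O(ε²), and this comes straight from `hpt` at u.
  have key : ∀ n, ‖iteratedDeriv n (amplitude (F ε) (b₀ + b₁ * ε)) u - iteratedDeriv n H₀ u‖ ≤
      n.factorial * (P * ε) / (ρ / 2) ^ n := fun n =>
    iteratedDeriv_sub_le hρ0 n hHd hH₀d hdz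
  have hQ0 : 0 ≤ Q := by positivity
  refine ⟨?_, ?_, ?_⟩
  · obtain ⟨n1, n2⟩ := norm_ge_of_mem_ball hbb (Metric.mem_ball_self (x := (u : ℂ)) hd)
    obtain ⟨-, n3⟩ := norm_ge_of_mem_ball hb0 (Metric.mem_ball_self (x := (u : ℂ)) hd)
    have z1 : (u : ℂ) ≠ 0 := norm_pos_iff.1 (hd.trans_le n1)
    have z2 : (u : ℂ) - ((b₀ + b₁ * ε : ℝ) : ℂ) ≠ 0 := norm_pos_iff.1 (hd.trans_le n2)
    have z3 : (u : ℂ) - b₀ ≠ 0 := norm_pos_iff.1 (hd.trans_le n3)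
    have e : amplitude (F ε) (b₀ + b₁ * ε) u - ((A₀ : ℝ) : ℂ) *
        (1 + ((L₂ u + b₁ / (u - b₀) : ℝ) : ℂ) * ε) =
        (F ε u - ((E : ℝ) + (E * L₂ u : ℝ) * ε)) / (u * (u - ((b₀ + b₁ * ε : ℝ) : ℂ)))
        + E * (b₁ * ε) ^ 2 / (u * (u - ((b₀ + b₁ * ε : ℝ) : ℂ)) * (u - b₀) * (u - b₀))
        + E * (L₂ u * ε) * (b₁ * ε) / (u * (u - ((b₀ + b₁ * ε : ℝ) : ℂ)) * (u - b₀)) := by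
      rw [amplitude, hA₀]
      push_cast at z2 ⊢
      field_simp
      ring
    rw [e]
    have nr : ∀ x : ℝ, ‖(x : ℂ)‖ = |x| := fun x => by rw [Complex.norm_real, Real.norm_eq_abs]
    have t1 : ‖(F ε u - ((E : ℝ) + (E * L₂ u : ℝ) * ε)) / (u * (u - ((b₀ + b₁ * ε : ℝ) : ℂ)))‖ ≤
        |C₁| * ε ^ 2 / d ^ 2 := by
      rw [norm_div, norm_mul, pow_two d]
      gcongr
      refine (hC₁ ε ⟨hε0, hε.2.trans (min_le_left _ _)⟩).trans ?_
      gcongr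
      exact le_abs_self _
    have t2 : ‖E * (b₁ * ε : ℂ) ^ 2 / (u * (u - ((b₀ + b₁ * ε : ℝ) : ℂ)) * (u - b₀) * (u - b₀))‖ ≤
        |E| * (|b₁| * ε) ^ 2 / d ^ 4 := by
      rw [norm_div, norm_mul, norm_pow, norm_mul, norm_mul, norm_mul, norm_mul, nr E, nr b₁, nr ε,
        abs_of_pos hε0, show d ^ 4 = d * d * d * d by ring]
      gcongr
    have t3 : ‖E * (L₂ u * ε : ℂ) * (b₁ * ε) / (u * (u - ((b₀ + b₁ * ε : ℝ) : ℂ)) * (u - b₀))‖ ≤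
        |E| * (|L₂ u| * ε) * (|b₁| * ε) / d ^ 3 := by
      rw [norm_div, norm_mul, norm_mul, norm_mul, norm_mul, norm_mul, norm_mul, nr E, nr b₁, nr ε,
        nr (L₂ u), abs_of_pos hε0, show d ^ 3 = d * d * d by ring]
      gcongr
    calc _ ≤ _ := norm_add₃_le.trans (add_le_add (add_le_add t1 t2) t3)
      _ = Q * ε ^ 2 := by simp only [hQ]; ring
      _ ≤ _ := by
        gcongr
        rw [add_assoc]
        exact le_add_of_nonneg_right (by positivity)
  · have := key 1
    rw [iteratedDeriv_one, iteratedDeriv_one, hder1] at this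
    refine this.trans ?_
    calc Nat.factorial 1 * (P * ε) / (ρ / 2) ^ 1 = (Nat.factorial 1 * P / (ρ / 2) ^ 1) * ε := by ring
      _ ≤ _ := by
        gcongr
        have : 0 ≤ Nat.factorial 2 * P / (ρ / 2) ^ 2 := by positivity
        linarith
  · have := key 2
    rw [hder2] at this
    refine this.trans ?_
    calc Nat.factorial 2 * (P * ε) / (ρ / 2) ^ 2 = (Nat.factorial 2 * P / (ρ / 2) ^ 2) * ε := by ring
      _ ≤ _ := by
        gcongr
        have : 0 ≤ Nat.factorial 1 * P / (ρ / 2) ^ 1 := by positivity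
        linarith

/-- The coefficient of order `ε` in the relative expansion of the inverse Fourier integral. -/
def saddleCoeff (φ L₁ L₂ : ℝ → ℝ) (u b₀ b₁ : ℝ) : ℝ :=
  L₂ u + b₁ / (u - b₀) -
    (((deriv L₁ u - 1 / u - 1 / (u - b₀)) ^ 2
        + (iteratedDeriv 2 L₁ u + 1 / u ^ 2 + 1 / (u - b₀) ^ 2)) / (2 * iteratedDeriv 2 φ u)
      - 3 * (2 * (iteratedDeriv 3 φ u / 6) * (deriv L₁ u - 1 / u - 1 / (u - b₀))
        + iteratedDeriv 4 φ u / 12) / (2 * iteratedDeriv 2 φ u ^ 2)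
      + 15 * (iteratedDeriv 3 φ u / 6) ^ 2 / (2 * iteratedDeriv 2 φ u ^ 3))

/-- Relative second order expansion of the inverse Fourier integral. -/
theorem saddle_integral_expansion {F : ℝ → ℂ → ℂ} {G : ℂ → ℂ} {φ L₁ L₂ : ℝ → ℝ}
    {u r K b₀ b₁ ε₀ : ℝ} (hu : u ≠ 0) (hub : u ≠ b₀) (hr : 0 < r) (hε₀ : 0 < ε₀)
    (hG : DifferentiableOn ℂ G (Metric.ball (u : ℂ) r)) (hφ : ∀ᶠ x : ℝ in 𝓝 u, G x = φ x)
    (ha : 0 < iteratedDeriv 2 φ u) (hGc : Continuous fun q : ℝ => G (u + q * Complex.I))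
    (htail : ∀ δ > 0, ∃ η > 0, ∀ q : ℝ, δ ≤ |q| → (G (u + q * Complex.I)).re ≤ (G u).re - η)
    (hF : ∀ ε ∈ Ioc 0 ε₀, DifferentiableOn ℂ (F ε) (Metric.ball (u : ℂ) r))
    (hFK : ∀ ε ∈ Ioc 0 ε₀, ∀ z ∈ Metric.ball (u : ℂ) r, ‖F ε z‖ ≤ K)
    (hFc : ∀ ε ∈ Ioc 0 ε₀, Continuous fun q : ℝ => F ε (u + q * Complex.I))
    (hFl : ∀ ε ∈ Ioc 0 ε₀, ∀ q : ℝ, ‖F ε (u + q * Complex.I)‖ ≤ K)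
    (hpt : ∀ x : ℝ, |x - u| < r → ∃ C : ℝ, ∃ ε₁ > 0, ∀ ε ∈ Ioc 0 ε₁,
      ‖F ε x - ((Real.exp (L₁ x) : ℝ) + (Real.exp (L₁ x) * L₂ x : ℝ) * ε)‖ ≤ C * ε ^ 2) :
    ∃ C : ℝ, ∃ ε₁ > 0, ∀ ε ∈ Ioc 0 ε₁,
      ‖(∫ q : ℝ, saddleIntegrand (F ε) G φ u (b₀ + b₁ * ε) ε q) -
        (√(2 * Real.pi * ε / iteratedDeriv 2 φ u) * (Real.exp (L₁ u) / (u * (u - b₀)))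
          * (1 + saddleCoeff φ L₁ L₂ u b₀ b₁ * ε) : ℝ)‖ ≤ C * (ε ^ 2 * √ε) := by
  obtain ⟨C₁, e₁, he₁, h₁⟩ := saddle_integral_laplace (b₁ := b₁) hu hub hr hε₀ hG hφ ha hGc htail hF
    hFK hFc hFl
  obtain ⟨C₂, hC₂, e₂, he₂, h₂⟩ := amplitude_expansion (b₁ := b₁) hu hub hr hε₀ hF hFK hpt
  set a := iteratedDeriv 2 φ u with haa
  set A₀ := Real.exp (L₁ u) / (u * (u - b₀)) with hA₀
  set p1 := deriv L₁ u - 1 / u - 1 / (u - b₀) with hp1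
  set p2 := p1 ^ 2 + (iteratedDeriv 2 L₁ u + 1 / u ^ 2 + 1 / (u - b₀) ^ 2) with hp2
  set φ3 := iteratedDeriv 3 φ u / 6 with hφ3
  set φ4 := iteratedDeriv 4 φ u / 12 with hφ4
  set ℓ := L₂ u + b₁ / (u - b₀) with hℓ
  set S := √(2 * Real.pi / a) with hS
  set V := C₂ / (2 * a) + 3 * (2 * |φ3| * C₂ + |φ4| * (C₂ + |A₀| * |ℓ|)) / (2 * a ^ 2)
    + 15 * (|φ3| ^ 2 * (C₂ + |A₀| * |ℓ|)) / (2 * a ^ 3) with hV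
  have hV0 : 0 ≤ V := by positivity
  refine ⟨C₁ + S * (C₂ + V), min e₁ (min e₂ 1), by positivity, fun ε hε => ?_⟩
  have hε0 : 0 < ε := hε.1
  have hε1 : ε ≤ 1 := hε.2.trans ((min_le_right _ _).trans (min_le_right _ _))
  have k1 := h₁ ε ⟨hε0, hε.2.trans (min_le_left _ _)⟩
  obtain ⟨k2, k3, k4⟩ := h₂ ε ⟨hε0, hε.2.trans ((min_le_right _ _).trans (min_le_left _ _))⟩
  set H := amplitude (F ε) (b₀ + b₁ * ε) with hH
  have nr : ∀ x : ℝ, ‖(x : ℂ)‖ = |x| := fun x => by rw [Complex.norm_real, Real.norm_eq_abs]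
  have k5 : ‖H u - (A₀ : ℝ)‖ ≤ (C₂ + |A₀| * |ℓ|) * ε := by
    have e : H u - (A₀ : ℝ) = (H u - (A₀ : ℝ) * (1 + (ℓ : ℝ) * ε)) + A₀ * ℓ * ε := by ring
    rw [e]
    refine (norm_add_le _ _).trans ?_
    rw [norm_mul, norm_mul, nr, nr, nr, abs_of_pos hε0, add_mul]
    gcongr
    refine k2.trans ?_
    gcongr
    nlinarith
  have ha' : (a : ℂ) ≠ 0 := by exact_mod_cast ha.ne'
  have k6 : ‖laplaceCorrection φ H u - (A₀ * (p2 / (2 * a) - 3 * (2 * φ3 * p1 + φ4) / (2 * a ^ 2)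
      + 15 * φ3 ^ 2 / (2 * a ^ 3)) : ℝ)‖ ≤ V * ε := by
    have e : laplaceCorrection φ H u - (A₀ * (p2 / (2 * a) - 3 * (2 * φ3 * p1 + φ4) / (2 * a ^ 2)
        + 15 * φ3 ^ 2 / (2 * a ^ 3)) : ℝ) =
        (iteratedDeriv 2 H u - (A₀ : ℝ) * (p2 : ℝ)) / (2 * a)
        + (-(3 * (2 * φ3 * (deriv H u - (A₀ : ℝ) * (p1 : ℝ)) + φ4 * (H u - (A₀ : ℝ))) / (2 * a ^ 2)))
        + 15 * (φ3 ^ 2 * (H u - (A₀ : ℝ))) / (2 * a ^ 3) := by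
      unfold laplaceCorrection
      rw [← haa, ← hφ3, ← hφ4]
      push_cast
      ring
    rw [e]
    have t1 : ‖(iteratedDeriv 2 H u - (A₀ : ℝ) * (p2 : ℝ)) / (2 * a)‖ ≤ C₂ * ε / (2 * a) := by
      rw [norm_div, norm_mul, Complex.norm_ofNat, nr, abs_of_pos ha]
      gcongr
    have t2 : ‖-(3 * (2 * φ3 * (deriv H u - (A₀ : ℝ) * (p1 : ℝ)) + φ4 * (H u - (A₀ : ℝ))) / (2 * a ^ 2)
        : ℂ)‖ ≤ 3 * (2 * |φ3| * (C₂ * ε) + |φ4| * ((C₂ + |A₀| * |ℓ|) * ε)) / (2 * a ^ 2) := by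
      rw [norm_neg, norm_div, norm_mul, norm_mul, norm_pow, Complex.norm_ofNat, Complex.norm_ofNat,
        nr, abs_of_pos ha]
      gcongr
      refine (norm_add_le _ _).trans ?_
      rw [norm_mul, norm_mul, norm_mul, Complex.norm_ofNat, nr, nr]
      gcongr
    have t3 : ‖15 * (φ3 ^ 2 * (H u - (A₀ : ℝ))) / (2 * a ^ 3)‖ ≤
        15 * (|φ3| ^ 2 * ((C₂ + |A₀| * |ℓ|) * ε)) / (2 * a ^ 3) := by
      rw [norm_div, norm_mul, norm_mul, norm_mul, norm_pow, norm_pow, Complex.norm_ofNat,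
        Complex.norm_ofNat, nr, nr, abs_of_pos ha]
      gcongr
    calc _ ≤ _ := norm_add₃_le.trans (add_le_add (add_le_add t1 t2) t3)
      _ = _ := by simp only [hV]; ring
  have hsq : √(2 * Real.pi * ε / a) = S * √ε := by
    rw [hS, ← Real.sqrt_mul (by positivity)]
    congr 1
    ring
  set T := ∫ q : ℝ, saddleIntegrand (F ε) G φ u (b₀ + b₁ * ε) ε q with hT
  have e : T - (√(2 * Real.pi * ε / a) * A₀ * (1 + saddleCoeff φ L₁ L₂ u b₀ b₁ * ε) : ℝ) =
      (T - √(2 * Real.pi * ε / a) * (H u - ε * laplaceCorrection φ H u))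
      + (√(2 * Real.pi * ε / a) : ℝ) * ((H u - (A₀ : ℝ) * (1 + (ℓ : ℝ) * ε))
        - ε * (laplaceCorrection φ H u - (A₀ * (p2 / (2 * a) - 3 * (2 * φ3 * p1 + φ4) / (2 * a ^ 2)
      + 15 * φ3 ^ 2 / (2 * a ^ 3)) : ℝ))) := by
    unfold saddleCoeff
    rw [← haa, ← hφ3, ← hφ4, ← hp1, ← hp2, ← hℓ]
    push_cast
    ring
  rw [e]
  refine (norm_add_le _ _).trans ?_
  rw [add_mul]
  refine add_le_add k1 ?_
  rw [norm_mul, nr, abs_of_nonneg (Real.sqrt_nonneg _), hsq]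
  calc S * √ε * _ ≤ S * √ε * (C₂ * ε ^ 2 + ε * (V * ε)) := by
        gcongr
        refine (norm_sub_le _ _).trans (add_le_add k2 ?_)
        rw [norm_mul, nr, abs_of_pos hε0]
        gcongr
    _ = _ := by ring

end FwdSmile

end

/-! ### The inverse Fourier integral of a family -/

noncomputable section

namespace FwdSmile

variable {Ω : Type*} [MeasurableSpace Ω] {μ : ℝ → Measure Ω} {Y : ℝ → Ω → ℝ} {G : ℂ → ℂ}

/-- Eventual bounds at `0+` hold on an interval. -/
theorem exists_Ioc_of_eventually {p : ℝ → Prop} (h : ∀ᶠ ε : ℝ in 𝓝[>] 0, p ε) :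
    ∃ ε₁ > 0, ∀ ε ∈ Ioc 0 ε₁, p ε := by
  obtain ⟨e, he, h⟩ := (mem_nhdsGT_iff_exists_Ioc_subset).1 h
  exact ⟨e, he, fun ε hε => h hε⟩

/-- The saddlepoint coefficient in terms of `Υ`. -/
theorem saddleCoeff_eq {Λ : Fin 3 → ℝ → ℝ} {u b₀ b₁ : ℝ} (hu : u ≠ 0) (hub : u ≠ b₀)
    (ha : iteratedDeriv 2 (Λ 0) u ≠ 0) :
    saddleCoeff (Λ 0) (Λ 1) (Λ 2) u b₀ b₁ = upsilon Λ b₀ u + b₁ / (u - b₀) := by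
  have hub' : u - b₀ ≠ 0 := sub_ne_zero.2 hub
  simp only [saddleCoeff, upsilon, dL, iteratedDeriv_one]
  field_simp
  ring

/-- Away from the real axis, `Re G` stays below its maximum on a vertical line. -/
theorem TailControl.exists_gap {D : Set ℝ} {Λ₀ : ℝ → ℝ} (hT : TailControl μ Y D Λ₀ G) {p : ℝ}
    (hp : p ∈ D) (hp0 : p ≠ 0) (hGc : Continuous fun q : ℝ => G (p + q * Complex.I)) {δ : ℝ}
    (hδ : 0 < δ) :
    ∃ η > 0, ∀ q : ℝ, δ ≤ |q| → (G (p + q * Complex.I)).re ≤ (G p).re - η := by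
  obtain ⟨η, hη, R, hR⟩ := hT.bounded_away p hp hp0
  -- A strict maximum gives no uniform gap by itself: compactness handles δ ≤ |q| ≤ R and
  -- `bounded_away` the remaining q.
  set S : Set ℝ := Icc (-R) R ∩ {q | δ ≤ |q|} with hS
  have hSc : IsCompact S :=
    isCompact_Icc.inter_right (isClosed_le continuous_const continuous_abs)
  rcases S.eq_empty_or_nonempty with hempty | hne
  · refine ⟨η, hη, fun q hq => hR q (not_lt.1 fun h => ?_)⟩
    have : q ∈ S := ⟨abs_le.1 h.le, hq⟩
    simp [hempty] at this
  · obtain ⟨q₀, hq₀, hmax⟩ := hSc.exists_isMaxOn hne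
      (Complex.continuous_re.comp hGc).continuousOn
    have hq0 : q₀ ≠ 0 := fun h => by
      have := hq₀.2
      simp only [h, mem_ofPred_eq, abs_zero] at this
      linarith
    have hlt := hT.unique_max p hp hp0 q₀ hq0
    refine ⟨min η ((G p).re - (G (p + q₀ * Complex.I)).re), lt_min hη (sub_pos.2 hlt),
      fun q hq => ?_⟩
    rcases le_total R |q| with h | h
    · linarith [hR q h, min_le_left η ((G p).re - (G (p + q₀ * Complex.I)).re)]
    · have := hmax (show q ∈ S from ⟨abs_le.1 h, hq⟩)
      simp only [Function.comp_apply, mem_ofPred_eq] at this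
      linarith [min_le_right η ((G p).re - (G (p + q₀ * Complex.I)).re)]

theorem cMgf_ofReal_eq_exp {ε x : ℝ} (hε : 0 < ε) [NeZero (μ ε)] (hx : x ∈ lmgfDomain μ Y ε) :
    cMgf μ Y ε x = (Real.exp (lmgf μ Y ε x / ε) : ℝ) := by
  have h : Integrable (fun ω => Real.exp (x / ε * Y ε ω)) (μ ε) := hx
  unfold cMgf lmgf
  rw [mul_div_cancel_left₀ _ hε.ne', exp_cgf h, ← complexMGF_ofReal]
  push_cast
  rfl

/-- Pointwise expansion of the normalised moment generating function. -/
theorem Assumptions.normMgf_expansion {Λ : Fin 3 → ℝ → ℝ} (hA : Assumptions μ Y Λ)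
    (hT : TailControl μ Y (D0int μ Y) (Λ 0) G) (hμ : ∀ ε > 0, NeZero (μ ε)) {x : ℝ}
    (hx : x ∈ D0int μ Y) (hx0 : x ≠ 0) :
    ∃ C : ℝ, ∃ ε₁ > 0, ∀ ε ∈ Ioc 0 ε₁,
      ‖normMgf μ Y G ε x - ((Real.exp (Λ 1 x) : ℝ) + (Real.exp (Λ 1 x) * Λ 2 x : ℝ) * ε)‖ ≤
        C * ε ^ 2 := by
  obtain ⟨C, hC⟩ := (hA.expansion x hx).bound
  obtain ⟨e₁, he₁, h₁⟩ := exists_Ioc_of_eventually hC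
  obtain ⟨e₂, he₂, hsub, -⟩ := hA.smooth
  have hC0 : 0 ≤ |C| := abs_nonneg C
  set B := |Λ 2 x| + |C| with hB
  refine ⟨Real.exp (Λ 1 x) * (B ^ 2 + |C|), min (min e₁ (e₂ / 2)) (min 1 (1 / (B + 1))),
    by positivity, fun ε hε => ?_⟩
  have hε0 := hε.1
  have hm1 := hε.2.trans (min_le_left _ _)
  have hm2 := hε.2.trans (min_le_right _ _)
  have hε1 : ε ≤ 1 := hm2.trans (min_le_left _ _)
  have hεB : B * ε ≤ 1 := by
    have := hm2.trans (min_le_right _ _)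
    rw [le_div_iff₀ (by positivity)] at this
    nlinarith
  have hb := h₁ ε ⟨hε0, hm1.trans (min_le_left _ _)⟩
  have hd : x ∈ lmgfDomain μ Y ε :=
    hsub ε ⟨hε0, (hm1.trans (min_le_right _ _)).trans_lt (by linarith)⟩ hx
  have := hμ ε hε0
  rw [Fin.sum_univ_three, Real.norm_eq_abs, Real.norm_eq_abs, abs_of_pos (pow_pos hε0 3)] at hb
  simp only [Fin.val_zero, pow_zero, mul_one, Fin.val_one, pow_one, Fin.val_two] at hb
  set ρ := lmgf μ Y ε x - (Λ 0 x + Λ 1 x * ε + Λ 2 x * ε ^ 2) with hρ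
  -- The logarithm of the normalised function is Λ₁ + s. The division of Λ_ε by ε is why an O(ε³)
  -- expansion yields only O(ε²) here.
  set s := Λ 2 x * ε + ρ / ε with hs
  have hρε : |ρ / ε| ≤ |C| * ε ^ 2 := by
    rw [abs_div, abs_of_pos hε0, div_le_iff₀ hε0]
    calc |ρ| ≤ C * ε ^ 3 := hb
      _ ≤ |C| * ε ^ 3 := by gcongr; exact le_abs_self C
      _ = _ := by ring
  have hsB : |s| ≤ B * ε := by
    calc |s| ≤ |Λ 2 x * ε| + |ρ / ε| := abs_add_le _ _
      _ ≤ |Λ 2 x| * ε + |C| * ε := by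
        rw [abs_mul, abs_of_pos hε0]
        gcongr
        refine hρε.trans ?_
        gcongr
        nlinarith
      _ = _ := by rw [hB]; ring
  have hval : normMgf μ Y G ε x = (Real.exp (Λ 1 x) * Real.exp s : ℝ) := by
    unfold normMgf
    rw [cMgf_ofReal_eq_exp hε0 hd, hT.extend x hx hx0, ← Complex.ofReal_neg, ← Complex.ofReal_div,
      ← Complex.ofReal_exp, ← Complex.ofReal_mul, ← Real.exp_add, ← Real.exp_add]
    congr 2
    rw [hs, hρ]
    field_simp
    ring
  rw [hval, show ((Real.exp (Λ 1 x) * Real.exp s : ℝ) : ℂ) -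
      ((Real.exp (Λ 1 x) : ℝ) + (Real.exp (Λ 1 x) * Λ 2 x : ℝ) * ε) =
      ((Real.exp (Λ 1 x) * ((Real.exp s - 1 - s) + ρ / ε) : ℝ) : ℂ) by
    rw [show ρ / ε = s - Λ 2 x * ε by rw [hs]; ring]
    push_cast
    ring, Complex.norm_real, Real.norm_eq_abs, abs_mul, Real.abs_exp, mul_assoc]
  gcongr
  refine (abs_add_le _ _).trans ?_
  rw [add_mul]
  refine add_le_add ((Real.abs_exp_sub_one_sub_id_le (hsB.trans hεB)).trans ?_) hρε
  rw [← sq_abs, ← mul_pow]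
  gcongr

theorem continuous_vertical {f : ℂ → ℂ} {D : Set ℝ} (hD : IsOpen D) {p : ℝ} (hp : p ∈ D)
    (hf : DifferentiableOn ℂ f {z | z.re ∈ D}) : Continuous fun q : ℝ => f (p + q * Complex.I) := by
  have ho : IsOpen {z : ℂ | z.re ∈ D} := hD.preimage Complex.continuous_re
  rw [continuous_iff_continuousAt]
  intro q
  have hm : (p + q * Complex.I : ℂ) ∈ {z : ℂ | z.re ∈ D} := by simpa using hp
  have h1 : ContinuousAt f (p + q * Complex.I) :=
    (hf.differentiableAt (ho.mem_nhds hm)).continuousAt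
  exact ContinuousAt.comp (f := fun q : ℝ => (p + q * Complex.I : ℂ)) h1 (by fun_prop)

/-- The inverse Fourier integral of the moment generating function along the line `Re z = u`. -/
def fourierIntegral (μ : ℝ → Measure Ω) (Y : ℝ → Ω → ℝ) (u b k ε : ℝ) : ℂ :=
  ∫ q : ℝ, cMgf μ Y ε (u + q * Complex.I) /
    ((u + q * Complex.I) * (u + q * Complex.I - b)) * Complex.exp (-(k * (u + q * Complex.I)) / ε)

/-- The second derivative of `Λ₀` is positive, and the inverse Fourier integral has an expansion. -/
theorem Assumptions.fourierIntegral_expansion {Λ : Fin 3 → ℝ → ℝ} (hA : Assumptions μ Y Λ)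
    (hμ : ∀ ε > 0, NeZero (μ ε)) {u b₀ : ℝ} (b₁ : ℝ) (hu : u ∈ D0int μ Y) (hu0 : u ≠ 0)
    (hub : u ≠ b₀) :
    0 < dL Λ 0 2 u ∧ ∃ C : ℝ, ∃ ε₁ > 0, ∀ ε ∈ Ioc 0 ε₁,
      ‖(Real.exp ((u * deriv (Λ 0) u - Λ 0 u) / ε) : ℝ) *
          fourierIntegral μ Y u (b₀ + b₁ * ε) (deriv (Λ 0) u) ε -
        (√(2 * Real.pi * ε / dL Λ 0 2 u) * (Real.exp (Λ 1 u) / (u * (u - b₀)))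
          * (1 + (upsilon Λ b₀ u + b₁ / (u - b₀)) * ε) : ℝ)‖ ≤ C * (ε ^ 2 * √ε) := by
  obtain ⟨G, hT⟩ := hA.tail
  have hDo : IsOpen (D0int μ Y) := isOpen_interior
  obtain ⟨r, hr, hrD, K₁, e₁, he₁, hF⟩ := hA.exists_uniform_bound hT hu hu0
  obtain ⟨K₂, e₂, he₂, hK₂⟩ := hT.line_bound hu hu0
  have hG : DifferentiableOn ℂ G (Metric.ball (u : ℂ) r) := hT.holo.mono fun z hz => by
    refine hrD _ ?_
    have := Complex.abs_re_le_norm (z - u)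
    rw [Complex.sub_re, Complex.ofReal_re] at this
    rw [Metric.mem_ball, dist_eq_norm] at hz
    linarith
  have hφ : ∀ᶠ x : ℝ in 𝓝 u, G x = Λ 0 x := by
    filter_upwards [(hDo.inter isOpen_ne).mem_nhds ⟨hu, hu0⟩] with x hx
    exact hT.extend x hx.1 hx.2
  have hGa : AnalyticAt ℂ G u :=
    hG.analyticAt (Metric.isOpen_ball.mem_nhds (Metric.mem_ball_self hr))
  have ha : 0 < iteratedDeriv 2 (Λ 0) u := by
    refine second_deriv_pos hGa hφ ?_
    have : ∀ᶠ z : ℂ in 𝓝 (u : ℂ), z.re ∈ D0int μ Y ∩ {x | x ≠ 0} :=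
      Complex.continuous_re.continuousAt.eventually
        ((hDo.inter isOpen_ne).mem_nhds (by simpa using ⟨hu, hu0⟩))
    filter_upwards [this] with z hz him
    have := hT.unique_max z.re hz.1 hz.2 z.im him
    rwa [Complex.re_add_im] at this
  have hGc : Continuous fun q : ℝ => G (u + q * Complex.I) :=
    continuous_vertical (hDo.inter isOpen_ne) (p := u) ⟨hu, hu0⟩ hT.holo
  refine ⟨ha, ?_⟩
  obtain ⟨C, e₃, he₃, h⟩ := saddle_integral_expansion (F := normMgf μ Y G) (G := G) (φ := Λ 0)
    (L₁ := Λ 1) (L₂ := Λ 2) (K := max K₁ K₂) (b₁ := b₁) hu0 hub hr (lt_min he₁ he₂) hG hφ ha hGc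
    (fun δ hδ => hT.exists_gap hu hu0 hGc hδ)
    (fun ε hε => (hF ε ⟨hε.1, hε.2.trans (min_le_left _ _)⟩).2.1)
    (fun ε hε z hz => ((hF ε ⟨hε.1, hε.2.trans (min_le_left _ _)⟩).2.2 z hz).trans
      (le_max_left _ _))
    (fun ε hε => by
      have h1 := continuous_vertical hDo hu (differentiableOn_cMgf hDo hε.1
        (hF ε ⟨hε.1, hε.2.trans (min_le_left _ _)⟩).1)
      exact h1.mul (hGc.neg.div_const _).cexp)
    (fun ε hε q => (hK₂ ε ⟨hε.1, hε.2.trans (min_le_right _ _)⟩ _ (by simp)).trans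
      (le_max_right _ _))
    (fun x hx => hA.normMgf_expansion hT hμ (hrD x hx).1 (hrD x hx).2)
  rw [saddleCoeff_eq hu0 hub ha.ne'] at h
  refine ⟨C, e₃, he₃, fun ε hε => ?_⟩
  refine le_trans (le_of_eq ?_) (h ε hε)
  congr 2
  rw [fourierIntegral, ← integral_const_mul]
  refine integral_congr_ae (Eventually.of_forall fun q => ?_)
  have hε' : (ε : ℂ) ≠ 0 := by exact_mod_cast hε.1.ne'
  simp only [saddleIntegrand, amplitude, normMgf]
  rw [hT.extend u hu hu0]
  have : ∀ a b c d e : ℂ, a = b + c - d → Complex.exp a * e =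
    e * Complex.exp b * Complex.exp c / Complex.exp d := by
    rintro a b c d e rfl
    rw [Complex.exp_sub, Complex.exp_add]; ring
  -- The prefactor exp((uk − Λ₀(u))/ε) recentres the exponent (G(z) − kz)/ε so that it vanishes at
  -- the saddlepoint.
  set z : ℂ := u + q * Complex.I with hz
  set k := deriv (Λ 0) u
  have e1 : Complex.exp (-G z / ε) * Complex.exp ((G z - Λ 0 u - k * (q * Complex.I)) / ε) =
      (Real.exp ((u * k - Λ 0 u) / ε) : ℝ) * Complex.exp (-(k * z) / ε) := by
    push_cast
    rw [← Complex.exp_add, ← Complex.exp_add]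
    congr 1
    rw [hz]
    field_simp
    ring
  rw [mul_div_right_comm, mul_assoc, e1]
  ring

end FwdSmile

end

/-! ### Inverse Fourier representation of call prices -/

noncomputable section

namespace FwdSmile

open scoped FourierTransform

/-- The one-sided exponential function with Fourier transform `1 / (a + iθ)`. -/
def oneSidedExp (a s : ℝ) : ℂ :=
  if 0 < a then (Ioi (0 : ℝ)).indicator (fun s : ℝ => Complex.exp (-a * s)) s
  else -(Iic (0 : ℝ)).indicator (fun s : ℝ => Complex.exp (-a * s)) s

theorem integrable_oneSidedExp {a : ℝ} (ha : a ≠ 0) : Integrable (oneSidedExp a) := by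
  unfold oneSidedExp
  split_ifs with h
  · exact (integrableOn_exp_mul_complex_Ioi (a := -a) (by simpa using h) 0).integrable_indicator
      measurableSet_Ioi
  · refine Integrable.neg ?_
    exact (integrableOn_exp_mul_complex_Iic (a := -a)
      (by simpa using lt_of_le_of_ne (not_lt.1 h) ha) 0).integrable_indicator measurableSet_Iic

theorem fourier_oneSidedExp {a : ℝ} (ha : a ≠ 0) (θ : ℝ) :
    ∫ s : ℝ, Complex.exp (-(θ * s * Complex.I)) * oneSidedExp a s = 1 / (a + θ * Complex.I) := by
  have h0 : (a + θ * Complex.I : ℂ) ≠ 0 := fun h => ha (by simpa using congrArg Complex.re h)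
  have h1 : -(a + θ * Complex.I : ℂ) ≠ 0 := neg_ne_zero.2 h0
  have e : ∀ s : ℝ, Complex.exp (-(θ * s * Complex.I)) * Complex.exp (-a * s) =
      Complex.exp (-(a + θ * Complex.I) * s) := fun s => by
    rw [← Complex.exp_add]; congr 1; ring
  unfold oneSidedExp
  split_ifs with h
  · have : ∀ s : ℝ, Complex.exp (-(θ * s * Complex.I)) *
        (Ioi (0 : ℝ)).indicator (fun s : ℝ => Complex.exp (-a * s)) s =
        (Ioi (0 : ℝ)).indicator (fun s : ℝ => Complex.exp (-(a + θ * Complex.I) * s)) s := by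
      intro s
      by_cases hs : s ∈ Ioi (0 : ℝ)
      · rw [indicator_of_mem hs, indicator_of_mem hs, e]
      · rw [indicator_of_notMem hs, indicator_of_notMem hs, mul_zero]
    simp_rw [this]
    rw [integral_indicator measurableSet_Ioi, integral_exp_mul_complex_Ioi (by simpa using h)]
    simp only [Complex.ofReal_zero, mul_zero, Complex.exp_zero]
    rw [neg_div_neg_eq]
  · have : ∀ s : ℝ, Complex.exp (-(θ * s * Complex.I)) *
        -(Iic (0 : ℝ)).indicator (fun s : ℝ => Complex.exp (-a * s)) s =
        -(Iic (0 : ℝ)).indicator (fun s : ℝ => Complex.exp (-(a + θ * Complex.I) * s)) s := by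
      intro s
      by_cases hs : s ∈ Iic (0 : ℝ)
      · rw [indicator_of_mem hs, indicator_of_mem hs, mul_neg, e]
      · rw [indicator_of_notMem hs, indicator_of_notMem hs, neg_zero, mul_zero]
    simp_rw [this]
    rw [integral_neg, integral_indicator measurableSet_Iic, integral_exp_mul_complex_Iic
      (by simpa using lt_of_le_of_ne (not_lt.1 h) ha)]
    simp only [Complex.ofReal_zero, mul_zero, Complex.exp_zero]
    rw [div_neg, neg_neg]

/-- The normalised call payoff, corrected by the residues at the poles to the right of `c`. -/
def dampedPayoff (b c s : ℝ) : ℝ :=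
  max (Real.exp (b * s) - 1) 0 - (if c < b then Real.exp (b * s) else 0) + (if c < 0 then 1 else 0)

/-- Partial fractions b/(z(z − b)) = 1/(z − b) − 1/z make the kernel a difference of two one-sided
exponentials. The side on which each lives depends on whether the line passes left or right of the
pole; this produces the residue terms. -/
theorem oneSidedExp_sub {b c : ℝ} (hc : c ≠ 0) (hcb : c ≠ b) (hb : 0 < b) (s : ℝ) :
    oneSidedExp (c - b) s - oneSidedExp c s = (Real.exp (-c * s) * dampedPayoff b c s : ℝ) := by
  have hexp : Real.exp (-(c - b) * s) = Real.exp (-c * s) * Real.exp (b * s) := by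
    rw [← Real.exp_add]; congr 1; ring
  have key : ∀ a : ℝ, a ≠ 0 → oneSidedExp a s =
      (Real.exp (-a * s) * ((if 0 < s then 1 else 0) - (if a < 0 then 1 else 0)) : ℝ) := by
    intro a ha
    unfold oneSidedExp
    rcases lt_or_gt_of_ne ha with h | h
    · rcases lt_or_ge 0 s with h' | h'
      · simp [h.not_gt, h, h']
      · simp [h.not_gt, h, h'.not_gt, h']
    · rcases lt_or_ge 0 s with h' | h'
      · simp [h.not_gt, h, h']
      · simp [h.not_gt, h, h'.not_gt]
  rw [key _ (sub_ne_zero.2 hcb), key _ hc, ← Complex.ofReal_sub, hexp]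
  congr 1
  have h1 : (c - b < 0) = (c < b) := by simp
  simp only [dampedPayoff, h1]
  rcases lt_or_ge 0 s with h' | h'
  · rw [max_eq_left (by
      have : 1 ≤ Real.exp (b * s) := Real.one_le_exp (by positivity)
      linarith)]
    split_ifs <;> ring
  · rw [max_eq_right (by
      have : Real.exp (b * s) ≤ 1 := Real.exp_le_one_iff.2 (mul_nonpos_of_nonneg_of_nonpos hb.le h')
      linarith)]
    rw [if_neg h'.not_gt]
    split_ifs <;> ring

theorem vertical_ne {c b : ℝ} (hcb : c ≠ b) (q : ℝ) : (c + q * Complex.I - b : ℂ) ≠ 0 := fun h =>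
  sub_ne_zero.2 hcb (by simpa using congrArg Complex.re h)

theorem integrable_inv_vertical {b c : ℝ} (hc : c ≠ 0) (hcb : c ≠ b) :
    Integrable fun q : ℝ => (1 : ℂ) / ((c + q * Complex.I) * (c + q * Complex.I - b)) := by
  have hd := poleDist_pos hc hcb
  refine Integrable.mono' ((integrable_inv_sq_add_sq hd).const_mul 1) ?_
    (Eventually.of_forall fun q => ?_)
  · refine Continuous.aestronglyMeasurable ?_
    refine Continuous.div (by fun_prop) (by fun_prop) fun q => mul_ne_zero ?_ (vertical_ne hcb q)
    simpa using vertical_ne hc q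
  · exact norm_amplitude_line_le (F := fun _ => 1) hd (by simpa using hd.le) (by simp)

/-- Fourier representation of the call payoff. -/
theorem integral_vertical_exp {b c : ℝ} (hc : c ≠ 0) (hcb : c ≠ b) (hb : 0 < b) (s : ℝ) :
    ∫ q : ℝ, Complex.exp ((c + q * Complex.I) * s) /
      ((c + q * Complex.I) * (c + q * Complex.I - b)) = (2 * Real.pi / b * dampedPayoff b c s : ℝ) := by
  set f : ℝ → ℂ := fun s => oneSidedExp (c - b) s - oneSidedExp c s with hf
  have hcb' : c - b ≠ 0 := sub_ne_zero.2 hcb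
  have hfi : Integrable f := (integrable_oneSidedExp hcb').sub (integrable_oneSidedExp hc)
  -- Each one-sided exponential jumps by 1 at the origin and the jumps cancel; continuity is
  -- required for pointwise Fourier inversion.
  have hfc : Continuous f := by
    have : f = fun s => ((Real.exp (-c * s) * dampedPayoff b c s : ℝ) : ℂ) :=
      funext fun s => oneSidedExp_sub hc hcb hb s
    rw [this]
    unfold dampedPayoff
    split_ifs <;> fun_prop
  have hFf : ∀ w : ℝ, 𝓕 f w = b * (1 / ((c + (2 * Real.pi * w : ℝ) * Complex.I) *
      (c + (2 * Real.pi * w : ℝ) * Complex.I - b))) := by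
    intro w
    have hi : ∀ a : ℝ, a ≠ 0 → Integrable fun s : ℝ =>
        Complex.exp (-((2 * Real.pi * w : ℝ) * s * Complex.I)) * oneSidedExp a s := fun a ha => by
      refine (integrable_oneSidedExp ha).bdd_mul (c := 1)
        (Continuous.aestronglyMeasurable (by fun_prop)) (Eventually.of_forall fun s => ?_)
      rw [Complex.norm_exp]
      simp
    have e : 𝓕 f w = ∫ s : ℝ,
        (Complex.exp (-((2 * Real.pi * w : ℝ) * s * Complex.I)) * oneSidedExp (c - b) s
        - Complex.exp (-((2 * Real.pi * w : ℝ) * s * Complex.I)) * oneSidedExp c s) := by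
      rw [Real.fourier_real_eq_integral_exp_smul]
      refine integral_congr_ae (Eventually.of_forall fun s => ?_)
      simp only [hf, smul_eq_mul]
      rw [mul_sub]
      congr 3 <;> (push_cast; ring)
    rw [e, integral_sub (hi _ hcb') (hi _ hc), fourier_oneSidedExp hcb', fourier_oneSidedExp hc]
    have h1 := vertical_ne hcb (2 * Real.pi * w)
    have h2 : (c + (2 * Real.pi * w : ℝ) * Complex.I : ℂ) ≠ 0 := by
      simpa using vertical_ne hc (2 * Real.pi * w)
    have h3 : ((c - b : ℝ) + (2 * Real.pi * w : ℝ) * Complex.I : ℂ) =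
      c + (2 * Real.pi * w : ℝ) * Complex.I - b := by push_cast; ring
    rw [h3]
    field_simp
    ring
  have hpi : (2 * Real.pi) ≠ 0 := by positivity
  have hFi : Integrable (𝓕 f) := by
    rw [show 𝓕 f = _ from funext hFf]
    exact ((integrable_inv_vertical hc hcb).comp_mul_left' hpi).const_mul _
  have hinv := congrFun (hfc.fourierInv_fourier_eq hfi hFi) s
  rw [Real.fourierInv_eq'] at hinv
  set g : ℝ → ℂ := fun q => Complex.exp ((q * s : ℝ) * Complex.I) *
    (1 / ((c + q * Complex.I) * (c + q * Complex.I - b))) with hg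
  have h1 : ∀ w : ℝ, Complex.exp ((2 * Real.pi * inner ℝ w s : ℝ) * Complex.I) • 𝓕 f w =
      b * g (2 * Real.pi * w) := fun w => by
    rw [hFf, smul_eq_mul, hg]
    simp only [RCLike.inner_apply, conj_trivial]
    rw [show 2 * Real.pi * (s * w) = 2 * Real.pi * w * s by ring]
    ring
  simp_rw [h1] at hinv
  rw [integral_const_mul, Measure.integral_comp_mul_left g, hf] at hinv
  simp only [oneSidedExp_sub hc hcb hb s] at hinv
  rw [abs_of_pos (by positivity), Complex.real_smul] at hinv
  have h2 : ∀ q : ℝ, Complex.exp ((c + q * Complex.I) * s) /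
      ((c + q * Complex.I) * (c + q * Complex.I - b)) = Real.exp (c * s) * g q := fun q => by
    rw [hg]
    push_cast
    rw [← mul_assoc, ← Complex.exp_add, mul_one_div]
    congr 2
    ring
  simp_rw [h2]
  rw [integral_const_mul]
  have hb' : (b : ℂ) ≠ 0 := by exact_mod_cast hb.ne'
  have h3 : ∫ q, g q = (2 * Real.pi / b * (Real.exp (-c * s) * dampedPayoff b c s) : ℝ) := by
    push_cast at hinv ⊢
    rw [← hinv]
    field_simp
  rw [h3, ← Complex.ofReal_mul]
  congr 1
  have h4 : Real.exp (c * s) * Real.exp (-c * s) = 1 := by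
    rw [← Real.exp_add]; simp
  linear_combination (2 * Real.pi / b * dampedPayoff b c s) * h4

variable {Ω : Type*} [MeasurableSpace Ω] {μ : ℝ → Measure Ω} {Y : ℝ → Ω → ℝ}

/-- Inverse Fourier representation of the price of a call. -/
theorem fourierIntegral_eq {ε u b : ℝ} (k : ℝ) [IsProbabilityMeasure (μ ε)] (hε : 0 < ε)
    (hu : u ∈ lmgfDomain μ Y ε)
    (hu0 : u ≠ 0) (hub : u ≠ b) (hb : 0 < b) (hbi : b ∈ lmgfDomain μ Y ε) :
    b / (2 * Real.pi) * Real.exp (b * k / ε) * fourierIntegral μ Y u b k ε =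
      ((∫ ω, max (Real.exp (b * (Y ε ω / ε)) - Real.exp (b * k / ε)) 0 ∂μ ε)
        - (if u < b then ∫ ω, Real.exp (b * (Y ε ω / ε)) ∂μ ε else 0)
        + (if u < 0 then Real.exp (b * k / ε) else 0) : ℝ) := by
  have hui : Integrable (fun ω => Real.exp (u / ε * Y ε ω)) (μ ε) := hu
  have hbi' : Integrable (fun ω => Real.exp (b * (Y ε ω / ε))) (μ ε) := by
    have : Integrable (fun ω => Real.exp (b / ε * Y ε ω)) (μ ε) := hbi
    refine this.congr (Eventually.of_forall fun ω => ?_)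
    simp only
    congr 1
    ring
  -- Measurability of Y ε is not assumed; it is recovered from that of exp(uY/ε), which is possible
  -- because u ≠ 0.
  have hYm : AEMeasurable (Y ε) (μ ε) :=
    aemeasurable_of_integrable_exp_mul (u := u / ε) (v := 0) (by positivity) hui (by simp)
  set A : ℝ → ℂ := fun q => 1 / ((u + q * Complex.I) * (u + q * Complex.I - b)) with hA
  have hAi : Integrable A := integrable_inv_vertical hu0 hub
  set Φ : ℝ × Ω → ℂ := fun p => Complex.exp ((u + p.1 * Complex.I) * ((Y ε p.2 - k) / ε : ℝ)) * A p.1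
    with hΦ
  have hΦm : AEStronglyMeasurable Φ ((volume : Measure ℝ).prod (μ ε)) := by
    have h1 : AEMeasurable (fun p : ℝ × Ω => Y ε p.2) ((volume : Measure ℝ).prod (μ ε)) :=
      hYm.comp_snd
    have h2 : AEMeasurable (fun p : ℝ × Ω => Complex.exp ((u + p.1 * Complex.I) *
        ((Y ε p.2 - k) / ε : ℝ))) ((volume : Measure ℝ).prod (μ ε)) := by fun_prop
    exact h2.aestronglyMeasurable.mul hAi.aestronglyMeasurable.comp_fst
  -- The modulus of the integrand is a product of an integrable kernel in q and a multiple of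
  -- exp(uY/ε), so Fubini applies.
  have hΦi : Integrable Φ ((volume : Measure ℝ).prod (μ ε)) := by
    refine Integrable.mono' (hAi.norm.mul_prod (hui.const_mul (Real.exp (-(u * k / ε))))) hΦm
      (Eventually.of_forall fun p => le_of_eq ?_)
    simp only [hΦ]
    rw [norm_mul, Complex.norm_exp, mul_comm, ← Real.exp_add]
    congr 2
    rw [Complex.re_mul_ofReal]
    simp
    ring
  have hsw := integral_integral_swap (f := fun q ω => Φ (q, ω)) hΦi
  have hL : ∀ q : ℝ, ∫ ω, Φ (q, ω) ∂μ ε = cMgf μ Y ε (u + q * Complex.I) /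
      ((u + q * Complex.I) * (u + q * Complex.I - b)) *
      Complex.exp (-(k * (u + q * Complex.I)) / ε) := fun q => by
    have : ∀ ω, Φ (q, ω) = Complex.exp (((u + q * Complex.I) / ε) * Y ε ω) *
        (A q * Complex.exp (-(k * (u + q * Complex.I)) / ε)) := fun ω => by
      simp only [hΦ]
      rw [mul_left_comm, ← Complex.exp_add, mul_comm]
      congr 2
      push_cast
      ring
    simp_rw [this]
    rw [integral_mul_const, cMgf, complexMGF, hA]
    ring
  have hR : ∀ ω, ∫ q : ℝ, Φ (q, ω) =
      (2 * Real.pi / b * dampedPayoff b u ((Y ε ω - k) / ε) : ℝ) := fun ω => by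
    rw [← integral_vertical_exp hu0 hub hb]
    refine integral_congr_ae (Eventually.of_forall fun q => ?_)
    simp only [hΦ, hA]
    rw [mul_one_div]
  simp_rw [hL, hR] at hsw
  rw [fourierIntegral, hsw, integral_complex_ofReal, integral_const_mul, ← Complex.ofReal_ofNat,
    ← Complex.ofReal_mul, ← Complex.ofReal_div, ← Complex.ofReal_mul, ← Complex.ofReal_mul]
  congr 1
  have hmax : Integrable (fun ω => max (Real.exp (b * (Y ε ω / ε)) - Real.exp (b * k / ε)) 0) (μ ε) :=
    (hbi'.sub (integrable_const _)).sup (integrable_const _)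
  have hpt : ∀ ω, Real.exp (b * k / ε) * dampedPayoff b u ((Y ε ω - k) / ε) =
      max (Real.exp (b * (Y ε ω / ε)) - Real.exp (b * k / ε)) 0
        - (if u < b then Real.exp (b * (Y ε ω / ε)) else 0)
        + (if u < 0 then Real.exp (b * k / ε) else 0) := fun ω => by
    have h1 : Real.exp (b * k / ε) * Real.exp (b * ((Y ε ω - k) / ε)) = Real.exp (b * (Y ε ω / ε)) := by
      rw [← Real.exp_add]; congr 1; ring
    have h2 : Real.exp (b * k / ε) * max (Real.exp (b * ((Y ε ω - k) / ε)) - 1) 0 =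
        max (Real.exp (b * (Y ε ω / ε)) - Real.exp (b * k / ε)) 0 := by
      rw [mul_max_of_nonneg _ _ (Real.exp_nonneg _), mul_sub, h1, mul_one, mul_zero]
    rw [dampedPayoff, mul_add, mul_sub, h2, mul_ite, mul_ite, h1, mul_one, mul_zero]
  calc b / (2 * Real.pi) * Real.exp (b * k / ε) *
        (2 * Real.pi / b * ∫ ω, dampedPayoff b u ((Y ε ω - k) / ε) ∂μ ε)
      = Real.exp (b * k / ε) * ∫ ω, dampedPayoff b u ((Y ε ω - k) / ε) ∂μ ε := by
        field_simp
    _ = ∫ ω, Real.exp (b * k / ε) * dampedPayoff b u ((Y ε ω - k) / ε) ∂μ ε := by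
        rw [integral_const_mul]
    _ = _ := by
        have hR : Integrable (fun ω => if u < b then Real.exp (b * (Y ε ω / ε)) else 0) (μ ε) := by
          split_ifs
          exacts [hbi', integrable_const _]
        have hMR : Integrable (fun ω => max (Real.exp (b * (Y ε ω / ε)) - Real.exp (b * k / ε)) 0
          - if u < b then Real.exp (b * (Y ε ω / ε)) else 0) (μ ε) := hmax.sub hR
        simp_rw [hpt]
        rw [integral_add hMR (integrable_const _), integral_sub hmax hR]
        congr 1
        · congr 1
          split_ifs <;> simp
        · simp

end FwdSmile

end

/-! ### The Black-Scholes price and Mills' ratio -/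

noncomputable section

namespace FwdSmile

/-- The standard Gaussian density. -/
def gaussDensity (x : ℝ) : ℝ := (√(2 * Real.pi))⁻¹ * Real.exp (-(x ^ 2 / 2))

theorem gaussDensity_pos (x : ℝ) : 0 < gaussDensity x := by
  unfold gaussDensity
  positivity

theorem gaussDensity_neg (x : ℝ) : gaussDensity (-x) = gaussDensity x := by
  simp [gaussDensity]

theorem hasDerivAt_gaussDensity (x : ℝ) : HasDerivAt gaussDensity (-x * gaussDensity x) x := by
  have h : HasDerivAt (fun x : ℝ => -(x ^ 2 / 2)) (-x) x := by
    simpa using ((hasDerivAt_pow 2 x).div_const 2).fun_neg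
  refine (h.exp.const_mul (√(2 * Real.pi))⁻¹).congr_deriv ?_
  unfold gaussDensity
  ring

theorem hasDerivAt_cdf_gaussian (x : ℝ) :
    HasDerivAt (cdf (gaussianReal 0 1)) (gaussDensity x) x := by
  have hpdf : gaussianPDFReal 0 1 = gaussDensity := by
    funext y
    simp [gaussianPDFReal, gaussDensity, neg_div]
  have hi : Integrable gaussDensity := hpdf ▸ integrable_gaussianPDFReal 0 1
  have hc : Continuous gaussDensity := by unfold gaussDensity; fun_prop
  have hcdf : ∀ y, cdf (gaussianReal 0 1) y = ∫ t in Iic y, gaussDensity t := fun y => by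
    rw [cdf_eq_real, Measure.real, gaussianReal_apply_eq_integral _ (by simp),
      ENNReal.toReal_ofReal (integral_nonneg fun t => gaussianPDFReal_nonneg _ _ _), hpdf]
  have h : ∀ y, cdf (gaussianReal 0 1) y =
      (∫ t in Iic (0 : ℝ), gaussDensity t) + ∫ t in (0 : ℝ)..y, gaussDensity t := fun y => by
    rw [hcdf, ← intervalIntegral.integral_Iic_sub_Iic hi.integrableOn hi.integrableOn]
    ring
  rw [funext h]
  exact (intervalIntegral.integral_hasDerivAt_right (hc.intervalIntegrable _ _)
    (hc.stronglyMeasurableAtFilter _ _) hc.continuousAt).const_add _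

/-- The density is even, so N(x) + N(−x) has zero derivative; its limit at infinity is 1. -/
theorem cdf_gaussian_neg (x : ℝ) :
    cdf (gaussianReal 0 1) (-x) = 1 - cdf (gaussianReal 0 1) x := by
  set f : ℝ → ℝ := fun x => cdf (gaussianReal 0 1) x + cdf (gaussianReal 0 1) (-x) with hf
  have hd : ∀ x, HasDerivAt f 0 x := fun x => by
    have h2 := (hasDerivAt_cdf_gaussian (-x)).comp x (hasDerivAt_neg x)
    refine ((hasDerivAt_cdf_gaussian x).add h2).congr_deriv ?_
    rw [gaussDensity_neg]; ring
  have hlim : Tendsto f atTop (𝓝 (1 + 0)) :=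
    (tendsto_cdf_atTop _).add ((tendsto_cdf_atBot _).comp tendsto_neg_atTop_atBot)
  have hconst : ∀ y, f y = f x := fun y =>
    is_const_of_deriv_eq_zero (fun z => (hd z).differentiableAt) (fun z => (hd z).deriv) y x
  have : f x = 1 + 0 :=
    tendsto_nhds_unique (tendsto_const_nhds.congr fun y => (hconst y).symm) hlim
  simp only [hf] at this
  linarith

theorem tendsto_gaussDensity : Tendsto gaussDensity atTop (𝓝 0) := by
  unfold gaussDensity
  rw [show (0 : ℝ) = (√(2 * Real.pi))⁻¹ * 0 by simp]
  refine Tendsto.const_mul _ (Real.tendsto_exp_atBot.comp ?_)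
  refine tendsto_neg_atTop_atBot.comp ?_
  exact (tendsto_pow_atTop two_ne_zero).atTop_div_const two_pos

/-- A function that decreases to 0 at infinity is nonnegative. Both bounds on Mills' ratio have this
form: the difference to a partial sum of the asymptotic series has a one-term derivative of constant
sign. -/
theorem nonneg_of_hasDerivAt_nonpos {h h' : ℝ → ℝ} (hd : ∀ x > 0, HasDerivAt h (h' x) x)
    (hn : ∀ x > 0, h' x ≤ 0) (hlim : Tendsto h atTop (𝓝 0)) {x : ℝ} (hx : 0 < x) : 0 ≤ h x := by
  have hanti : AntitoneOn h (Ioi 0) := by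
    refine antitoneOn_of_deriv_nonpos (convex_Ioi 0)
      (fun y hy => (hd y hy).continuousAt.continuousWithinAt)
      (fun y hy => (hd y (by simpa using hy)).differentiableAt.differentiableWithinAt) fun y hy => ?_
    rw [interior_Ioi] at hy
    rw [(hd y hy).deriv]
    exact hn y hy
  refine le_of_tendsto hlim ?_
  filter_upwards [eventually_ge_atTop x] with y hy
  exact hanti hx (hx.trans_le hy) hy

/-- The first terms of the expansion of the Gaussian distribution function at infinity. -/
def millsSum (d : ℝ) : ℝ := -(1 / d) + 1 / d ^ 3 - 3 / d ^ 5

/-- Bounds for Mills' ratio. -/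
theorem mills_bounds {x : ℝ} (hx : 0 < x) :
    1 - cdf (gaussianReal 0 1) x ≤ gaussDensity x * (1 / x - 1 / x ^ 3 + 3 / x ^ 5) ∧
    gaussDensity x * (1 / x - 1 / x ^ 3 + 3 / x ^ 5 - 15 / x ^ 7) ≤
      1 - cdf (gaussianReal 0 1) x := by
  have hp : ∀ (n : ℕ), n ≠ 0 → ∀ c : ℝ, Tendsto (fun x : ℝ => c / x ^ n) atTop (𝓝 0) :=
    fun n hn c => (tendsto_pow_atTop hn).const_div_atTop c
  have hp1 : Tendsto (fun x : ℝ => 1 / x) atTop (𝓝 0) := by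
    simpa using hp 1 one_ne_zero 1
  have hdp : ∀ (n : ℕ) (c : ℝ) (x : ℝ), 0 < x →
      HasDerivAt (fun x : ℝ => c / x ^ n) (-(c * n / x ^ (n + 1))) x := fun n c x hx => by
    have := ((hasDerivAt_pow n x).fun_inv (pow_pos hx n).ne').const_mul c
    simp only [← div_eq_mul_inv] at this
    refine this.congr_deriv ?_
    rcases n with _ | n
    · simp
    · simp only [Nat.add_sub_cancel]
      field_simp
      ring
  have hd1 : ∀ x : ℝ, 0 < x → HasDerivAt (fun x : ℝ => 1 / x) (-(1 / x ^ 2)) x := fun x hx => by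
    simpa using hdp 1 1 x hx
  have hQ := (tendsto_cdf_atTop (gaussianReal 0 1)).const_sub 1
  rw [sub_self] at hQ
  constructor
  · have := nonneg_of_hasDerivAt_nonpos
      (h := fun x => gaussDensity x * (1 / x - 1 / x ^ 3 + 3 / x ^ 5)
        - (1 - cdf (gaussianReal 0 1) x)) (h' := fun x => -(15 / x ^ 6 * gaussDensity x))
      (fun x hx => ?_) (fun x hx => ?_) ?_ hx
    · linarith
    · refine (((hasDerivAt_gaussDensity x).mul (((hd1 x hx).sub (hdp 3 1 x hx)).add
        (hdp 5 3 x hx))).sub ((hasDerivAt_cdf_gaussian x).const_sub 1)).congr_deriv ?_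
      simp only [Pi.add_apply, Pi.sub_apply]
      push_cast
      field_simp
      ring
    · have := gaussDensity_pos x
      simp only [Left.neg_nonpos_iff]
      positivity
    · simpa using (tendsto_gaussDensity.mul ((hp1.sub (hp 3 (by norm_num) 1)).add
        (hp 5 (by norm_num) 3))).sub hQ
  · have := nonneg_of_hasDerivAt_nonpos
      (h := fun x => (1 - cdf (gaussianReal 0 1) x)
        - gaussDensity x * (1 / x - 1 / x ^ 3 + 3 / x ^ 5 - 15 / x ^ 7))
      (h' := fun x => -(105 / x ^ 8 * gaussDensity x))
      (fun x hx => ?_) (fun x hx => ?_) ?_ hx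
    · linarith
    · refine (((hasDerivAt_cdf_gaussian x).const_sub 1).sub ((hasDerivAt_gaussDensity x).mul
        ((((hd1 x hx).sub (hdp 3 1 x hx)).add (hdp 5 3 x hx)).sub (hdp 7 15 x hx)))).congr_deriv ?_
      simp only [Pi.add_apply, Pi.sub_apply]
      push_cast
      field_simp
      ring
    · have := gaussDensity_pos x
      simp only [Left.neg_nonpos_iff]
      positivity
    · simpa using hQ.sub (tendsto_gaussDensity.mul (((hp1.sub (hp 3 (by norm_num) 1)).add
        (hp 5 (by norm_num) 3)).sub (hp 7 (by norm_num) 15)))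

/-- Expansion of the Gaussian distribution function at infinity. -/
theorem abs_cdf_gaussian_sub_le {d : ℝ} (hd : d ≠ 0) :
    |cdf (gaussianReal 0 1) d - ((if 0 < d then 1 else 0) + gaussDensity d * millsSum d)| ≤
      gaussDensity d * (15 / |d| ^ 7) := by
  rcases lt_or_gt_of_ne hd with h | h
  · rw [if_neg h.not_gt, abs_of_neg h]
    obtain ⟨h1, h2⟩ := mills_bounds (neg_pos.2 h)
    rw [cdf_gaussian_neg, gaussDensity_neg] at h1 h2
    have e : (1 / -d - 1 / (-d) ^ 3 + 3 / (-d) ^ 5) = millsSum d := by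
      unfold millsSum; field_simp; ring
    rw [e] at h1 h2
    rw [mul_sub] at h2
    rw [abs_le]
    constructor <;> linarith [mul_pos (gaussDensity_pos d) (by have := neg_pos.2 h; positivity : 0 < 15 / (-d) ^ 7)]
  · rw [if_pos h, abs_of_pos h]
    obtain ⟨h1, h2⟩ := mills_bounds h
    have e : (1 / d - 1 / d ^ 3 + 3 / d ^ 5) = -millsSum d := by
      unfold millsSum; ring
    rw [e] at h1 h2
    rw [mul_sub, mul_neg] at h2
    rw [mul_neg] at h1
    rw [abs_le]
    constructor <;> linarith [mul_pos (gaussDensity_pos d) (by positivity : 0 < 15 / d ^ 7)]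

/-- Black-Scholes price in terms of the total standard deviation. -/
def bsTotal (k h : ℝ) : ℝ :=
  cdf (gaussianReal 0 1) (-k / h + h / 2) - Real.exp k * cdf (gaussianReal 0 1) (-k / h - h / 2)

theorem bsCall_eq_bsTotal (τ k σ : ℝ) : bsCall τ k σ = bsTotal k (σ * √τ) := rfl

/-- The squares of the two arguments d₊ and d₋ differ by 2k. Consequently both Black-Scholes terms
carry the same Gaussian factor, and the derivative in the total standard deviation collapses to it.
-/
theorem exp_mul_gaussDensity {h : ℝ} (k : ℝ) (hh : h ≠ 0) :
    Real.exp k * gaussDensity (-k / h - h / 2) = gaussDensity (-k / h + h / 2) := by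
  unfold gaussDensity
  rw [mul_left_comm, ← Real.exp_add]
  congr 2
  field_simp
  ring

theorem hasDerivAt_bsTotal (k : ℝ) {h : ℝ} (hh : 0 < h) :
    HasDerivAt (bsTotal k) (gaussDensity (-k / h + h / 2)) h := by
  have h1 : HasDerivAt (fun h : ℝ => -k / h) (k / h ^ 2) h := by
    refine (((hasDerivAt_id h).fun_inv hh.ne').const_mul (-k)).congr_deriv ?_ |>.congr_of_eventuallyEq
      (Eventually.of_forall fun x => by simp [div_eq_mul_inv])
    simp only [id_eq]
    ring
  have h2 : HasDerivAt (fun h : ℝ => h / 2) (1 / 2) h := (hasDerivAt_id h).div_const 2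
  have h3 := (hasDerivAt_cdf_gaussian (-k / h + h / 2)).comp h (h1.add h2)
  have h4 := ((hasDerivAt_cdf_gaussian (-k / h - h / 2)).comp h (h1.sub h2)).const_mul (Real.exp k)
  refine (h3.sub h4).congr_deriv ?_
  rw [← mul_assoc, exp_mul_gaussDensity k hh.ne']
  ring

theorem strictMonoOn_bsTotal (k : ℝ) : StrictMonoOn (bsTotal k) (Ioi 0) := by
  refine strictMonoOn_of_deriv_pos (convex_Ioi 0)
    (fun h hh => (hasDerivAt_bsTotal k hh).continuousAt.continuousWithinAt) fun h hh => ?_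
  rw [interior_Ioi] at hh
  rw [(hasDerivAt_bsTotal k hh).deriv]
  exact gaussDensity_pos _

/-- The contribution of the residues to the Black-Scholes price. -/
def bsResidue (k h : ℝ) : ℝ :=
  (if 0 < -k / h + h / 2 then 1 else 0) - Real.exp k * (if 0 < -k / h - h / 2 then 1 else 0)

theorem abs_bsTotal_sub_le {k h : ℝ} (hh : h ≠ 0) (h1 : -k / h + h / 2 ≠ 0)
    (h2 : -k / h - h / 2 ≠ 0) :
    |bsTotal k h - bsResidue k h - gaussDensity (-k / h + h / 2) *
        (millsSum (-k / h + h / 2) - millsSum (-k / h - h / 2))| ≤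
      gaussDensity (-k / h + h / 2) * (15 / |-k / h + h / 2| ^ 7 + 15 / |-k / h - h / 2| ^ 7) := by
  have e1 := abs_cdf_gaussian_sub_le h1
  have e2 := abs_cdf_gaussian_sub_le h2
  have e3 := exp_mul_gaussDensity k hh
  set d₁ := -k / h + h / 2
  set d₂ := -k / h - h / 2
  have e : bsTotal k h - bsResidue k h - gaussDensity d₁ * (millsSum d₁ - millsSum d₂) =
      (cdf (gaussianReal 0 1) d₁ - ((if 0 < d₁ then 1 else 0) + gaussDensity d₁ * millsSum d₁))
      - Real.exp k * (cdf (gaussianReal 0 1) d₂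
        - ((if 0 < d₂ then 1 else 0) + gaussDensity d₂ * millsSum d₂)) := by
    rw [bsTotal, bsResidue, ← e3]
    ring
  rw [e, mul_add]
  refine (abs_sub _ _).trans (add_le_add e1 ?_)
  rw [abs_mul, Real.abs_exp, ← e3, mul_assoc]
  gcongr

end FwdSmile

end

/-! ### Comparison of expansions -/

noncomputable section

namespace FwdSmile

/-- Moves a relative expansion 1 + χε + O(ε²) into the exponent, using z − 1 − 2(z − 1)² ≤ log z ≤ z
− 1 for z ≥ 1/2. The constant is explicit since it must be uniform in the variance for large
maturities. -/
theorem abs_log_sub_le {K X ε z χ : ℝ} (hε : 0 < ε) (hX : |χ| ≤ X)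
    (hz : |z - 1 - χ * ε| ≤ K * ε ^ 2) (hε1 : ε ≤ 1) (hε2 : (X + K) * ε ≤ 1 / 2) :
    0 < z ∧ |Real.log z - χ * ε| ≤ (K + 2 * (X + K) ^ 2) * ε ^ 2 := by
  have hK : 0 ≤ K := by
    have := (abs_nonneg _).trans hz
    by_contra h
    nlinarith [pow_pos hε 2]
  have h1 : |z - 1| ≤ (X + K) * ε := by
    calc |z - 1| = |(z - 1 - χ * ε) + χ * ε| := by ring_nf
      _ ≤ K * ε ^ 2 + X * ε := by
        refine (abs_add_le _ _).trans (add_le_add hz ?_)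
        rw [abs_mul, abs_of_pos hε]
        gcongr
      _ ≤ _ := by nlinarith [mul_nonneg hK (mul_nonneg hε.le (sub_nonneg.2 hε1))]
  have h2 := abs_le.1 (h1.trans hε2)
  have hz0 : 0 < z := by linarith [h2.1]
  refine ⟨hz0, ?_⟩
  have h3 := Real.log_le_sub_one_of_pos hz0
  have h4 := Real.one_sub_inv_le_log_of_pos hz0
  have h5 : (z - 1) - 2 * (z - 1) ^ 2 ≤ 1 - z⁻¹ := by
    have : 1 - z⁻¹ = (z - 1) / z := by field_simp
    rw [this, le_div_iff₀ hz0]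
    nlinarith [mul_nonneg (sq_nonneg (z - 1)) (by linarith [h2.1] : 0 ≤ 2 * z - 1)]
  have h6 : (z - 1) ^ 2 ≤ (X + K) ^ 2 * ε ^ 2 := by
    rw [← sq_abs, ← mul_pow]
    gcongr
  have h7 := abs_le.1 hz
  rw [abs_le]
  constructor <;> nlinarith [h7.1, h7.2, sq_nonneg (z - 1)]

/-- Second order Taylor bound for analytic functions. -/
theorem isBigO_taylor_one {f : ℝ → ℝ} {x f' : ℝ} (hf : AnalyticAt ℝ f x) (hd : HasDerivAt f f' x) :
    (fun s : ℝ => f (x + s) - f x - f' * s) =O[𝓝 0] fun s => s ^ 2 := by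
  obtain ⟨p, hp⟩ := hf
  have h := hp.isBigO_sub_partialSum_pow 2
  have h1 : p.coeff 0 = f x := hp.coeff_zero _
  have h2 : p.coeff 1 = f' := hp.hasDerivAt.unique hd
  refine (h.congr_left fun s => ?_).trans (Asymptotics.isBigO_of_le _ fun s => by simp)
  simp only [FormalMultilinearSeries.partialSum, Finset.sum_range_succ, Finset.sum_range_zero,
    zero_add, FormalMultilinearSeries.apply_eq_pow_smul_coeff, h1, h2, smul_eq_mul]
  ring

theorem exists_Icc_bound {f g : ℝ → ℝ} (h : f =O[𝓝 0] g) :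
    ∃ C ≥ 0, ∃ δ > 0, ∀ s : ℝ, |s| ≤ δ → |f s| ≤ C * |g s| := by
  obtain ⟨C, hC, h⟩ := h.exists_nonneg
  obtain ⟨δ, hδ, hb⟩ := Metric.eventually_nhds_iff.1 h.bound
  refine ⟨C, hC, δ / 2, by positivity, fun s hs => ?_⟩
  have := hb (y := s) (by rw [Real.dist_eq, sub_zero]; linarith)
  simpa using this

set_option maxHeartbeats 400000 in
/-- Comparison of two families with exponential expansions: a third order expansion of the parameter
for which they coincide. -/
theorem exists_bracket {f : ℝ → ℝ → ℝ} {c φ ψ χ : ℝ → ℝ}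
    {v₀ v₁ v₂ δ C s φ₀ φ₁ φ₂ ψ₁ α₀ α₁ ε₀ : ℝ} (hv₀ : 0 < v₀) (hδ : 0 < δ) (hε₀ : 0 < ε₀) (hs : s ≠ 0)
    (hf : ∀ ε ∈ Ioc 0 ε₀, ∀ V ∈ Icc (v₀ - δ) (v₀ + δ), ∃ ρ, |ρ| ≤ C * ε ^ 2 ∧
      f ε V = s * Real.exp (-φ V / ε + ψ V + χ V * ε + ρ))
    (hc : ∀ ε ∈ Ioc 0 ε₀, ∃ ρ, |ρ| ≤ C * ε ^ 2 ∧
      c ε = s * Real.exp (-φ₀ / ε + α₀ + α₁ * ε + ρ))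
    (hφ : (fun x => φ (v₀ + x) - φ₀ - φ₁ * x - φ₂ * x ^ 2) =O[𝓝 0] fun x : ℝ => x ^ 3)
    (hψ : (fun x => ψ (v₀ + x) - ψ v₀ - ψ₁ * x) =O[𝓝 0] fun x : ℝ => x ^ 2)
    (hχ : (fun x => χ (v₀ + x) - χ v₀) =O[𝓝 0] fun x : ℝ => x)
    (h1 : φ₁ ≠ 0) (e₀ : -φ₁ * v₁ + ψ v₀ - α₀ = 0)
    (e₁ : -φ₁ * v₂ - φ₂ * v₁ ^ 2 + ψ₁ * v₁ + χ v₀ - α₁ = 0)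
    (hmono : ∀ ε ∈ Ioc 0 ε₀, StrictMonoOn (f ε) (Ioi 0)) :
    ∃ K > 0, ∃ ε₁ > 0, ∀ ε ∈ Ioc 0 ε₁, 0 < v₀ + v₁ * ε + v₂ * ε ^ 2 - K * ε ^ 3 ∧
      f ε (v₀ + v₁ * ε + v₂ * ε ^ 2 - K * ε ^ 3) < c ε ∧
      c ε < f ε (v₀ + v₁ * ε + v₂ * ε ^ 2 + K * ε ^ 3) := by
  obtain ⟨C₃, hC₃, δ₃, hδ₃, h₃⟩ := exists_Icc_bound hφ
  obtain ⟨C₂, hC₂, δ₂, hδ₂, h₂⟩ := exists_Icc_bound hψ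
  obtain ⟨C₁, hC₁, δ₁, hδ₁, h₁⟩ := exists_Icc_bound hχ
  set T := |v₁| + |v₂| + 1 with hT
  have hT0 : 0 < T := by positivity
  set N := |φ₂| * ((|v₂| + 1) * (2 * T)) + C₃ * T ^ 3 + |ψ₁| * (|v₂| + 1) + C₂ * T ^ 2 + C₁ * T
    + 2 * |C| with hN
  have hN0 : 0 ≤ N := by positivity
  set m := min (min δ (v₀ / 2)) (min δ₁ (min δ₂ δ₃)) with hm
  have hm0 : 0 < m := by positivity
  -- The point is that N does not depend on x; only the admissible range of ε does. This permits
  -- choosing x = ±K in terms of N afterwards.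
  have key : ∀ x : ℝ, ∀ ε ∈ Ioc 0 (min (min ε₀ 1) (min (1 / (|x| + 1)) (m / T))),
      0 < v₀ + v₁ * ε + v₂ * ε ^ 2 + x * ε ^ 3 ∧
      ∃ E E' R : ℝ, f ε (v₀ + v₁ * ε + v₂ * ε ^ 2 + x * ε ^ 3) = s * Real.exp E ∧
      c ε = s * Real.exp E' ∧ |R| ≤ N * ε ^ 2 ∧ E - E' = -φ₁ * x * ε ^ 2 + R := by
    intro x ε hε
    have hε0 : 0 < ε := hε.1
    have hm1 := hε.2.trans (min_le_left _ _)
    have hm2 := hε.2.trans (min_le_right _ _)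
    have hεε : ε ∈ Ioc 0 ε₀ := ⟨hε0, hm1.trans (min_le_left _ _)⟩
    have hε1 : ε ≤ 1 := hm1.trans (min_le_right _ _)
    have hxε : |x| * ε ≤ 1 := by
      have := hm2.trans (min_le_left _ _)
      rw [le_div_iff₀ (by positivity)] at this
      nlinarith
    have hTε : T * ε ≤ m := by
      have := hm2.trans (min_le_right _ _)
      rw [le_div_iff₀ hT0] at this
      linarith
    set t := v₁ * ε + v₂ * ε ^ 2 + x * ε ^ 3 with ht
    have ht1 : |t - v₁ * ε| ≤ (|v₂| + 1) * ε ^ 2 := by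
      have : t - v₁ * ε = v₂ * ε ^ 2 + x * ε * ε ^ 2 := by rw [ht]; ring
      rw [this]
      refine (abs_add_le _ _).trans ?_
      rw [abs_mul, abs_mul, abs_mul, abs_of_pos hε0, abs_of_pos (pow_pos hε0 2), add_mul]
      gcongr
    have hε2 : ε ^ 2 ≤ ε := by nlinarith
    have ht2 : |t| ≤ T * ε := by
      have : |t| ≤ |t - v₁ * ε| + |v₁ * ε| := by
        calc |t| = |(t - v₁ * ε) + v₁ * ε| := by ring_nf
          _ ≤ _ := abs_add_le _ _
      rw [abs_mul, abs_of_pos hε0] at this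
      have h5 : (|v₂| + 1) * ε ^ 2 ≤ (|v₂| + 1) * ε := by gcongr
      rw [hT]
      linarith
    have ht3 : |t + v₁ * ε| ≤ 2 * T * ε := by
      refine (abs_add_le _ _).trans ?_
      rw [abs_mul, abs_of_pos hε0]
      have : |v₁| * ε ≤ T * ε := by
        gcongr
        rw [hT]; linarith [abs_nonneg v₂]
      linarith
    have htm : |t| ≤ m := ht2.trans hTε
    have b1 : m ≤ δ := (min_le_left _ _).trans (min_le_left _ _)
    have b2 : m ≤ v₀ / 2 := (min_le_left _ _).trans (min_le_right _ _)
    have b3 : m ≤ δ₁ := (min_le_right _ _).trans (min_le_left _ _)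
    have b4 : m ≤ δ₂ := (min_le_right _ _).trans ((min_le_right _ _).trans (min_le_left _ _))
    have b5 : m ≤ δ₃ := (min_le_right _ _).trans ((min_le_right _ _).trans (min_le_right _ _))
    have hV : v₀ + v₁ * ε + v₂ * ε ^ 2 + x * ε ^ 3 = v₀ + t := by rw [ht]; ring
    rw [hV]
    have htl := abs_le.1 htm
    refine ⟨by linarith [htl.1], ?_⟩
    obtain ⟨ρ, hρ, hfe⟩ := hf ε hεε (v₀ + t) ⟨by linarith [htl.1], by linarith [htl.2]⟩
    obtain ⟨ρ', hρ', hce⟩ := hc ε hεε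
    have r3 := h₃ t (htm.trans b5)
    have r2 := h₂ t (htm.trans b4)
    have r1 := h₁ t (htm.trans b3)
    set q3 := φ (v₀ + t) - φ₀ - φ₁ * t - φ₂ * t ^ 2 with hq3
    set q2 := ψ (v₀ + t) - ψ v₀ - ψ₁ * t with hq2
    set q1 := χ (v₀ + t) - χ v₀ with hq1
    refine ⟨_, _, -φ₂ * ((t - v₁ * ε) * (t + v₁ * ε) / ε) + -q3 / ε + ψ₁ * (t - v₁ * ε) + q2 + q1 * ε
      + (ρ - ρ'), hfe, hce, ?_, ?_⟩
    · have a1 : |-φ₂ * ((t - v₁ * ε) * (t + v₁ * ε) / ε)| ≤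
          |φ₂| * ((|v₂| + 1) * (2 * T)) * ε ^ 2 := by
        rw [abs_mul, abs_neg, mul_assoc, abs_div, abs_mul, abs_of_pos hε0]
        gcongr
        rw [div_le_iff₀ hε0]
        calc _ ≤ ((|v₂| + 1) * ε ^ 2) * (2 * T * ε) := by gcongr
          _ = _ := by ring
      have a2 : |-q3 / ε| ≤ C₃ * T ^ 3 * ε ^ 2 := by
        rw [abs_div, abs_neg, abs_of_pos hε0, div_le_iff₀ hε0]
        refine r3.trans ?_
        rw [abs_pow]
        calc C₃ * |t| ^ 3 ≤ C₃ * (T * ε) ^ 3 := by gcongr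
          _ = _ := by ring
      have a3 : |ψ₁ * (t - v₁ * ε)| ≤ |ψ₁| * (|v₂| + 1) * ε ^ 2 := by
        rw [abs_mul, mul_assoc]
        gcongr
      have a4 : |q2| ≤ C₂ * T ^ 2 * ε ^ 2 := by
        refine r2.trans ?_
        rw [abs_pow, mul_assoc, ← mul_pow]
        gcongr
      have a5 : |q1 * ε| ≤ C₁ * T * ε ^ 2 := by
        rw [abs_mul, abs_of_pos hε0]
        calc |q1| * ε ≤ (C₁ * (T * ε)) * ε := by
              gcongr
              exact r1.trans (by gcongr)
          _ = _ := by ring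
      have a6 : |ρ - ρ'| ≤ 2 * |C| * ε ^ 2 := by
        refine (abs_sub _ _).trans ?_
        have : C * ε ^ 2 ≤ |C| * ε ^ 2 := by gcongr; exact le_abs_self C
        linarith
      refine (abs_add_le _ _).trans ?_
      refine (add_le_add_left (abs_add_le _ _) _).trans ?_
      refine (add_le_add_left (add_le_add_left (abs_add_three _ _ _) _) _).trans ?_
      rw [hN]
      linarith [abs_add_le (-φ₂ * ((t - v₁ * ε) * (t + v₁ * ε) / ε)) (-q3 / ε)]
    · have p3 : φ (v₀ + t) = q3 + φ₀ + φ₁ * t + φ₂ * t ^ 2 := by rw [hq3]; ring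
      have p2 : ψ (v₀ + t) = q2 + ψ v₀ + ψ₁ * t := by rw [hq2]; ring
      have p1 : χ (v₀ + t) = q1 + χ v₀ := by rw [hq1]; ring
      rw [p3, p2, p1]
      have hE : -(q3 + φ₀ + φ₁ * t + φ₂ * t ^ 2) / ε = -q3 / ε - φ₀ / ε - φ₁ * (t / ε)
        - φ₂ * ((t - v₁ * ε) * (t + v₁ * ε) / ε) - φ₂ * v₁ ^ 2 * ε := by
        field_simp
        ring
      have hE2 : t / ε = v₁ + v₂ * ε + x * ε ^ 2 := by
        rw [ht]; field_simp
      rw [hE, hE2]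
      -- Order 1/ε cancels through the common φ₀, and `e₀`, `e₁` cancel the orders 1 and ε. At order
      -- ε² there remain −φ₁x and R.
      linear_combination e₀ + ε * e₁
  -- With this K the shift |φ₁|Kε² exceeds the error Nε² by ε².
  set K := (N + 1) / |φ₁| with hK
  have hφ1 : 0 < |φ₁| := abs_pos.2 h1
  have hK0 : 0 < K := by positivity
  refine ⟨K, hK0, min (min ε₀ 1) (min (1 / (|K| + 1)) (m / T)), by positivity, fun ε hε => ?_⟩
  have hε0 : 0 < ε := hε.1
  have hεε : ε ∈ Ioc 0 ε₀ := ⟨hε0, hε.2.trans ((min_le_left _ _).trans (min_le_left _ _))⟩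
  obtain ⟨hp, E, E', R, k1, k2, k3, k4⟩ := key K ε hε
  obtain ⟨hm', E₁, E₁', R₁, l1, l2, l3, l4⟩ := key (-K) ε (by rwa [abs_neg])
  rw [neg_mul, ← sub_eq_add_neg] at hm' l1
  refine ⟨hm', ?_⟩
  have hEE : E₁' = E' := by
    have := l2.symm.trans k2
    exact Real.exp_injective (mul_left_cancel₀ hs this)
  rw [hEE] at l4
  set fp := f ε (v₀ + v₁ * ε + v₂ * ε ^ 2 + K * ε ^ 3)
  set fm := f ε (v₀ + v₁ * ε + v₂ * ε ^ 2 - K * ε ^ 3)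
  have hlt : fm < fp := hmono ε hεε hm' hp (by
    have : 0 < K * ε ^ 3 := by positivity
    linarith)
  have hKφ : |φ₁| * K = N + 1 := by rw [hK]; field_simp
  have hε2 : 0 < ε ^ 2 := by positivity
  have k3' := abs_le.1 k3
  have l3' := abs_le.1 l3
  -- The signs of s and φ₁ are unknown, so first only opposite sides are established; monotonicity
  -- then decides which endpoint is the lower one.
  have hprod : (fp - c ε) * (fm - c ε) < 0 := by
    rw [k1, l1, k2]
    have : (s * Real.exp E - s * Real.exp E') * (s * Real.exp E₁ - s * Real.exp E') =
      s ^ 2 * ((Real.exp E - Real.exp E') * (Real.exp E₁ - Real.exp E')) := by ring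
    rw [this]
    refine mul_neg_of_pos_of_neg (by positivity) ?_
    rcases lt_or_gt_of_ne h1 with h | h
    · rw [abs_of_neg h] at hKφ
      have hK2 : -φ₁ * K * ε ^ 2 = N * ε ^ 2 + ε ^ 2 := by rw [hKφ]; ring
      have hK3 : -φ₁ * -K * ε ^ 2 = -(N * ε ^ 2 + ε ^ 2) := by rw [← hK2]; ring
      exact mul_neg_of_pos_of_neg (sub_pos.2 (Real.exp_lt_exp.2 (by linarith [k3'.1])))
        (sub_neg.2 (Real.exp_lt_exp.2 (by linarith [l3'.2])))
    · rw [abs_of_pos h] at hKφ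
      have hK2 : -φ₁ * K * ε ^ 2 = -(N * ε ^ 2 + ε ^ 2) := by rw [neg_mul, hKφ]; ring
      have hK3 : -φ₁ * -K * ε ^ 2 = N * ε ^ 2 + ε ^ 2 := by rw [neg_mul_neg, hKφ]; ring
      exact mul_neg_of_neg_of_pos (sub_neg.2 (Real.exp_lt_exp.2 (by linarith [k3'.2])))
        (sub_pos.2 (Real.exp_lt_exp.2 (by linarith [l3'.1])))
  rcases mul_neg_iff.1 hprod with ⟨h, h'⟩ | ⟨h, h'⟩
  · exact ⟨by linarith only [h'], by linarith only [h]⟩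
  · exact absurd hlt (by linarith only [h, h'])

/-- Existence, uniqueness and bounds for the implied volatility. -/
theorem implied_vol_of_bracket {τ k c V₁ V₂ : ℝ} (hτ : 0 < τ) (hV₁ : 0 < V₁)
    (h₁ : bsTotal k √(V₁ * τ) < c) (h₂ : c < bsTotal k √(V₂ * τ)) (hV : V₁ < V₂) :
    (∃! σ : ℝ, 0 < σ ∧ c = bsCall τ k σ) ∧
      V₁ ≤ sInf {σ : ℝ | 0 < σ ∧ c = bsCall τ k σ} ^ 2 ∧
      sInf {σ : ℝ | 0 < σ ∧ c = bsCall τ k σ} ^ 2 ≤ V₂ := by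
  have hV₂ : 0 < V₂ := hV₁.trans hV
  have hpos : ∀ {V : ℝ}, 0 < V → 0 < √(V * τ) := fun hV => Real.sqrt_pos.2 (by positivity)
  have hle : √(V₁ * τ) ≤ √(V₂ * τ) := Real.sqrt_le_sqrt (by gcongr)
  have hcont : ContinuousOn (bsTotal k) (Icc √(V₁ * τ) √(V₂ * τ)) := fun x hx =>
    (hasDerivAt_bsTotal k ((hpos hV₁).trans_le hx.1)).continuousAt.continuousWithinAt
  obtain ⟨h, hh, hhc⟩ := intermediate_value_Icc hle hcont ⟨h₁.le, h₂.le⟩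
  have hh0 : 0 < h := (hpos hV₁).trans_le hh.1
  have hτ' : 0 < √τ := Real.sqrt_pos.2 hτ
  set σ := h / √τ with hσ
  have hσ0 : 0 < σ := by positivity
  have hσh : σ * √τ = h := by rw [hσ]; field_simp
  have huniq : ∀ σ' : ℝ, 0 < σ' ∧ c = bsCall τ k σ' → σ' = σ := fun σ' ⟨h0, he⟩ => by
    have : σ' * √τ = h := (strictMonoOn_bsTotal k).injOn (mul_pos h0 hτ') hh0
      (by rw [← bsCall_eq_bsTotal, ← he, hhc])
    rw [hσ, ← this]
    field_simp
  have hmem : 0 < σ ∧ c = bsCall τ k σ := ⟨hσ0, by rw [bsCall_eq_bsTotal, hσh, hhc]⟩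
  refine ⟨⟨σ, hmem, huniq⟩, ?_⟩
  have hset : {σ : ℝ | 0 < σ ∧ c = bsCall τ k σ} = {σ} := by
    ext x
    exact ⟨huniq x, fun hx => by rw [mem_singleton_iff.1 hx]; exact hmem⟩
  rw [hset, csInf_singleton]
  have hsq : σ ^ 2 * τ = h ^ 2 := by rw [← hσh, mul_pow, Real.sq_sqrt hτ.le]
  constructor
  · have : V₁ * τ ≤ h ^ 2 := by
      rw [← Real.sq_sqrt (by positivity : 0 ≤ V₁ * τ)]
      exact pow_le_pow_left₀ (Real.sqrt_nonneg _) hh.1 2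
    rw [← hsq] at this
    exact le_of_mul_le_mul_right this hτ
  · have : h ^ 2 ≤ V₂ * τ := by
      rw [← Real.sq_sqrt (by positivity : 0 ≤ V₂ * τ)]
      exact pow_le_pow_left₀ hh0.le hh.2 2
    rw [← hsq] at this
    exact le_of_mul_le_mul_right this hτ

end FwdSmile

end

/-! ### Expansions of the Black-Scholes price -/

noncomputable section

namespace FwdSmile

/-- The correction in the small maturity expansion of the Black-Scholes price. -/
theorem isBigO_small_maturity {k : ℝ} (hk : k ≠ 0) :
    (fun y : ℝ => Real.exp (-y / 8) * (1 / (k ^ 2 - y ^ 2 / 4)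
        - y * ((3 * k ^ 2 + y ^ 2 / 4) / (k ^ 2 - y ^ 2 / 4) ^ 3
          - 3 * y * (5 * k ^ 4 + 5 / 2 * k ^ 2 * y ^ 2 + y ^ 4 / 16) / (k ^ 2 - y ^ 2 / 4) ^ 5))
      - 1 / k ^ 2 - -(1 / 8 + 3 / k ^ 2) / k ^ 2 * y) =O[𝓝 0] fun y => y ^ 2 := by
  set P : ℝ → ℝ := fun y => k ^ 2 - y ^ 2 / 4 with hP
  set g : ℝ → ℝ := fun y => (3 * k ^ 2 + y ^ 2 / 4) / P y ^ 3
          - 3 * y * (5 * k ^ 4 + 5 / 2 * k ^ 2 * y ^ 2 + y ^ 4 / 16) / P y ^ 5 with hg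
  have hP0 : P 0 ≠ 0 := by simpa [hP] using hk
  have hPa : AnalyticAt ℝ P 0 := by simp only [hP]; fun_prop
  have hga : AnalyticAt ℝ g 0 := by
    simp only [hg]
    refine AnalyticAt.sub (AnalyticAt.div (by fun_prop) (by fun_prop) (pow_ne_zero _ hP0))
      (AnalyticAt.div (by fun_prop) (by fun_prop) (pow_ne_zero _ hP0))
  have hPd : HasDerivAt P 0 0 := by
    have := ((hasDerivAt_pow 2 (0 : ℝ)).div_const 4).const_sub (k ^ 2)
    simpa [hP] using this
  have hd : HasDerivAt (fun y : ℝ => Real.exp (-y / 8) * (1 / P y - y * g y))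
      (-(1 / 8 + 3 / k ^ 2) / k ^ 2) 0 := by
    have h1 : HasDerivAt (fun y : ℝ => Real.exp (-y / 8)) (Real.exp (-0 / 8) * (-1 / 8)) 0 :=
      ((hasDerivAt_neg (0 : ℝ)).div_const 8).exp
    have h2 : HasDerivAt (fun y : ℝ => 1 / P y) (-0 / P 0 ^ 2) 0 := by
      simpa only [one_div] using hPd.fun_inv hP0
    have h3 : HasDerivAt (fun y : ℝ => y * g y) (1 * g 0 + 0 * deriv g 0) 0 :=
      (hasDerivAt_id (0 : ℝ)).mul hga.differentiableAt.hasDerivAt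
    refine (h1.mul (h2.sub h3)).congr_deriv ?_
    simp only [hg, hP, Pi.sub_apply]
    norm_num
    field_simp
    ring
  have ha : AnalyticAt ℝ (fun y : ℝ => Real.exp (-y / 8) * (1 / P y - y * g y)) 0 := by
    refine AnalyticAt.mul (by fun_prop) (AnalyticAt.sub (AnalyticAt.div (by fun_prop) hPa hP0) ?_)
    exact analyticAt_id.mul hga
  have := isBigO_taylor_one ha hd
  simpa [hP] using this

theorem gaussDensity_div (k : ℝ) {y : ℝ} (hy : 0 < y) :
    gaussDensity (-k / √y + √y / 2) =
      (√(2 * Real.pi))⁻¹ * Real.exp (-((k - y / 2) ^ 2 / (2 * y))) := by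
  have h : √y ^ 2 = y := Real.sq_sqrt hy.le
  have hs : √y ≠ 0 := (Real.sqrt_pos.2 hy).ne'
  unfold gaussDensity
  congr 3
  have : (-k / √y + √y / 2) = -(k - y / 2) / √y := by
    nth_rewrite 3 [← h]
    field_simp
    ring
  rw [this, div_pow, neg_sq, h]
  field_simp

/-- Black-Scholes price for small total variance `y`. -/
theorem bsTotal_small_maturity {k : ℝ} (hk : k ≠ 0) :
    ∃ C : ℝ, ∃ y₁ > 0, ∀ y ∈ Ioc 0 y₁,
      bsResidue k √y = (if k < 0 then 1 - Real.exp k else 0) ∧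
      ∃ ρ, |ρ| ≤ C * y ^ 2 ∧ bsTotal k √y - bsResidue k √y = y * √y / √(2 * Real.pi) *
        Real.exp (-(k ^ 2 / (2 * y)) + k / 2 - Real.log (k ^ 2) + -(1 / 8 + 3 / k ^ 2) * y + ρ) := by
  obtain ⟨C, hC, δ, hδ, hb⟩ := exists_Icc_bound (isBigO_small_maturity hk)
  have hk0 : 0 < |k| := abs_pos.2 hk
  have hk2 : 0 < k ^ 2 := by positivity
  set K := k ^ 2 * (C + 30 / (|k| / 2) ^ 7) with hK
  set X := 1 / 8 + 3 / k ^ 2 with hX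
  have hK0 : 0 ≤ K := by positivity
  have hX0 : 0 < X := by positivity
  refine ⟨K + 2 * (X + K) ^ 2, min (min δ |k|) (min 1 (1 / (2 * (X + K)))), by positivity,
    fun y hy => ?_⟩
  have hy0 : 0 < y := hy.1
  have hyδ : y ≤ δ := hy.2.trans ((min_le_left _ _).trans (min_le_left _ _))
  have hyk : y ≤ |k| := hy.2.trans ((min_le_left _ _).trans (min_le_right _ _))
  have hy1 : y ≤ 1 := hy.2.trans ((min_le_right _ _).trans (min_le_left _ _))
  have hyX : (X + K) * y ≤ 1 / 2 := by
    have := hy.2.trans ((min_le_right _ _).trans (min_le_right _ _))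
    rw [le_div_iff₀ (by positivity)] at this
    linarith
  set h := √y with hh
  have hh0 : 0 < h := Real.sqrt_pos.2 hy0
  have hhy : h ^ 2 = y := Real.sq_sqrt hy0.le
  -- In these terms d₊ = −p/h and d₋ = −m/h. For y ≤ |k| both p and m have the sign of k and modulus
  -- at least |k|/2, which settles the residues and the size of the Mills errors.
  set p := k - y / 2 with hp
  set m := k + y / 2 with hm
  have hp1 : |k| / 2 ≤ |p| := by
    have := abs_sub_abs_le_abs_sub k (y / 2)
    rw [abs_of_pos (by positivity : 0 < y / 2)] at this
    linarith
  have hm1 : |k| / 2 ≤ |m| := by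
    have := abs_sub_abs_le_abs_sub k (-(y / 2))
    rw [abs_neg, abs_of_pos (by positivity : 0 < y / 2), sub_neg_eq_add] at this
    linarith
  have hp0 : p ≠ 0 := abs_pos.1 (by linarith)
  have hm0 : m ≠ 0 := abs_pos.1 (by linarith)
  have d1 : -k / h + h / 2 = -p / h := by
    rw [hp, ← hhy]; field_simp; ring
  have d2 : -k / h - h / 2 = -m / h := by
    rw [hm, ← hhy]; field_simp; ring
  have hres : bsResidue k h = (if k < 0 then 1 - Real.exp k else 0) := by
    rw [bsResidue, d1, d2]
    rcases lt_or_gt_of_ne hk with hk' | hk'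
    · rw [abs_of_neg hk'] at hyk
      rw [if_pos (div_pos (by linarith) hh0), if_pos (div_pos (by linarith) hh0), if_pos hk', mul_one]
    · rw [abs_of_pos hk'] at hyk
      rw [if_neg (div_neg_of_neg_of_pos (by linarith) hh0).not_gt,
        if_neg (div_neg_of_neg_of_pos (by linarith) hh0).not_gt, if_neg hk'.not_gt]
      simp
  refine ⟨hres, ?_⟩
  have hmain := abs_bsTotal_sub_le (k := k) hh0.ne' (by rw [d1]; simp [hp0, hh0.ne'])
    (by rw [d2]; simp [hm0, hh0.ne'])
  have hg := gaussDensity_div k hy0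
  rw [← hh] at hg
  set n := gaussDensity (-k / h + h / 2) with hn
  have hn0 : 0 < n := gaussDensity_pos _
  rw [d1, d2] at hmain
  set B := bsTotal k h - bsResidue k h with hB
  set R := 1 / (k ^ 2 - y ^ 2 / 4)
        - y * ((3 * k ^ 2 + y ^ 2 / 4) / (k ^ 2 - y ^ 2 / 4) ^ 3
          - 3 * y * (5 * k ^ 4 + 5 / 2 * k ^ 2 * y ^ 2 + y ^ 4 / 16) / (k ^ 2 - y ^ 2 / 4) ^ 5) with hR
  have hmills : millsSum (-p / h) - millsSum (-m / h) = y * h * R := by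
    have hpm : k ^ 2 - y ^ 2 / 4 = p * m := by rw [hp, hm]; ring
    have e1 : millsSum (-p / h) = h / p - h ^ 3 / p ^ 3 + 3 * h ^ 5 / p ^ 5 := by
      unfold millsSum; field_simp; ring
    have e2 : millsSum (-m / h) = h / m - h ^ 3 / m ^ 3 + 3 * h ^ 5 / m ^ 5 := by
      unfold millsSum; field_simp; ring
    rw [hR, hpm, e1, e2, show h ^ 3 = h * y by rw [← hhy]; ring,
      show h ^ 5 = h * y ^ 2 by rw [← hhy]; ring]
    have hkk : k = (p + m) / 2 := by rw [hp, hm]; ring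
    have hyy : y = m - p := by rw [hp, hm]; ring
    rw [hkk, hyy]
    field_simp
    ring
  rw [hmills] at hmain
  set r := B / (n * (y * h)) - R with hr
  have hr1 : |r| ≤ 30 / (|k| / 2) ^ 7 * y ^ 2 := by
    have e : r = (B - n * (y * h * R)) / (n * (y * h)) := by
      rw [hr]; field_simp
    rw [e, abs_div, abs_of_pos (by positivity : 0 < n * (y * h)), div_le_iff₀ (by positivity)]
    refine hmain.trans ?_
    rw [abs_div, abs_div, abs_neg, abs_neg, abs_of_pos hh0]
    have f1 : ∀ x : ℝ, |k| / 2 ≤ |x| → 15 / (|x| / h) ^ 7 ≤ 15 / (|k| / 2) ^ 7 * h ^ 7 := by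
      intro x hx
      rw [div_pow, ← div_mul, mul_comm_div, ← mul_div_assoc, div_mul_eq_mul_div]
      gcongr
    calc n * (15 / (|p| / h) ^ 7 + 15 / (|m| / h) ^ 7)
        ≤ n * (15 / (|k| / 2) ^ 7 * h ^ 7 + 15 / (|k| / 2) ^ 7 * h ^ 7) := by
          gcongr <;> apply f1 <;> assumption
      _ = 30 / (|k| / 2) ^ 7 * y ^ 2 * (n * (y * h)) := by
          rw [← hhy]; ring
  have hby := hb y (by rwa [abs_of_pos hy0])
  rw [← hR, abs_of_pos (by positivity : 0 < y ^ 2)] at hby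
  -- The factor e^{−y/8} comes from (k − y/2)²/(2y) = k²/(2y) − k/2 + y/8, and k² normalises the
  -- limit at y = 0 to 1.
  set z := k ^ 2 * (Real.exp (-y / 8) * (R + r)) with hz
  have hz1 : |z - 1 - -X * y| ≤ K * y ^ 2 := by
    have e : z - 1 - -X * y = k ^ 2 * ((Real.exp (-y / 8) * R - 1 / k ^ 2 - -X / k ^ 2 * y)
      + Real.exp (-y / 8) * r) := by
      rw [hz]; field_simp; ring
    rw [e, abs_mul, abs_of_pos hk2, hK, mul_assoc, add_mul]
    gcongr
    refine (abs_add_le _ _).trans (add_le_add hby ?_)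
    rw [abs_mul, Real.abs_exp]
    have : Real.exp (-y / 8) ≤ 1 := Real.exp_le_one_iff.2 (by linarith)
    calc _ ≤ 1 * |r| := by gcongr
      _ ≤ _ := by rw [one_mul]; exact hr1
  obtain ⟨hz0, hlog⟩ := abs_log_sub_le hy0 (by rw [abs_neg, abs_of_pos hX0]) hz1 hy1 hyX
  refine ⟨Real.log z - -X * y, hlog, ?_⟩
  rw [show -(k ^ 2 / (2 * y)) + k / 2 - Real.log (k ^ 2) + -X * y + (Real.log z - -X * y) =
    (-(k ^ 2 / (2 * y)) + k / 2 - Real.log (k ^ 2)) + Real.log z by ring, Real.exp_add,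
    Real.exp_log hz0, Real.exp_sub, Real.exp_log hk2, hz]
  have hBn : B = n * (y * h) * (R + r) := by rw [hr]; field_simp; ring
  have hexp : Real.exp (-((k - y / 2) ^ 2 / (2 * y))) =
      Real.exp (-(k ^ 2 / (2 * y)) + k / 2) * Real.exp (-y / 8) := by
    rw [← Real.exp_add]
    congr 1
    field_simp
    ring
  rw [hBn, hg, ← hp, hexp]
  field_simp

set_option maxHeartbeats 800000 in
/-- Black-Scholes price for large maturities `1 / ε`, with variance `V` near `v`. -/
theorem bsTotal_large_maturity {k v s : ℝ} (hv : 0 < v) (hs : s = 1 ∨ s = -1)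
    (hkv : 0 < s * (4 * k ^ 2 - v ^ 2)) :
    ∃ C : ℝ, ∃ δ > 0, ∃ ε₁ > 0, ∀ ε ∈ Ioc 0 ε₁, ∀ V ∈ Icc (v - δ) (v + δ),
      bsResidue (k / ε) √(V / ε) =
        (if 2 * k < v then 1 else 0) - Real.exp (k / ε) * (if v < -2 * k then 1 else 0) ∧
      ∃ ρ, |ρ| ≤ C * ε ^ 2 ∧ bsTotal (k / ε) √(V / ε) - bsResidue (k / ε) √(V / ε) =
        √ε / √(2 * Real.pi) * (s * Real.exp (-((k - V / 2) ^ 2 / (2 * V)) / ε +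
          (Real.log 4 + 3 / 2 * Real.log V - Real.log (s * (4 * k ^ 2 - V ^ 2)))
          + -(4 * V * (12 * k ^ 2 + V ^ 2) / (4 * k ^ 2 - V ^ 2) ^ 2) * ε + ρ)) := by
  have hfac : 4 * k ^ 2 - v ^ 2 = (2 * k - v) * (2 * k + v) := by ring
  have hne : (2 * k - v) * (2 * k + v) ≠ 0 := by
    rw [← hfac]
    rintro h
    rw [h] at hkv
    simp at hkv
  have hn1 : 0 < |2 * k - v| := abs_pos.2 (left_ne_zero_of_mul hne)
  have hn2 : 0 < |2 * k + v| := abs_pos.2 (right_ne_zero_of_mul hne)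
  -- For |V − v| ≤ δ the quantities 2k ∓ V keep a fixed sign and a fixed distance from 0, so the
  -- residue indicators are those at v and all estimates are uniform in V.
  set δ := min v (min |2 * k - v| |2 * k + v|) / 2 with hδ
  have hδ0 : 0 < δ := by positivity
  have b1 : 2 * δ ≤ v := by rw [hδ]; linarith [min_le_left v (min |2 * k - v| |2 * k + v|)]
  have b2 : 2 * δ ≤ |2 * k - v| := by
    rw [hδ]
    linarith [min_le_right v (min |2 * k - v| |2 * k + v|), min_le_left |2 * k - v| |2 * k + v|]
  have b3 : 2 * δ ≤ |2 * k + v| := by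
    rw [hδ]
    linarith [min_le_right v (min |2 * k - v| |2 * k + v|), min_le_right |2 * k - v| |2 * k + v|]
  set κ := δ / 2 with hκ
  have hκ0 : 0 < κ := by positivity
  set Q := |k| + v with hQ
  have hQ0 : 0 < Q := by positivity
  set K := (6 / κ ^ 5 + 30 / κ ^ 7 * (2 * v)) * (2 * v) ^ 2 * (Q * Q / (v / 2)) with hK
  set X := 4 * (2 * v) * (12 * k ^ 2 + (2 * v) ^ 2) / (16 * κ ^ 4) with hX
  have hK0 : 0 < K := by positivity
  have hX0 : 0 < X := by positivity
  refine ⟨K + 2 * (X + K) ^ 2, δ, hδ0, min 1 (1 / (2 * (X + K))), by positivity,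
    fun ε hε V hV => ?_⟩
  have hε0 : 0 < ε := hε.1
  have hε1 : ε ≤ 1 := hε.2.trans (min_le_left _ _)
  have hεX : (X + K) * ε ≤ 1 / 2 := by
    have := hε.2.trans (min_le_right _ _)
    rw [le_div_iff₀ (by positivity)] at this
    linarith
  have hV1 : v / 2 ≤ V := by linarith [hV.1]
  have hV2 : V ≤ 2 * v := by linarith [hV.2]
  have hV0 : 0 < V := by linarith
  have hVv : |v - V| ≤ δ := by rw [abs_le]; constructor <;> linarith [hV.1, hV.2]
  set p := k - V / 2 with hp
  set m := k + V / 2 with hm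
  have hp1 : κ ≤ |p| := by
    have e2 : |2 * k - v| ≤ |2 * p| + |v - V| := by
      calc |2 * k - v| = |2 * p - (v - V)| := by rw [hp]; ring_nf
        _ ≤ _ := abs_sub _ _
    rw [abs_mul, abs_two] at e2
    rw [hκ]; linarith
  have hm1 : κ ≤ |m| := by
    have e2 : |2 * k + v| ≤ |2 * m| + |v - V| := by
      calc |2 * k + v| = |2 * m + (v - V)| := by rw [hm]; ring_nf
        _ ≤ _ := abs_add_le _ _
    rw [abs_mul, abs_two] at e2
    rw [hκ]; linarith
  have hp0 : p ≠ 0 := abs_pos.1 (by linarith)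
  have hm0 : m ≠ 0 := abs_pos.1 (by linarith)
  have hpQ : |p| ≤ Q := by
    rw [hp, hQ]
    refine (abs_sub _ _).trans ?_
    rw [abs_of_pos (by positivity : 0 < V / 2)]
    linarith
  have hmQ : |m| ≤ Q := by
    rw [hm, hQ]
    refine (abs_add_le _ _).trans ?_
    rw [abs_of_pos (by positivity : 0 < V / 2)]
    linarith
  have hpm : 4 * k ^ 2 - V ^ 2 = 4 * (p * m) := by rw [hp, hm]; ring
  set y := V * ε with hy
  have hy0 : 0 < y := by positivity
  set h := √y with hh
  have hh0 : 0 < h := Real.sqrt_pos.2 hy0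
  have hhy : h ^ 2 = y := Real.sq_sqrt hy0.le
  set H := √(V / ε) with hH
  have hH0 : 0 < H := Real.sqrt_pos.2 (by positivity)
  -- Log-strike k/ε and total deviation h/ε give d₊ = −p/h and d₋ = −m/h with h = √(Vε), so both
  -- arguments grow like ε^{−1/2}.
  have hHh : H = h / ε := by
    rw [hH, hh, hy]
    rw [show V / ε = V * ε / ε ^ 2 by field_simp, Real.sqrt_div (by positivity), Real.sqrt_sq hε0.le]
  have hHV : V = h ^ 2 / ε := by rw [hhy, hy]; field_simp
  have d1 : -(k / ε) / H + H / 2 = -p / h := by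
    rw [hp, hHh, hHV]; field_simp; ring
  have d2 : -(k / ε) / H - H / 2 = -m / h := by
    rw [hm, hHh, hHV]; field_simp; ring
  have hres : bsResidue (k / ε) H =
      (if 2 * k < v then 1 else 0) - Real.exp (k / ε) * (if v < -2 * k then 1 else 0) := by
    rw [bsResidue, d1, d2]
    have i1 : 0 < -p / h ↔ 2 * k < v := by
      rw [div_pos_iff_of_pos_right hh0]
      rcases lt_or_ge (2 * k) v with hc | hc
      · rw [abs_of_neg (by linarith)] at b2
        exact ⟨fun _ => hc, fun _ => by rw [hp]; linarith [hV.1]⟩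
      · rw [abs_of_nonneg (by linarith)] at b2
        exact ⟨fun h' => by rw [hp] at h'; linarith [hV.2], fun h' => by linarith⟩
    have i2 : 0 < -m / h ↔ v < -2 * k := by
      rw [div_pos_iff_of_pos_right hh0]
      rcases lt_or_ge (2 * k + v) 0 with hc | hc
      · rw [abs_of_neg hc] at b3
        exact ⟨fun _ => by linarith, fun _ => by rw [hm]; linarith [hV.2]⟩
      · rw [abs_of_nonneg hc] at b3
        exact ⟨fun h' => by rw [hm] at h'; linarith [hV.1], fun h' => by linarith⟩
    simp only [i1, i2]
  refine ⟨hres, ?_⟩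
  have hmain := abs_bsTotal_sub_le (k := k / ε) hH0.ne' (by rw [d1]; simp [hp0, hh0.ne'])
    (by rw [d2]; simp [hm0, hh0.ne'])
  rw [d1, d2] at hmain
  set n := gaussDensity (-p / h) with hn
  have hn0 : 0 < n := gaussDensity_pos _
  have hg : n = (√(2 * Real.pi))⁻¹ * Real.exp (-(p ^ 2 / (2 * V)) / ε) := by
    rw [hn, gaussDensity, div_pow, hhy, hy, neg_sq]
    congr 2
    field_simp
  set B := bsTotal (k / ε) H - bsResidue (k / ε) H with hB
  set χ := -(4 * V * (12 * k ^ 2 + V ^ 2) / (4 * k ^ 2 - V ^ 2) ^ 2) with hχ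
  -- The first two Mills terms give V/(pm) and its relative correction χε; the third is already
  -- O(ε²) and is moved to the error below.
  set R := V / (p * m) * (1 + χ * ε) + 3 * y ^ 2 * (1 / p ^ 5 - 1 / m ^ 5) with hR
  have hmills : millsSum (-p / h) - millsSum (-m / h) = h * R := by
    have e1 : millsSum (-p / h) = h / p - h ^ 3 / p ^ 3 + 3 * h ^ 5 / p ^ 5 := by
      unfold millsSum; field_simp; ring
    have e2 : millsSum (-m / h) = h / m - h ^ 3 / m ^ 3 + 3 * h ^ 5 / m ^ 5 := by
      unfold millsSum; field_simp; ring
    rw [hR, hχ, hpm, e1, e2, show h ^ 3 = h * y by rw [← hhy]; ring,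
      show h ^ 5 = h * y ^ 2 by rw [← hhy]; ring, hy]
    have hkk : k = (p + m) / 2 := by rw [hp, hm]; ring
    have hyy : V = m - p := by rw [hp, hm]; ring
    rw [hkk, hyy]
    field_simp
    ring
  rw [hmills] at hmain
  set r := B / (n * h) - R with hr
  have hr1 : |r| ≤ 30 / κ ^ 7 * y ^ 3 := by
    have e : r = (B - n * (h * R)) / (n * h) := by
      rw [hr]; field_simp
    rw [e, abs_div, abs_of_pos (by positivity : 0 < n * h), div_le_iff₀ (by positivity)]
    refine hmain.trans ?_
    rw [abs_div, abs_div, abs_neg, abs_neg, abs_of_pos hh0]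
    have f1 : ∀ x : ℝ, κ ≤ |x| → 15 / (|x| / h) ^ 7 ≤ 15 / κ ^ 7 * h ^ 7 := by
      intro x hx
      rw [div_pow, ← div_mul, mul_comm_div, ← mul_div_assoc, div_mul_eq_mul_div]
      gcongr
    calc n * (15 / (|p| / h) ^ 7 + 15 / (|m| / h) ^ 7)
        ≤ n * (15 / κ ^ 7 * h ^ 7 + 15 / κ ^ 7 * h ^ 7) := by
          gcongr <;> apply f1 <;> assumption
      _ = 30 / κ ^ 7 * y ^ 3 * (n * h) := by
          rw [← hhy]; ring
  have hχX : |χ| ≤ X := by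
    rw [hχ, abs_neg, hpm, abs_div, abs_of_pos (by positivity), abs_of_nonneg (by positivity), hX,
      show (4 * (p * m)) ^ 2 = 16 * (|p| ^ 2 * |m| ^ 2) by rw [sq_abs, sq_abs]; ring,
      show κ ^ 4 = κ ^ 2 * κ ^ 2 by ring]
    gcongr
  set z := (R + r) * (p * m / V) with hz
  have hz1 : |z - 1 - χ * ε| ≤ K * ε ^ 2 := by
    have e : z - 1 - χ * ε = (3 * y ^ 2 * (1 / p ^ 5 - 1 / m ^ 5) + r) * (p * m / V) := by
      rw [hz, hR]; field_simp; ring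
    have hy2 : y ≤ 2 * v * ε := by rw [hy]; gcongr
    have hyv : y ≤ 2 * v := hy2.trans (mul_le_of_le_one_right (by positivity) hε1)
    have f2 : ∀ x : ℝ, κ ≤ |x| → |1 / x ^ 5| ≤ 1 / κ ^ 5 := fun x hx => by
      rw [abs_div, abs_one, abs_pow]
      gcongr
    have f3 : |3 * y ^ 2 * (1 / p ^ 5 - 1 / m ^ 5)| ≤ 6 / κ ^ 5 * y ^ 2 := by
      rw [abs_mul, abs_of_pos (by positivity)]
      calc _ ≤ 3 * y ^ 2 * (1 / κ ^ 5 + 1 / κ ^ 5) := by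
            gcongr
            exact (abs_sub _ _).trans (add_le_add (f2 p hp1) (f2 m hm1))
        _ = _ := by ring
    have f4 : |r| ≤ 30 / κ ^ 7 * (2 * v) * y ^ 2 := by
      refine hr1.trans ?_
      rw [mul_assoc]
      gcongr
      rw [pow_succ, mul_comm]
      exact mul_le_mul_of_nonneg_right hyv (sq_nonneg y)
    rw [e, abs_mul, abs_div, abs_mul, abs_of_pos hV0]
    calc _ ≤ (6 / κ ^ 5 * y ^ 2 + 30 / κ ^ 7 * (2 * v) * y ^ 2) * (Q * Q / (v / 2)) := by
          gcongr
          exact (abs_add_le _ _).trans (add_le_add f3 f4)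
      _ = (6 / κ ^ 5 + 30 / κ ^ 7 * (2 * v)) * y ^ 2 * (Q * Q / (v / 2)) := by ring
      _ ≤ (6 / κ ^ 5 + 30 / κ ^ 7 * (2 * v)) * (2 * v * ε) ^ 2 * (Q * Q / (v / 2)) :=
          mul_le_mul_of_nonneg_right (mul_le_mul_of_nonneg_left (pow_le_pow_left₀ hy0.le hy2 2)
            (by positivity)) (by positivity)
      _ = _ := by rw [hK]; ring
  clear_value K X κ Q δ R χ
  obtain ⟨hz0, hlog⟩ := abs_log_sub_le hε0 hχX hz1 hε1 hεX
  refine ⟨Real.log z - χ * ε, hlog, ?_⟩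
  have hsV : 0 < s * (4 * k ^ 2 - V ^ 2) := by
    have hs2 : s * s = 1 := by rcases hs with rfl | rfl <;> norm_num
    have sgn : ∀ a b : ℝ, 2 * δ ≤ |a| → |a - b| ≤ δ → 0 < a * b := by
      intro a b ha hab
      rw [abs_le] at hab
      rcases le_total 0 a with h0 | h0
      · rw [abs_of_nonneg h0] at ha
        exact mul_pos (by linarith) (by linarith [hab.2])
      · rw [abs_of_nonpos h0] at ha
        exact mul_pos_of_neg_of_neg (by linarith) (by linarith [hab.1])
    have s1 := sgn (2 * k - v) (2 * p) b2 (by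
      rw [show 2 * k - v - 2 * p = -(v - V) by rw [hp]; ring, abs_neg]; exact hVv)
    have s2 := sgn (2 * k + v) (2 * m) b3 (by
      rw [show 2 * k + v - 2 * m = v - V by rw [hm]; ring]; exact hVv)
    have s3 : 0 < (s * (4 * k ^ 2 - v ^ 2)) * (s * (4 * k ^ 2 - V ^ 2)) := by
      have : (s * (4 * k ^ 2 - v ^ 2)) * (s * (4 * k ^ 2 - V ^ 2)) =
          (s * s) * (((2 * k - v) * (2 * p)) * ((2 * k + v) * (2 * m))) := by
        rw [hpm, hfac]; ring
      rw [this, hs2, one_mul]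
      exact mul_pos s1 s2
    exact (pos_iff_pos_of_mul_pos s3).1 hkv
  rw [show -(p ^ 2 / (2 * V)) / ε +
          (Real.log 4 + 3 / 2 * Real.log V - Real.log (s * (4 * k ^ 2 - V ^ 2)))
          + χ * ε + (Real.log z - χ * ε) = -(p ^ 2 / (2 * V)) / ε +
          (Real.log 4 + (Real.log V + Real.log V / 2) - Real.log (s * (4 * k ^ 2 - V ^ 2)))
          + Real.log z by ring, Real.exp_add, Real.exp_log hz0, Real.exp_add, Real.exp_sub,
    Real.exp_add, Real.exp_add, Real.exp_log (by norm_num), Real.exp_log hV0, Real.exp_log hsV,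
    ← Real.log_sqrt hV0.le, Real.exp_log (Real.sqrt_pos.2 hV0)]
  have hBn : B = n * h * (R + r) := by rw [hr]; field_simp; ring
  have hhs : h = √V * √ε := by rw [hh, hy, Real.sqrt_mul hV0.le]
  have hs0 : s ≠ 0 := by rintro rfl; simp at hsV
  rw [hBn, hg, hz, hpm, hhs]
  field_simp

end FwdSmile

end

/-! ### Expansion of call prices -/

noncomputable section

namespace FwdSmile

/-! ### Tangents and the Legendre transform at the saddlepoint. -/

section Convexity

variable {D : Set ℝ} {Λ : Fin 3 → ℝ → ℝ}

/-- A strictly convex function lies strictly above its tangents. -/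
theorem tangent_lt {f : ℝ → ℝ} (hf : StrictConvexOn ℝ D f) {x y : ℝ} (hx : x ∈ D) (hy : y ∈ D)
    (hd : DifferentiableAt ℝ f x) (hxy : x ≠ y) : f x + deriv f x * (y - x) < f y := by
  rcases lt_or_gt_of_ne hxy with h | h
  · have := hf.lt_slope_of_hasDerivAt hx hy h hd.hasDerivAt
    rw [slope_def_field, lt_div_iff₀ (sub_pos.2 h)] at this
    linarith
  · have := hf.slope_lt_of_hasDerivAt hy hx h hd.hasDerivAt
    rw [slope_def_field, div_lt_iff₀ (sub_pos.2 h)] at this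
    linarith

theorem deriv_lt_deriv {f : ℝ → ℝ} (hf : StrictConvexOn ℝ D f) {x y : ℝ} (hx : x ∈ D) (hy : y ∈ D)
    (hdx : DifferentiableAt ℝ f x) (hdy : DifferentiableAt ℝ f y) (hxy : x < y) :
    deriv f x < deriv f y := by
  have h1 := tangent_lt hf hx hy hdx hxy.ne
  have h2 := tangent_lt hf hy hx hdy hxy.ne'
  nlinarith

theorem rate_eq (hf : StrictConvexOn ℝ D (Λ 0)) {u : ℝ} (hu : u ∈ D)
    (hd : DifferentiableAt ℝ (Λ 0) u) : rate D Λ (deriv (Λ 0) u) = u * deriv (Λ 0) u - Λ 0 u := by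
  refine IsGreatest.csSup_eq ⟨⟨u, hu, rfl⟩, ?_⟩
  rintro _ ⟨x, hx, rfl⟩
  rcases eq_or_ne u x with rfl | h
  · exact le_rfl
  · have := tangent_lt hf hu hx hd h
    simp only
    linarith

end Convexity

/-! ### Call prices for a family satisfying the standing assumptions. -/

section Family

variable {Ω : Type*} [MeasurableSpace Ω] {μ : ℝ → Measure Ω} {Y : ℝ → Ω → ℝ} {Λ : Fin 3 → ℝ → ℝ}

/-- For probability measures Λ_ε(0) = 0, and the expansion at 0 passes this to the limit. This
normalisation gives positivity of the rate function through the tangent inequality. -/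
theorem Assumptions.apply_zero (hA : Assumptions μ Y Λ) (hμ : ∀ ε > 0, IsProbabilityMeasure (μ ε)) :
    Λ 0 0 = 0 := by
  have h0 : ∀ᶠ ε : ℝ in 𝓝[>] 0, lmgf μ Y ε 0 = 0 := by
    filter_upwards [self_mem_nhdsWithin] with ε hε
    have := hμ ε hε
    simp [lmgf]
  have h1 : Tendsto (fun ε : ℝ => ε ^ 3) (𝓝[>] 0) (𝓝 0) := by
    have : Tendsto (fun ε : ℝ => ε ^ 3) (𝓝 0) (𝓝 (0 ^ 3)) := (continuous_pow 3).tendsto 0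
    simpa using this.mono_left nhdsWithin_le_nhds
  have h2 := (hA.expansion 0 hA.zero_mem).trans_tendsto h1
  have h3 : Tendsto (fun ε : ℝ => ∑ i : Fin 3, Λ i 0 * ε ^ (i : ℕ)) (𝓝[>] 0) (𝓝 0) := by
    have := h2.neg
    rw [neg_zero] at this
    refine this.congr' ?_
    filter_upwards [h0] with ε hε
    rw [hε]; ring
  have h4 : Tendsto (fun ε : ℝ => ∑ i : Fin 3, Λ i 0 * ε ^ (i : ℕ)) (𝓝[>] 0)
      (𝓝 (∑ i : Fin 3, Λ i 0 * (0 : ℝ) ^ (i : ℕ))) := by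
    have hc : Continuous (fun ε : ℝ => ∑ i : Fin 3, Λ i 0 * ε ^ (i : ℕ)) := by fun_prop
    exact (hc.tendsto 0).mono_left nhdsWithin_le_nhds
  have := tendsto_nhds_unique h4 h3
  simpa [Fin.sum_univ_three] using this

theorem Assumptions.differentiableAt (hA : Assumptions μ Y Λ) {u : ℝ} (hu : u ∈ D0int μ Y) :
    DifferentiableAt ℝ (Λ 0) u :=
  hA.differentiable.differentiableAt (isOpen_interior.mem_nhds hu)

/-- Expansion of the prices of call options. -/
theorem Assumptions.call_expansion (hA : Assumptions μ Y Λ)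
    (hμ : ∀ ε > 0, IsProbabilityMeasure (μ ε)) {u b₀ b₁ s ε₀ : ℝ} (hu : u ∈ D0int μ Y) (hu0 : u ≠ 0)
    (hub : u ≠ b₀) (hs : s = 1 ∨ s = -1) (hsu : 0 < s * (u * (u - b₀))) (hε₀ : 0 < ε₀)
    (hb : ∀ ε ∈ Ioc 0 ε₀, 0 < b₀ + b₁ * ε ∧ u ≠ b₀ + b₁ * ε ∧
      Integrable (fun ω => Real.exp ((b₀ + b₁ * ε) * (Y ε ω / ε))) (μ ε) ∧
      ∫ ω, Real.exp ((b₀ + b₁ * ε) * (Y ε ω / ε)) ∂μ ε = 1) :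
    ∃ C : ℝ, ∃ ε₁ > 0, ∀ ε ∈ Ioc 0 ε₁, ∃ ρ, |ρ| ≤ C * ε ^ 2 ∧
      (∫ ω, max (Real.exp ((b₀ + b₁ * ε) * (Y ε ω / ε)) -
          Real.exp ((b₀ + b₁ * ε) * deriv (Λ 0) u / ε)) 0 ∂μ ε) -
        ((if u < b₀ + b₁ * ε then 1 else 0) -
          (if u < 0 then Real.exp ((b₀ + b₁ * ε) * deriv (Λ 0) u / ε) else 0)) =
      (b₀ + b₁ * ε) * √ε / √(2 * Real.pi) *
        (s * Real.exp (-(u * deriv (Λ 0) u - Λ 0 u - b₀ * deriv (Λ 0) u) / ε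
          + (b₁ * deriv (Λ 0) u + Λ 1 u - Real.log (dL Λ 0 2 u) / 2 - Real.log (s * (u * (u - b₀))))
          + (upsilon Λ b₀ u + b₁ / (u - b₀)) * ε + ρ)) := by
  obtain ⟨ha, C, e₁, he₁, hexp⟩ := hA.fourierIntegral_expansion
    (fun ε hε => have := hμ ε hε; inferInstance) b₁ hu hu0 hub
  obtain ⟨e₂, he₂, hsub, -⟩ := hA.smooth
  set k := deriv (Λ 0) u with hk
  set a := dL Λ 0 2 u with haa
  set α := upsilon Λ b₀ u + b₁ / (u - b₀) with hα
  set A₀ := Real.exp (Λ 1 u) / (u * (u - b₀)) with hA₀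
  have hub' : u - b₀ ≠ 0 := sub_ne_zero.2 hub
  have hA₀0 : A₀ ≠ 0 := by positivity
  set S := √(2 * Real.pi / a) with hS
  have hS0 : 0 < S := Real.sqrt_pos.2 (by positivity)
  set K := |C| / (S * |A₀|) with hK
  have hA₀1 : 0 < |A₀| := abs_pos.2 hA₀0
  have hK0 : 0 ≤ K := by positivity
  set X := |α| with hX
  refine ⟨K + 2 * (X + K) ^ 2, min (min e₁ (e₂ / 2)) (min ε₀ (min 1 (1 / (2 * (X + K + 1))))),
    by positivity, fun ε hε => ?_⟩
  have hε0 : 0 < ε := hε.1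
  have m1 := hε.2.trans (min_le_left _ _)
  have m2 := hε.2.trans (min_le_right _ _)
  have hεX : (X + K) * ε ≤ 1 / 2 := by
    have := (m2.trans (min_le_right _ _)).trans (min_le_right _ _)
    rw [le_div_iff₀ (by positivity)] at this
    linarith
  obtain ⟨hb0, hub1, hbi, hb1⟩ := hb ε ⟨hε0, m2.trans (min_le_left _ _)⟩
  have hw := hexp ε ⟨hε0, m1.trans (min_le_left _ _)⟩
  have hD := hsub ε ⟨hε0, (m1.trans (min_le_right _ _)).trans_lt (by linarith)⟩
  have := hμ ε hε0
  set b := b₀ + b₁ * ε with hbb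
  have hbd : b ∈ lmgfDomain μ Y ε := by
    refine hbi.congr (Eventually.of_forall fun ω => ?_)
    simp only
    congr 1
    ring
  have hF := fourierIntegral_eq k hε0 (hD hu) hu0 hub1 hb0 hbd
  rw [hb1] at hF
  set L := (∫ ω, max (Real.exp (b * (Y ε ω / ε)) - Real.exp (b * k / ε)) 0 ∂μ ε) -
        ((if u < b then 1 else 0) - (if u < 0 then Real.exp (b * k / ε) else 0)) with hL
  have hF' : ((b / (2 * Real.pi) * Real.exp (b * k / ε) : ℝ) : ℂ) *
      fourierIntegral μ Y u b k ε = (L : ℝ) := by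
    rw [hL, ← sub_add, ← hF]
    push_cast
    ring
  set c := b / (2 * Real.pi) * Real.exp (b * k / ε) with hc
  have hc0 : 0 < c := by positivity
  -- The inversion formula shows that the Fourier integral is real, so its expansion in complex norm
  -- becomes a real one and logarithms can be taken.
  have hFI : fourierIntegral μ Y u b k ε = ((L / c : ℝ) : ℂ) := by
    rw [Complex.ofReal_div, ← hF', mul_div_cancel_left₀]
    exact_mod_cast hc0.ne'
  set r := u * k - Λ 0 u with hr
  have hsq : √(2 * Real.pi * ε / a) = S * √ε := by
    rw [hS, ← Real.sqrt_mul (by positivity)]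
    congr 1
    ring
  have hε' : 0 < √ε := Real.sqrt_pos.2 hε0
  rw [hFI, hsq, ← Complex.ofReal_mul, ← Complex.ofReal_sub, Complex.norm_real, Real.norm_eq_abs] at hw
  set z := Real.exp (r / ε) * (L / c) / (S * √ε * A₀) with hz
  have hz1 : |z - 1 - α * ε| ≤ K * ε ^ 2 := by
    have e : z - 1 - α * ε =
        (Real.exp (r / ε) * (L / c) - S * √ε * A₀ * (1 + α * ε)) / (S * √ε * A₀) := by
      rw [hz]; field_simp; ring
    rw [e, abs_div, abs_mul, abs_mul, abs_of_pos hS0, abs_of_pos hε', div_le_iff₀ (by positivity)]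
    refine hw.trans ?_
    calc C * (ε ^ 2 * √ε) ≤ |C| * (ε ^ 2 * √ε) := by gcongr; exact le_abs_self C
      _ = _ := by rw [hK]; field_simp
  obtain ⟨hz0, hlog⟩ := abs_log_sub_le hε0 le_rfl hz1
    ((m2.trans (min_le_right _ _)).trans (min_le_left _ _)) hεX
  refine ⟨Real.log z - α * ε, hlog, ?_⟩
  rw [show -(r - b₀ * k) / ε + (b₁ * k + Λ 1 u - Real.log a / 2 - Real.log (s * (u * (u - b₀)))) +
      α * ε + (Real.log z - α * ε) = (-(r / ε) + b * k / ε) +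
      (Λ 1 u - Real.log a / 2 - Real.log (s * (u * (u - b₀)))) + Real.log z by
    rw [hbb]; field_simp; ring, Real.exp_add, Real.exp_log hz0, Real.exp_add, Real.exp_sub,
    Real.exp_sub, Real.exp_log hsu, ← Real.log_sqrt ha.le, Real.exp_log (Real.sqrt_pos.2 ha),
    Real.exp_add, Real.exp_neg, hz, hA₀, hc, hS, Real.sqrt_div (by positivity)]
  have hs0 : s ≠ 0 := by rintro rfl; simp at hsu
  have ha' : 0 < √a := Real.sqrt_pos.2 ha
  have hpi : √(2 * Real.pi) ^ 2 = 2 * Real.pi := Real.sq_sqrt (by positivity)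
  have hpi' : 0 < √(2 * Real.pi) := Real.sqrt_pos.2 (by positivity)
  generalize √(2 * Real.pi) = q at hpi hpi' ⊢
  rw [← hpi]
  field_simp

end Family

/-! ### Change to the share-price measure. -/

section Martingale

variable {Ω : Type*} [mΩ : MeasurableSpace Ω] {P : Measure Ω}
  {ℱ : Filtration ℝ≥0 mΩ} {X : ℝ≥0 → Ω → ℝ}

theorem integral_exp_eq_one [IsProbabilityMeasure P] (hX0 : ∀ᵐ ω ∂P, X 0 ω = 0)
    (hmart : Martingale (fun s ω => Real.exp (X s ω)) ℱ P) (t : ℝ≥0) :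
    ∫ ω, Real.exp (X t ω) ∂P = 1 := by
  have h := hmart.setIntegral_eq (zero_le (a := t)) (s := univ) MeasurableSet.univ
  rw [setIntegral_univ, setIntegral_univ] at h
  rw [← h]
  have : ∫ ω, Real.exp (X 0 ω) ∂P = ∫ _, (1 : ℝ) ∂P := by
    refine integral_congr_ae ?_
    filter_upwards [hX0] with ω hω
    simp [hω]
  rw [this]
  simp

theorem isProbabilityMeasure_sharePriceMeasure [IsProbabilityMeasure P] (hX0 : ∀ᵐ ω ∂P, X 0 ω = 0)
    (hmart : Martingale (fun s ω => Real.exp (X s ω)) ℱ P) (t : ℝ≥0) :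
    IsProbabilityMeasure (sharePriceMeasure P X t) := by
  refine ⟨?_⟩
  rw [sharePriceMeasure, withDensity_apply _ MeasurableSet.univ, Measure.restrict_univ,
    ← ofReal_integral_eq_lintegral_ofReal (hmart.integrable t)
      (Eventually.of_forall fun ω => (Real.exp_pos _).le), integral_exp_eq_one hX0 hmart,
    ENNReal.ofReal_one]

theorem integral_sharePriceMeasure (hmart : Martingale (fun s ω => Real.exp (X s ω)) ℱ P) (t : ℝ≥0)
    (g : Ω → ℝ) :
    ∫ ω, g ω ∂sharePriceMeasure P X t = ∫ ω, Real.exp (X t ω) * g ω ∂P := by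
  rw [sharePriceMeasure, integral_withDensity_eq_integral_toReal_smul₀
    (hmart.integrable t).aemeasurable.ennreal_ofReal (Eventually.of_forall fun ω => by simp)]
  simp [ENNReal.toReal_ofReal (Real.exp_pos _).le]

theorem integrable_sharePriceMeasure_iff (hmart : Martingale (fun s ω => Real.exp (X s ω)) ℱ P)
    (t : ℝ≥0) (g : Ω → ℝ) : Integrable g (sharePriceMeasure P X t) ↔
      Integrable (fun ω => Real.exp (X t ω) * g ω) P := by
  rw [sharePriceMeasure, integrable_withDensity_iff_integrable_smul₀'
    (hmart.integrable t).aemeasurable.ennreal_ofReal (Eventually.of_forall fun ω => by simp)]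
  simp [ENNReal.toReal_ofReal (Real.exp_pos _).le]

theorem exp_mul_exp_fwd {Ω : Type*} {X : ℝ≥0 → Ω → ℝ} (t τ : ℝ≥0) (ω : Ω) :
    Real.exp (X t ω) * Real.exp (fwd X t τ ω) = Real.exp (X (t + τ) ω) := by
  rw [← Real.exp_add]
  congr 1
  simp [fwd]

theorem integrable_exp_fwd (hmart : Martingale (fun s ω => Real.exp (X s ω)) ℱ P) (t τ : ℝ≥0) :
    Integrable (fun ω => Real.exp (fwd X t τ ω)) (sharePriceMeasure P X t) := by
  rw [integrable_sharePriceMeasure_iff hmart]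
  simp only [exp_mul_exp_fwd]
  exact hmart.integrable _

theorem integral_exp_fwd [IsProbabilityMeasure P] (hX0 : ∀ᵐ ω ∂P, X 0 ω = 0)
    (hmart : Martingale (fun s ω => Real.exp (X s ω)) ℱ P) (t τ : ℝ≥0) :
    ∫ ω, Real.exp (fwd X t τ ω) ∂sharePriceMeasure P X t = 1 := by
  rw [integral_sharePriceMeasure hmart]
  simp only [exp_mul_exp_fwd]
  exact integral_exp_eq_one hX0 hmart _

/-- Factoring e^{X_t} out of the payoff absorbs it into the density. What remains is an ordinary
call on the forward increment. -/
theorem typeIICall_eq (hmart : Martingale (fun s ω => Real.exp (X s ω)) ℱ P) (t τ : ℝ≥0) (k : ℝ) :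
    typeIICall P X t τ k =
      ∫ ω, max (Real.exp (fwd X t τ ω) - Real.exp k) 0 ∂sharePriceMeasure P X t := by
  rw [integral_sharePriceMeasure hmart, typeIICall]
  refine integral_congr_ae (Eventually.of_forall fun ω => ?_)
  simp only
  rw [mul_max_of_nonneg _ _ (Real.exp_pos _).le, mul_sub, exp_mul_exp_fwd, mul_zero, ← Real.exp_add,
    add_comm k]

end Martingale

end FwdSmile

end

/-! ### The diagonal small-maturity regime -/

noncomputable section

namespace FwdSmile

theorem isBigO_sub_of_differentiableAt {f : ℝ → ℝ} {x : ℝ} (h : DifferentiableAt ℝ f x) :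
    (fun s : ℝ => f (x + s) - f x) =O[𝓝 0] fun s => s := by
  have h1 := (hasDerivAt_iff_isLittleO_nhds_zero.1 h.hasDerivAt).isBigO
  have h2 : (fun s : ℝ => s • deriv f x) =O[𝓝 0] fun s => s := by
    simpa [mul_comm] using (Asymptotics.isBigO_refl (fun s : ℝ => s) (𝓝 0)).const_mul_left (deriv f x)
  refine (h1.add h2).congr_left fun s => ?_
  ring

/-- Third order Taylor bound for `A / V + B + D * V`. -/
theorem isBigO_taylor_two {φ : ℝ → ℝ} {A B D v φ₀ : ℝ} (hv : 0 < v)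
    (hφ : ∀ V > 0, φ V = A / V + B + D * V) (h₀ : φ v = φ₀) :
    (fun x => φ (v + x) - φ₀ - (-A / v ^ 2 + D) * x - A / v ^ 3 * x ^ 2) =O[𝓝 0]
      fun x : ℝ => x ^ 3 := by
  refine Asymptotics.IsBigO.of_bound (|A| / (v ^ 3 * (v / 2))) ?_
  filter_upwards [Metric.ball_mem_nhds (0 : ℝ) (by positivity : 0 < v / 2)] with x hx
  rw [Metric.mem_ball, Real.dist_eq, sub_zero, abs_lt] at hx
  have hV : v / 2 ≤ v + x := by linarith [hx.1]
  have hV0 : 0 < v + x := by linarith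
  rw [← h₀, hφ _ hV0, hφ _ hv]
  have e : A / (v + x) + B + D * (v + x) - (A / v + B + D * v) - (-A / v ^ 2 + D) * x -
      A / v ^ 3 * x ^ 2 = -(A / (v ^ 3 * (v + x)) * x ^ 3) := by
    field_simp
    ring
  rw [e, norm_neg, norm_mul, norm_div, Real.norm_eq_abs A, Real.norm_of_nonneg (by positivity)]
  gcongr

theorem bracket_of_div {B₁ B₂ C r d : ℝ} (hd : 0 < d) (h₁ : (B₁ - r) / d < (C - r) / d)
    (h₂ : (C - r) / d < (B₂ - r) / d) : B₁ < C ∧ C < B₂ := by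
  rw [div_lt_div_iff_of_pos_right hd] at h₁ h₂
  exact ⟨by linarith, by linarith⟩

theorem mul_sqrt_eq_exp {x : ℝ} (hx : 0 < x) : x * √x = Real.exp (3 / 2 * Real.log x) := by
  rw [show 3 / 2 * Real.log x = Real.log x + Real.log x / 2 by ring, Real.exp_add, Real.exp_log hx,
    ← Real.log_sqrt hx.le, Real.exp_log (Real.sqrt_pos.2 hx)]

variable {Ω : Type*} [mΩ : MeasurableSpace Ω] {P : Measure Ω} [IsProbabilityMeasure P]
  {ℱ : Filtration ℝ≥0 mΩ} {X : ℝ≥0 → Ω → ℝ}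

set_option maxHeartbeats 800000 in
/-- The diagonal small maturity expansion. -/
theorem diagonal_expansion (hX0 : ∀ᵐ ω ∂P, X 0 ω = 0)
    (hmart : Martingale (fun s ω => Real.exp (X s ω)) ℱ P) {t τ : ℝ≥0} {Λ : Fin 3 → ℝ → ℝ} (hτ : 0 < τ)
    (hA : Assumptions (diagMeasure P X t) (diagProcess X t τ) Λ) (hΛ : deriv (Λ 0) 0 = 0)
    {D : Set ℝ} (hD : D = D0int (diagMeasure P X t) (diagProcess X t τ)) {k u : ℝ} (hu : u ∈ D)
    (hk : deriv (Λ 0) u = k) (hk0 : k ≠ 0) :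
    ∃ K > 0, ∃ ε₁ > 0, ∀ ε ∈ Ioc 0 ε₁,
      (∃! σ : ℝ, IsTypeIIVol P X (ε.toNNReal * t) (ε.toNNReal * τ) k σ) ∧
      |typeIIVol P X (ε.toNNReal * t) (ε.toNNReal * τ) k ^ 2
        - (v0 D Λ τ k + v1 D Λ τ k u * ε + v2 D Λ τ k u * ε ^ 2)| ≤ K * ε ^ 3 := by
  have hμ : ∀ ε > 0, IsProbabilityMeasure (diagMeasure P X t ε) := fun ε _ =>
    isProbabilityMeasure_sharePriceMeasure hX0 hmart _
  have hu' : u ∈ D0int (diagMeasure P X t) (diagProcess X t τ) := hD ▸ hu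
  have hΛ00 := hA.apply_zero hμ
  have hu0 : u ≠ 0 := by rintro rfl; exact hk0 (hk ▸ hΛ)
  -- The tangent at u evaluated at 0 gives Λ*(k) > 0. The tangent at 0 is horizontal, so Λ₀(u) > 0
  -- and hence uk > 0: u and k have the same sign.
  have t1 := tangent_lt hA.strictConvex hu' hA.zero_mem (hA.differentiableAt hu') hu0
  have t2 := tangent_lt hA.strictConvex hA.zero_mem hu' (hA.differentiableAt hA.zero_mem) hu0.symm
  rw [hk, hΛ00] at t1
  rw [hΛ, hΛ00] at t2
  have hr0 : 0 < u * k - Λ 0 u := by linarith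
  have huk : 0 < u * k := by linarith
  have hrate : rate D Λ k = u * k - Λ 0 u := by
    rw [← hk]
    exact rate_eq (hD ▸ hA.strictConvex) hu (hA.differentiableAt hu')
  have hτ' : (0 : ℝ) < τ := by exact_mod_cast hτ
  have hk2 : 0 < k ^ 2 := by positivity
  set r := u * k - Λ 0 u with hr
  have hv0 : v0 D Λ τ k = k ^ 2 / (2 * τ * r) := by rw [v0, hrate]
  have hv0' : 0 < v0 D Λ τ k := by rw [hv0]; positivity
  have hu2 : 0 < |u| := abs_pos.2 hu0
  -- The call is on e^Y with Y not rescaled, so the exponent is b = ε and the second pole tends to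
  -- 0. The restriction ε ≤ |u|/2 keeps it away from u.
  obtain ⟨C₁, e₁, he₁, h₁⟩ := hA.call_expansion (b₀ := 0) (b₁ := 1) (s := 1) (ε₀ := |u| / 2) hμ hu'
    hu0 hu0 (Or.inl rfl) (by rw [sub_zero, one_mul, ← pow_two]; positivity) (by positivity)
    (fun ε hε => by
      have hε0 := hε.1
      have e : ∀ ω, (0 + 1 * ε) * (diagProcess X t τ ε ω / ε) = diagProcess X t τ ε ω := fun ω => by
        field_simp
        ring
      simp only [e]
      refine ⟨by linarith, fun h => ?_, integrable_exp_fwd hmart _ _,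
        integral_exp_fwd hX0 hmart _ _⟩
      have h3 := hε.2
      rw [h, zero_add, one_mul, abs_of_pos hε0] at h3
      linarith)
  obtain ⟨ha, -⟩ := hA.fourierIntegral_expansion
    (fun ε hε => have := hμ ε hε; inferInstance) 0 hu' hu0 hu0
  obtain ⟨C₂, y₁, hy₁, h₂⟩ := bsTotal_small_maturity hk0
  set res : ℝ := if k < 0 then 1 - Real.exp k else 0 with hres
  rw [hk] at h₁
  set v := v0 D Λ τ k with hv
  set a := dL Λ 0 2 u with haa
  have hφ₀ : k ^ 2 / (2 * τ) / v = r := by rw [hv0]; field_simp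
  have hu22 : 0 < u ^ 2 := by positivity
  have hL : v1 D Λ τ k u = v ^ 2 * τ / k * (1 + 2 / k * (Real.log (k ^ 2) + Λ 1 u
      - (Real.log (u ^ 2) + Real.log a / 2 + 3 / 2 * Real.log (v * τ)))) := by
    rw [v1, ← hv, ← haa, Real.log_div (by positivity) (by positivity),
      Real.log_mul (by positivity) (by positivity), Real.log_exp,
      Real.log_mul (by positivity) (by positivity), Real.log_mul (by positivity) (by positivity),
      Real.log_sqrt ha.le, Real.log_rpow (by positivity), mul_comm (τ : ℝ) v]
  set M := max |C₁| (|C₂| * (2 * v * τ) ^ 2) with hM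
  have hsq2 : 0 < √(2 * Real.pi) := Real.sqrt_pos.2 (by positivity)
  -- Residues are removed and both prices divided by the same prefactor ε√ε/√(2π). The Black-Scholes
  -- prefactor is (Vτε)^{3/2}; its part depending on V goes into ψ as (3/2) log(Vτ).
  set f : ℝ → ℝ → ℝ := fun ε V =>
    (bsTotal k √(V * (ε * τ)) - res) / (ε * √ε / √(2 * Real.pi)) with hf
  set c : ℝ → ℝ := fun ε => (typeIICall P X (ε.toNNReal * t) (ε.toNNReal * τ) k - res) /
    (ε * √ε / √(2 * Real.pi)) with hc
  have hpre : ∀ ε : ℝ, 0 < ε → 0 < ε * √ε / √(2 * Real.pi) := fun ε hε => by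
    have := Real.sqrt_pos.2 hε
    positivity
  obtain ⟨K, hK, e₃, he₃, h₃⟩ := exists_bracket (f := f) (c := c) (φ := fun V => k ^ 2 / (2 * τ) / V)
    (ψ := fun V => 3 / 2 * Real.log (V * τ) + k / 2 - Real.log (k ^ 2))
    (χ := fun V => -(1 / 8 + 3 / k ^ 2) * (V * τ)) (v₀ := v) (v₁ := v1 D Λ τ k u)
    (v₂ := v2 D Λ τ k u) (δ := v / 2) (C := M) (s := 1) (φ₀ := r)
    (φ₁ := -(k ^ 2 / (2 * τ)) / v ^ 2 + 0) (φ₂ := k ^ 2 / (2 * τ) / v ^ 3)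
    (ψ₁ := 3 / 2 * (τ / (v * τ)))
    (α₀ := 1 * k + Λ 1 u - Real.log a / 2 - Real.log (1 * (u * (u - 0))))
    (α₁ := upsilon Λ 0 u + 1 / (u - 0))
    (ε₀ := min e₁ (min (|u| / 2) (y₁ / (2 * v * τ)))) hv0' (by positivity) (by positivity) one_ne_zero
    (fun ε hε V hV => by
      have hε0 := hε.1
      have hV0 : 0 < V := by linarith [hV.1]
      have hV2 : V ≤ 2 * v := by linarith [hV.2]
      have hy : V * (ε * τ) ≤ 2 * v * τ * ε := by
        calc V * (ε * τ) ≤ 2 * v * (ε * τ) := by gcongr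
          _ = _ := by ring
      have hyy : V * (ε * τ) ∈ Ioc 0 y₁ := by
        refine ⟨by positivity, hy.trans ?_⟩
        have := (hε.2.trans (min_le_right _ _)).trans (min_le_right _ _)
        rw [le_div_iff₀ (by positivity)] at this
        linarith
      obtain ⟨g1, ρ, hρ, g2⟩ := h₂ _ hyy
      refine ⟨ρ, ?_, ?_⟩
      · refine hρ.trans ?_
        calc C₂ * (V * (ε * τ)) ^ 2 ≤ |C₂| * (2 * v * τ * ε) ^ 2 := by
              gcongr
              exact le_abs_self _
          _ = |C₂| * (2 * v * τ) ^ 2 * ε ^ 2 := by ring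
          _ ≤ _ := by gcongr; exact le_max_right _ _
      · rw [g1] at g2
        have := Real.sqrt_pos.2 hε0
        simp only [hf]
        rw [g2, div_eq_iff (hpre ε hε0).ne', show V * (ε * τ) = (V * τ) * ε by ring,
          Real.sqrt_mul (by positivity), show V * τ * ε * (√(V * τ) * √ε) =
          (V * τ * √(V * τ)) * (ε * √ε) by ring, mul_sqrt_eq_exp (by positivity),
          show -(k ^ 2 / (2 * τ) / V) / ε + (3 / 2 * Real.log (V * τ) + k / 2 - Real.log (k ^ 2)) +
            -(1 / 8 + 3 / k ^ 2) * (V * τ) * ε + ρ = 3 / 2 * Real.log (V * τ) +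
            (-(k ^ 2 / (2 * (V * τ * ε))) + k / 2 - Real.log (k ^ 2) +
            -(1 / 8 + 3 / k ^ 2) * (V * τ * ε) + ρ) by field_simp; ring,
          Real.exp_add (3 / 2 * Real.log (V * τ))]
        ring)
    (fun ε hε => by
      have hε0 := hε.1
      obtain ⟨ρ, hρ, g⟩ := h₁ ε ⟨hε0, hε.2.trans (min_le_left _ _)⟩
      refine ⟨ρ, hρ.trans ?_, ?_⟩
      · gcongr
        exact (le_abs_self _).trans (le_max_left _ _)
      · have e : ∀ ω, (0 + 1 * ε) * (diagProcess X t τ ε ω / ε) = diagProcess X t τ ε ω := fun ω => by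
          field_simp
          ring
        have e2 : (0 + 1 * ε) * k / ε = k := by field_simp; ring
        simp only [e, e2] at g
        rw [zero_add, one_mul, zero_mul, sub_zero] at g
        -- The Fourier residues depend on the sign of u, those of Black-Scholes on the sign of k;
        -- they agree because uk > 0.
        have hres' : ((if u < ε then 1 else 0) - (if u < 0 then Real.exp k else 0)) = res := by
          have hεu := (hε.2.trans (min_le_right _ _)).trans (min_le_left _ _)
          rcases lt_or_gt_of_ne hu0 with h | h
          · have hk' : k < 0 := by nlinarith
            rw [if_pos (by linarith), if_pos h, hres, if_pos hk']
          · have hk' : 0 < k := by nlinarith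
            rw [abs_of_pos h] at hεu
            rw [if_neg (by linarith), if_neg h.not_gt, hres, if_neg hk'.not_gt, sub_zero]
        rw [hres'] at g
        simp only [hc]
        rw [div_eq_iff (hpre ε hε0).ne', typeIICall_eq hmart]
        refine g.trans ?_
        rw [mul_comm, sub_zero])
    (isBigO_taylor_two (B := 0) hv0' (fun V _ => by ring) hφ₀)
    (isBigO_taylor_one
      (AnalyticAt.sub (AnalyticAt.add (AnalyticAt.mul analyticAt_const
        (AnalyticAt.log (by fun_prop) (by positivity))) analyticAt_const) analyticAt_const)
      (((((hasDerivAt_id v).mul_const (τ : ℝ)).log (mul_pos hv0' hτ').ne').const_mul (3 / 2)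
        |>.add_const _ |>.sub_const _).congr_deriv (by simp)))
    (isBigO_sub_of_differentiableAt (f := fun V => -(1 / 8 + 3 / k ^ 2) * (V * τ)) (by fun_prop))
    (by
      rw [add_zero, neg_div]
      exact neg_ne_zero.2 (by positivity))
    (by
      rw [hL, sub_zero, one_mul (u * u), ← pow_two]
      field_simp
      ring)
    (by
      rw [v2, ← hv, sub_zero]
      field_simp
      ring)
    (fun ε hε V hV V' hV' hVV' => by
      have hε0 := hε.1
      simp only [hf]
      rw [div_lt_div_iff_of_pos_right (hpre ε hε0)]
      refine sub_lt_sub_right (strictMonoOn_bsTotal k ?_ ?_ ?_) _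
      · exact Real.sqrt_pos.2 (mul_pos hV (by positivity))
      · exact Real.sqrt_pos.2 (mul_pos hV' (by positivity))
      · exact Real.sqrt_lt_sqrt (mul_pos hV (by positivity)).le (by gcongr))
  refine ⟨K, hK, e₃, he₃, fun ε hε => ?_⟩
  have hε0 := hε.1
  obtain ⟨g1, g2, g3⟩ := h₃ ε hε
  obtain ⟨g4, g5⟩ := bracket_of_div (hpre ε hε0) g2 g3
  have hcoe : ((ε.toNNReal * τ : ℝ≥0) : ℝ) = ε * τ := by
    rw [NNReal.coe_mul, Real.coe_toNNReal _ hε0.le]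
  obtain ⟨g6, g7, g8⟩ := implied_vol_of_bracket (by positivity : 0 < ε * (τ : ℝ)) g1 g4 g5
    (by linarith [mul_pos hK (pow_pos hε0 3)])
  rw [← hcoe] at g6 g7 g8
  refine ⟨g6, ?_⟩
  rw [abs_le]
  exact ⟨by unfold typeIIVol IsTypeIIVol; linarith, by unfold typeIIVol IsTypeIIVol; linarith⟩

end FwdSmile

end

/-! ### The large-maturity regime -/

noncomputable section

namespace FwdSmile

/-- With Λ* = A² and Λ* − k = B², A and B positive, the leading-order equation (k − w/2)²/(2w) = B²
has the roots w = 2(A ± B)². As k = A² − B², the plus root exceeds 2|k|. -/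
theorem w0_of_mem {D : Set ℝ} {Λ : Fin 3 → ℝ → ℝ} {k : ℝ}
    (hk : k ∈ Ioo (deriv (Λ 0) 0) (deriv (Λ 0) 1)) (hr : 0 < rate D Λ k) (hrk : 0 < rate D Λ k - k) :
    0 < w0 D Λ k ∧ (k - w0 D Λ k / 2) ^ 2 / (2 * w0 D Λ k) = rate D Λ k - k ∧ 2 * k < w0 D Λ k ∧
      -2 * k < w0 D Λ k := by
  obtain ⟨A, hA, hA2⟩ : ∃ A > 0, A ^ 2 = rate D Λ k := ⟨_, Real.sqrt_pos.2 hr, Real.sq_sqrt hr.le⟩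
  obtain ⟨B, hB, hB2⟩ : ∃ B > 0, B ^ 2 = rate D Λ k - k :=
    ⟨_, Real.sqrt_pos.2 hrk, Real.sq_sqrt hrk.le⟩
  have hkAB : k = A ^ 2 - B ^ 2 := by linarith
  have hw : w0 D Λ k = 2 * (A + B) ^ 2 := by
    rw [w0, if_pos hk, ← hB2, ← hA2, ← mul_pow, Real.sqrt_sq (by positivity), hkAB]
    ring
  rw [hw, ← hB2, hkAB]
  refine ⟨by positivity, ?_, ?_, ?_⟩
  · field_simp
    ring
  · nlinarith [mul_pos hA hB]
  · nlinarith [mul_pos hA hB]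

/-- The minus root 2(A − B)² lies below 2|k| = 2|A − B|(A + B). It is positive only for k ≠ 0. -/
theorem w0_of_notMem {D : Set ℝ} {Λ : Fin 3 → ℝ → ℝ} {k : ℝ}
    (hk : k ∉ Ioo (deriv (Λ 0) 0) (deriv (Λ 0) 1)) (hk0 : k ≠ 0) (hr : 0 < rate D Λ k)
    (hrk : 0 < rate D Λ k - k) :
    0 < w0 D Λ k ∧ (k - w0 D Λ k / 2) ^ 2 / (2 * w0 D Λ k) = rate D Λ k - k ∧
      w0 D Λ k < 2 * |k| := by
  obtain ⟨A, hA, hA2⟩ : ∃ A > 0, A ^ 2 = rate D Λ k := ⟨_, Real.sqrt_pos.2 hr, Real.sq_sqrt hr.le⟩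
  obtain ⟨B, hB, hB2⟩ : ∃ B > 0, B ^ 2 = rate D Λ k - k :=
    ⟨_, Real.sqrt_pos.2 hrk, Real.sq_sqrt hrk.le⟩
  have hkAB : k = (A - B) * (A + B) := by linarith
  have hw : w0 D Λ k = 2 * (A - B) ^ 2 := by
    rw [w0, if_neg hk, ← hB2, ← hA2, ← mul_pow, Real.sqrt_sq (by positivity), hkAB]
    ring
  have hAB : A - B ≠ 0 := fun h => hk0 (by rw [hkAB, h, zero_mul])
  have hAB' : 0 < |A - B| := abs_pos.2 hAB
  rw [hw, ← hB2, hkAB]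
  refine ⟨by positivity, ?_, ?_⟩
  · field_simp
    ring
  · rw [abs_mul, abs_of_pos (by positivity : 0 < A + B), ← sq_abs, pow_two, mul_comm 2, mul_comm 2]
    have : |A - B| < A + B := by rw [abs_lt]; constructor <;> linarith
    gcongr

variable {Ω : Type*} [mΩ : MeasurableSpace Ω] {P : Measure Ω} [IsProbabilityMeasure P]
  {ℱ : Filtration ℝ≥0 mΩ} {X : ℝ≥0 → Ω → ℝ}

/-- The large maturity expansion from the leading order and the sign of `4k² - w₀²`. -/
theorem large_expansion_of_leading (hX0 : ∀ᵐ ω ∂P, X 0 ω = 0)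
    (hmart : Martingale (fun s ω => Real.exp (X s ω)) ℱ P) {t : ℝ≥0} {Λ : Fin 3 → ℝ → ℝ}
    (hA : Assumptions (largeMeasure P X t) (largeProcess X t) Λ) {D : Set ℝ}
    {k u s w : ℝ} (hu' : u ∈ D0int (largeMeasure P X t) (largeProcess X t))
    (hk : deriv (Λ 0) u = k) (hu0 : u ≠ 0) (hu1 : u ≠ 1) (hw : w = w0 D Λ k) (hw0 : 0 < w)
    (hφ₀ : (k - w / 2) ^ 2 / (2 * w) = u * k - Λ 0 u - 1 * k)
    (hs : s = 1 ∨ s = -1) (hsw : 0 < s * (4 * k ^ 2 - w ^ 2)) (hsu : 0 < s * (u * (u - 1)))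
    (h2k : 2 * k < w ↔ u < 1) (h2k' : w < -2 * k ↔ u < 0) :
    ∃ K > 0, ∃ ε₁ > 0, ∀ ε ∈ Ioc 0 ε₁,
      (∃! σ : ℝ, IsTypeIIVol P X t (ε⁻¹).toNNReal (k / ε) σ) ∧
      |typeIIVol P X t (ε⁻¹).toNNReal (k / ε) ^ 2
        - (w0 D Λ k + w1 D Λ k u * ε + w2 D Λ k u * ε ^ 2)| ≤ K * ε ^ 3 := by
  have hμ : ∀ ε > 0, IsProbabilityMeasure (largeMeasure P X t ε) := fun ε _ =>
    isProbabilityMeasure_sharePriceMeasure hX0 hmart _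
  have hu1' : u - 1 ≠ 0 := sub_ne_zero.2 hu1
  have hs0 : s ≠ 0 := by rintro rfl; simp at hsu
  have hkw : 4 * k ^ 2 - w ^ 2 ≠ 0 := by intro h; simp [h] at hsw
  have hcall : ∀ ε > 0, ∀ ω, (1 + 0 * ε) * (largeProcess X t ε ω / ε) = fwd X t (ε⁻¹).toNNReal ω :=
    fun ε hε ω => by
      unfold largeProcess
      field_simp
      ring
  obtain ⟨C₁, e₁, he₁, h₁⟩ := hA.call_expansion (b₀ := 1) (b₁ := 0) (s := s) (ε₀ := 1) hμ hu'
    hu0 hu1 hs hsu one_pos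
    (fun ε hε => by
      simp only [hcall ε hε.1]
      exact ⟨by norm_num, by simpa using hu1, integrable_exp_fwd hmart _ _,
        integral_exp_fwd hX0 hmart _ _⟩)
  obtain ⟨ha, -⟩ := hA.fourierIntegral_expansion
    (fun ε hε => have := hμ ε hε; inferInstance) 0 hu' hu0 hu0
  obtain ⟨C₂, δ, hδ, e₂, he₂, h₂⟩ := bsTotal_large_maturity hw0 hs hsw
  simp only [h2k, h2k'] at h₂
  rw [hk] at h₁
  set a := dL Λ 0 2 u with haa
  set res : ℝ → ℝ := fun ε => (if u < 1 then 1 else 0) - Real.exp (k / ε) * (if u < 0 then 1 else 0)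
    with hres
  have hL : w1 D Λ k u = 8 * w ^ 2 / (4 * k ^ 2 - w ^ 2) * (Λ 1 u + (Real.log (s * (4 * k ^ 2 - w ^ 2))
      - (Real.log 4 + Real.log (s * (u * (u - 1))) + 3 / 2 * Real.log w + Real.log a / 2))) := by
    -- The sign s is inserted above and below so that the logarithm splits into logarithms of
    -- positive numbers.
    have e : (4 * k ^ 2 - w ^ 2) / (4 * (u - 1) * u * w ^ (3 / 2 : ℝ) * √a) =
        (s * (4 * k ^ 2 - w ^ 2)) / (4 * (s * (u * (u - 1))) * w ^ (3 / 2 : ℝ) * √a) := by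
      field_simp
    have hsa : 0 < √a := Real.sqrt_pos.2 ha
    rw [w1, ← hw, ← haa, e]
    generalize s * (4 * k ^ 2 - w ^ 2) = W at hsw ⊢
    generalize s * (u * (u - 1)) = U at hsu ⊢
    rw [Real.log_div (by positivity) (by positivity), Real.log_mul (by positivity) (by positivity),
      Real.log_mul (by positivity) (by positivity), Real.log_mul (by positivity) (by positivity),
      Real.log_sqrt ha.le, Real.log_rpow hw0]
  have hsq2 : 0 < √(2 * Real.pi) := Real.sqrt_pos.2 (by positivity)
  have hpre : ∀ ε : ℝ, 0 < ε → 0 < √ε / √(2 * Real.pi) := fun ε hε => by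
    have := Real.sqrt_pos.2 hε
    positivity
  set f : ℝ → ℝ → ℝ := fun ε V =>
    (bsTotal (k / ε) √(V / ε) - res ε) / (√ε / √(2 * Real.pi)) with hf
  set c : ℝ → ℝ := fun ε => (typeIICall P X t (ε⁻¹).toNNReal (k / ε) - res ε) /
    (√ε / √(2 * Real.pi)) with hc
  have hda : HasDerivAt (fun V : ℝ => 4 * k ^ 2 - V ^ 2) (-(2 * w)) w := by
    simpa using (hasDerivAt_pow 2 w).const_sub (4 * k ^ 2)
  obtain ⟨K, hK, e₃, he₃, h₃⟩ := exists_bracket (f := f) (c := c)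
    (φ := fun V => (k - V / 2) ^ 2 / (2 * V))
    (ψ := fun V => Real.log 4 + 3 / 2 * Real.log V - Real.log (s * (4 * k ^ 2 - V ^ 2)))
    (χ := fun V => -(4 * V * (12 * k ^ 2 + V ^ 2) / (4 * k ^ 2 - V ^ 2) ^ 2)) (v₀ := w)
    (v₁ := w1 D Λ k u) (v₂ := w2 D Λ k u) (δ := δ) (C := max C₁ C₂) (s := s)
    (φ₀ := u * k - Λ 0 u - 1 * k) (φ₁ := -(k ^ 2 / 2) / w ^ 2 + 1 / 8) (φ₂ := k ^ 2 / 2 / w ^ 3)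
    (ψ₁ := 3 / 2 * w⁻¹ - s * -(2 * w) / (s * (4 * k ^ 2 - w ^ 2)))
    (α₀ := 0 * k + Λ 1 u - Real.log a / 2 - Real.log (s * (u * (u - 1))))
    (α₁ := upsilon Λ 1 u + 0 / (u - 1))
    (ε₀ := min e₁ e₂) hw0 hδ (by positivity) hs0
    (fun ε hε V hV => by
      have hε0 := hε.1
      obtain ⟨g1, ρ, hρ, g2⟩ := h₂ ε ⟨hε0, hε.2.trans (min_le_right _ _)⟩ V hV
      refine ⟨ρ, hρ.trans (by gcongr; exact le_max_right _ _), ?_⟩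
      rw [g1] at g2
      simp only [hf]
      rw [div_eq_iff (hpre ε hε0).ne', mul_comm]
      exact g2)
    (fun ε hε => by
      have hε0 := hε.1
      obtain ⟨ρ, hρ, g⟩ := h₁ ε ⟨hε0, hε.2.trans (min_le_left _ _)⟩
      refine ⟨ρ, hρ.trans (by gcongr; exact le_max_left _ _), ?_⟩
      have e2 : (1 + 0 * ε) * k / ε = k / ε := by ring
      simp only [hcall ε hε0, e2] at g
      have e3 : 1 + 0 * ε = 1 := by ring
      rw [e3, one_mul] at g
      have hres' : ((if u < 1 then 1 else 0) - (if u < 0 then Real.exp (k / ε) else 0)) = res ε := by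
        simp only [hres, mul_ite, mul_one, mul_zero]
      rw [hres'] at g
      simp only [hc]
      rw [div_eq_iff (hpre ε hε0).ne', typeIICall_eq hmart, mul_comm]
      exact g)
    (isBigO_taylor_two (φ := fun V => (k - V / 2) ^ 2 / (2 * V)) (A := k ^ 2 / 2) (B := -k / 2) (D := 1 / 8) hw0
      (fun V hV => by field_simp; ring) hφ₀)
    (isBigO_taylor_one
      (AnalyticAt.sub (AnalyticAt.add analyticAt_const (AnalyticAt.mul analyticAt_const
        (AnalyticAt.log (by fun_prop) hw0)))
        (AnalyticAt.log (f := fun V => s * (4 * k ^ 2 - V ^ 2)) (by fun_prop) hsw))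
      ((((Real.hasDerivAt_log hw0.ne').const_mul (3 / 2)).const_add _).sub
        ((hda.const_mul s).log hsw.ne')))
    (isBigO_sub_of_differentiableAt
      (f := fun V => -(4 * V * (12 * k ^ 2 + V ^ 2) / (4 * k ^ 2 - V ^ 2) ^ 2))
      (DifferentiableAt.neg (DifferentiableAt.div (by fun_prop) (by fun_prop) (pow_ne_zero _ hkw))))
    (by
      intro h
      apply hkw
      field_simp at h
      linarith)
    (by
      have h1 : -(-(k ^ 2 / 2) / w ^ 2 + 1 / 8) = (4 * k ^ 2 - w ^ 2) / (8 * w ^ 2) := by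
        field_simp
        ring
      rw [hL, h1]
      generalize Real.log (s * (4 * k ^ 2 - w ^ 2)) = ℓ
      generalize 4 * k ^ 2 - w ^ 2 = q at hkw ⊢
      field_simp
      ring)
    (by
      have hkw' : w ^ 2 - 4 * k ^ 2 ≠ 0 := by rw [← neg_sub]; exact neg_ne_zero.2 hkw
      rw [w2, ← hw]
      generalize w1 D Λ k u = w₁
      have h1 : (-(k ^ 2 / 2) / w ^ 2 + 1 / 8) = (w ^ 2 - 4 * k ^ 2) / (8 * w ^ 2) := by
        field_simp; ring
      have h2 : 4 * k ^ 2 - w ^ 2 = -(w ^ 2 - 4 * k ^ 2) := by ring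
      rw [h1, h2]
      -- Only even powers of k occur, so k² can be eliminated in favour of q; the matching condition
      -- becomes a rational identity with denominators in w and q.
      generalize hq : w ^ 2 - 4 * k ^ 2 = q at hkw' ⊢
      have hk4 : k ^ 2 = (w ^ 2 - q) / 4 := by linarith
      have hk5 : k ^ 4 = ((w ^ 2 - q) / 4) ^ 2 := by rw [← hk4]; ring
      have hk6 : k ^ 6 = ((w ^ 2 - q) / 4) ^ 3 := by rw [← hk4]; ring
      rw [hk6, hk5, hk4]
      field_simp
      ring)
    (fun ε hε V hV V' hV' hVV' => by
      have hε0 := hε.1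
      simp only [hf]
      rw [div_lt_div_iff_of_pos_right (hpre ε hε0)]
      refine sub_lt_sub_right (strictMonoOn_bsTotal _ ?_ ?_ ?_) _
      · exact Real.sqrt_pos.2 (div_pos hV hε0)
      · exact Real.sqrt_pos.2 (div_pos hV' hε0)
      · exact Real.sqrt_lt_sqrt (div_pos hV hε0).le (by gcongr))
  refine ⟨K, hK, e₃, he₃, fun ε hε => ?_⟩
  have hε0 := hε.1
  obtain ⟨g1, g2, g3⟩ := h₃ ε hε
  obtain ⟨g4, g5⟩ := bracket_of_div (hpre ε hε0) g2 g3
  have hcoe : (((ε⁻¹).toNNReal : ℝ≥0) : ℝ) = ε⁻¹ := Real.coe_toNNReal _ (by positivity)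
  generalize (ε⁻¹).toNNReal = T at hcoe g4 g5 ⊢
  have hdiv : ∀ V : ℝ, V / ε = V * T := fun V => by rw [hcoe, div_eq_mul_inv]
  rw [hdiv (w + w1 D Λ k u * ε + w2 D Λ k u * ε ^ 2 - K * ε ^ 3)] at g4
  rw [hdiv (w + w1 D Λ k u * ε + w2 D Λ k u * ε ^ 2 + K * ε ^ 3)] at g5
  obtain ⟨g6, g7, g8⟩ := implied_vol_of_bracket (by rw [hcoe]; positivity) g1 g4 g5
    (by linarith [mul_pos hK (pow_pos hε0 3)])
  refine ⟨g6, ?_⟩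
  rw [← hw, abs_le]
  exact ⟨by unfold typeIIVol IsTypeIIVol; linarith, by unfold typeIIVol IsTypeIIVol; linarith⟩

/-- The large maturity expansion. -/
theorem large_expansion (hX0 : ∀ᵐ ω ∂P, X 0 ω = 0)
    (hmart : Martingale (fun s ω => Real.exp (X s ω)) ℱ P) {t : ℝ≥0} {Λ : Fin 3 → ℝ → ℝ}
    (hA : Assumptions (largeMeasure P X t) (largeProcess X t) Λ)
    {D : Set ℝ} (hD : D = D0int (largeMeasure P X t) (largeProcess X t)) (h1D : (1 : ℝ) ∈ D)
    (hΛ1 : Λ 0 1 = 0) {k u : ℝ} (hu : u ∈ D)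
    (hk : deriv (Λ 0) u = k) (hk0 : k ≠ deriv (Λ 0) 0) (hk1 : k ≠ deriv (Λ 0) 1) :
    ∃ K > 0, ∃ ε₁ > 0, ∀ ε ∈ Ioc 0 ε₁,
      (∃! σ : ℝ, IsTypeIIVol P X t (ε⁻¹).toNNReal (k / ε) σ) ∧
      |typeIIVol P X t (ε⁻¹).toNNReal (k / ε) ^ 2
        - (w0 D Λ k + w1 D Λ k u * ε + w2 D Λ k u * ε ^ 2)| ≤ K * ε ^ 3 := by
  have hΛ0 := hA.apply_zero fun ε _ => isProbabilityMeasure_sharePriceMeasure hX0 hmart _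
  have h0D : (0 : ℝ) ∈ D := hD ▸ hA.zero_mem
  have hconv : StrictConvexOn ℝ D (Λ 0) := hD ▸ hA.strictConvex
  have hdiff : ∀ x ∈ D, DifferentiableAt ℝ (Λ 0) x := fun x hx => hA.differentiableAt (hD ▸ hx)
  have hu0 : u ≠ 0 := by rintro rfl; exact hk0 hk.symm
  have hu1 : u ≠ 1 := by rintro rfl; exact hk1 hk.symm
  -- In order, the four tangents give Λ* > 0, Λ* − k > 0, Λ₀'(0) < 0 and Λ₀'(1) > 0. The first two
  -- make both square roots in w₀ positive, the last two fix the sign of k outside the middle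
  -- interval.
  have t0 := tangent_lt hconv hu h0D (hdiff u hu) hu0
  have t1 := tangent_lt hconv hu h1D (hdiff u hu) hu1
  have t2 := tangent_lt hconv h0D h1D (hdiff 0 h0D) zero_ne_one
  have t3 := tangent_lt hconv h1D h0D (hdiff 1 h1D) one_ne_zero
  rw [hk, hΛ0] at t0
  rw [hk, hΛ1] at t1
  rw [hΛ0, hΛ1] at t2 t3
  have hrate : rate D Λ k = u * k - Λ 0 u := by
    rw [← hk]
    exact rate_eq hconv hu (hdiff u hu)
  have hr0 : 0 < rate D Λ k := by rw [hrate]; linarith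
  have hrk : 0 < rate D Λ k - k := by rw [hrate]; linarith
  have hmono : ∀ {x y : ℝ}, x ∈ D → y ∈ D → x < y → deriv (Λ 0) x < deriv (Λ 0) y :=
    fun hx hy hxy => deriv_lt_deriv hconv hx hy (hdiff _ hx) (hdiff _ hy) hxy
  have hφ : ∀ {w : ℝ}, (k - w / 2) ^ 2 / (2 * w) = rate D Λ k - k →
      (k - w / 2) ^ 2 / (2 * w) = u * k - Λ 0 u - 1 * k := fun h => by rw [h, hrate, one_mul]
  have hu' : u ∈ D0int (largeMeasure P X t) (largeProcess X t) := hD ▸ hu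
  rcases lt_or_gt_of_ne hu0 with h | h
  -- The cases u < 0, 0 < u < 1 and u > 1 correspond to k lying left of, inside and right of
  -- (Λ₀'(0), Λ₀'(1)). In each, the root selected by w₀ makes 4k² − w² and u(u − 1) have equal sign
  -- and the residues of both sides coincide.
  · have hkn : k < deriv (Λ 0) 0 := hk ▸ hmono hu h0D h
    have hk' : k < 0 := by linarith
    obtain ⟨a1, a2, a3⟩ := w0_of_notMem (D := D) (fun hm => hm.1.not_gt hkn) hk'.ne hr0 hrk
    rw [abs_of_neg hk'] at a3
    refine large_expansion_of_leading hX0 hmart hA hu' hk hu0 hu1 rfl a1 (hφ a2) (s := 1) (Or.inl rfl)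
      ?_ ?_ ⟨fun _ => by linarith, fun _ => by linarith⟩ ⟨fun _ => h, fun _ => by linarith⟩
    · nlinarith
    · nlinarith
  · rcases lt_or_gt_of_ne hu1 with h' | h'
    · have hkm : k ∈ Ioo (deriv (Λ 0) 0) (deriv (Λ 0) 1) :=
        hk ▸ ⟨hmono h0D hu h, hmono hu h1D h'⟩
      obtain ⟨a1, a2, a3, a4⟩ := w0_of_mem (D := D) hkm hr0 hrk
      refine large_expansion_of_leading hX0 hmart hA hu' hk hu0 hu1 rfl a1 (hφ a2) (s := -1)
        (Or.inr rfl) ?_ ?_ ⟨fun _ => h', fun _ => a3⟩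
        ⟨fun hc => absurd hc a4.not_gt, fun hc => absurd hc h.not_gt⟩
      · nlinarith [mul_pos (sub_pos.2 a3) (sub_pos.2 a4)]
      · nlinarith [mul_pos h (sub_pos.2 h')]
    · have hkp : deriv (Λ 0) 1 < k := hk ▸ hmono h1D hu h'
      have hk' : 0 < k := by linarith
      obtain ⟨a1, a2, a3⟩ := w0_of_notMem (D := D) (fun hm => hm.2.not_gt hkp) hk'.ne' hr0 hrk
      rw [abs_of_pos hk'] at a3
      refine large_expansion_of_leading hX0 hmart hA hu' hk hu0 hu1 rfl a1 (hφ a2) (s := 1)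
        (Or.inl rfl) ?_ ?_ ⟨fun hc => absurd hc a3.not_gt, fun hc => absurd hc h'.not_gt⟩
        ⟨fun hc => by linarith, fun hc => absurd hc h.not_gt⟩
      · nlinarith
      · nlinarith [mul_pos h (sub_pos.2 h')]

end FwdSmile

end

/-- Expansions of the Type-II forward implied volatility. -/
theorem proposition2p14 {Ω : Type*} [mΩ : MeasurableSpace Ω] (P : Measure Ω)
    [IsProbabilityMeasure P] (ℱ : Filtration ℝ≥0 mΩ) (X : ℝ≥0 → Ω → ℝ)
    (hX0 : ∀ᵐ ω ∂P, X 0 ω = 0)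
    (hmart : Martingale (fun s ω => Real.exp (X s ω)) ℱ P) :
    (∀ (t τ : ℝ≥0) (Λ : Fin 3 → ℝ → ℝ), 0 < τ →
      FwdSmile.Assumptions (FwdSmile.diagMeasure P X t) (FwdSmile.diagProcess X t τ) Λ →
      deriv (Λ 0) 0 = 0 →
      ∀ D : Set ℝ, D = FwdSmile.D0int (FwdSmile.diagMeasure P X t) (FwdSmile.diagProcess X t τ) →
      ∀ k u : ℝ, u ∈ D → deriv (Λ 0) u = k → k ≠ 0 →
        (∀ᶠ ε : ℝ in 𝓝[>] 0,
          ∃! σ : ℝ, FwdSmile.IsTypeIIVol P X (ε.toNNReal * t) (ε.toNNReal * τ) k σ) ∧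
        (fun ε : ℝ =>
          FwdSmile.typeIIVol P X (ε.toNNReal * t) (ε.toNNReal * τ) k ^ 2
            - (FwdSmile.v0 D Λ τ k + FwdSmile.v1 D Λ τ k u * ε + FwdSmile.v2 D Λ τ k u * ε ^ 2))
          =O[𝓝[>] 0] fun ε : ℝ => ε ^ 3) ∧
    (∀ (t : ℝ≥0) (Λ : Fin 3 → ℝ → ℝ),
      FwdSmile.Assumptions (FwdSmile.largeMeasure P X t) (FwdSmile.largeProcess X t) Λ →
      ∀ D : Set ℝ, D = FwdSmile.D0int (FwdSmile.largeMeasure P X t) (FwdSmile.largeProcess X t) →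
      (1 : ℝ) ∈ D → Λ 0 1 = 0 →
      ∀ k u : ℝ, u ∈ D → deriv (Λ 0) u = k → k ≠ deriv (Λ 0) 0 → k ≠ deriv (Λ 0) 1 →
        (∀ᶠ τ : ℝ≥0 in atTop, ∃! σ : ℝ, FwdSmile.IsTypeIIVol P X t τ (k * τ) σ) ∧
        (fun τ : ℝ≥0 =>
          FwdSmile.typeIIVol P X t τ (k * τ) ^ 2
            - (FwdSmile.w0 D Λ k + FwdSmile.w1 D Λ k u / τ + FwdSmile.w2 D Λ k u / (τ : ℝ) ^ 2))
          =O[atTop] fun τ : ℝ≥0 => 1 / (τ : ℝ) ^ 3) := by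
  constructor
  · intro t τ Λ hτ hA hΛ D hD k u hu hk hk0
    obtain ⟨K, -, ε₁, hε₁, h⟩ := FwdSmile.diagonal_expansion hX0 hmart hτ hA hΛ hD hu hk hk0
    have hev : ∀ᶠ ε : ℝ in 𝓝[>] 0, ε ∈ Ioc 0 ε₁ := Ioc_mem_nhdsGT hε₁
    refine ⟨hev.mono fun ε hε => (h ε hε).1, Asymptotics.IsBigO.of_bound K ?_⟩
    filter_upwards [hev] with ε hε
    rw [Real.norm_eq_abs, Real.norm_of_nonneg (pow_pos hε.1 3).le]
    exact (h ε hε).2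
  · intro t Λ hA D hD h1 hΛ1 k u hu hk hk0 hk1
    obtain ⟨K, -, ε₁, hε₁, h⟩ := FwdSmile.large_expansion hX0 hmart hA hD h1 hΛ1 hu hk hk0 hk1
    have hev : ∀ᶠ τ : ℝ≥0 in atTop, 0 < (τ : ℝ) ∧ ((τ : ℝ)⁻¹) ∈ Ioc 0 ε₁ := by
      filter_upwards [eventually_ge_atTop (ε₁⁻¹).toNNReal] with τ hτ
      have h2 : ε₁⁻¹ ≤ τ := Real.toNNReal_le_iff_le_coe.1 hτ
      have h3 : 0 < (τ : ℝ) := (inv_pos.2 hε₁).trans_le h2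
      exact ⟨h3, inv_pos.2 h3, inv_le_of_inv_le₀ hε₁ h2⟩
    have h' : ∀ τ : ℝ≥0, 0 < (τ : ℝ) ∧ ((τ : ℝ)⁻¹) ∈ Ioc 0 ε₁ →
        (∃! σ : ℝ, FwdSmile.IsTypeIIVol P X t τ (k * τ) σ) ∧
        |FwdSmile.typeIIVol P X t τ (k * τ) ^ 2
          - (FwdSmile.w0 D Λ k + FwdSmile.w1 D Λ k u / τ + FwdSmile.w2 D Λ k u / (τ : ℝ) ^ 2)| ≤
          K * (1 / (τ : ℝ) ^ 3) := fun τ hτ => by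
      have := h _ hτ.2
      rwa [inv_inv, Real.toNNReal_coe, div_inv_eq_mul, ← div_eq_mul_inv, inv_pow, ← div_eq_mul_inv,
        inv_pow, ← one_div ((τ : ℝ) ^ 3)] at this
    refine ⟨hev.mono fun τ hτ => (h' τ hτ).1, Asymptotics.IsBigO.of_bound K ?_⟩
    filter_upwards [hev] with τ hτ
    rw [Real.norm_eq_abs, Real.norm_of_nonneg (by positivity)]
    exact (h' τ hτ).2
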